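/- Let $X$ be a Hausdorff sequentially complete locally convex space over $\mathbb{C}$ and $L(X)$ the space of continuous linear operators on $X$. For $\zeta>0$ put $m=\lceil\zeta\rceil$, $g_\beta(t)=t^{\beta-1}/\Gamma(\beta)$ for $\beta,t>0$, and $g_0=\delta$. The Caputo derivative $$\mathbf D_t^\zeta u=\frac{d^m}{dt^m}\Bigl[g_{m-\zeta}*\Bigl(u-\sum_{j=0}^{m-1}u^{(j)}(0)\,g_{j+1}\Bigr)\Bigr]$$ is defined for those $u\in C^{m-1}([0,\infty):X)$ for which the function in square brackets belongs to $C^{m}([0,\infty):X)$. For $\alpha\in(0,\pi]$ let $\Sigma_\alpha=\{z\neq 0:|\arg z|<\alpha\}$. Let $n\ge 1$, $0<\zeta\le 2$, let $q_0=0<q_1\le q_2\le\dots\le q_n$ be integers and let $A_0,\dots,A_n$ be closed linear operators on $X$. Consider the problem $$(\ast)\qquad \sum_{i=0}^{n}A_i(\mathbf D_t^\zeta)^{q_i}u(t)=0,\quad t\ge 0,$$ with the initial conditions $\bigl((\mathbf D_t^\zeta)^ju\bigr)(0)=u_j$ for $0\le j\le q_n-1$ and, if $1<\zeta\le 2$,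 also $\bigl(\tfrac{d}{dt}(\mathbf D_t^\zeta)^ju\bigr)(0)=v_j$ for $0\le j\le q_n-1$. A *strong solution* of $(\ast)$ is a function $u\in C([0,\infty):X)$ such that every term $A_i(\mathbf D_t^\zeta)^{q_i}u$ is well defined and continuous on $[0,\infty)$ and $(\ast)$ holds. A strong solution $u$ is an *entire solution* if $u$ and all terms $A_iu^{(p)}$ ($0\le i\le n$, $p\ge 0$) are well defined on $[0,\infty)$ and extend to entire functions; it is an *analytical solution on $\mathbb{C}\setminus(-\infty,0]$* if $u$ and all terms $A_i(\mathbf D_t^\zeta)^pu$ ($0\le i\le n$, $p\ge0$) are well defined on $[0,\infty)$ and extend to $\mathbb{C}$, analytically on $\mathbb{C}\setminus(-\infty,0]$ and continuously on $\mathbb{C}\setminus(-\infty,0)$. Let $C\in L(X)$ be injective with $CA_i\subseteq A_iC$ for $0\le i\le n$, and let $\phi\in(-\pi,\pi]$, $\theta\in(\pi-\pi\zeta,\ \pi-\pi\zeta/2)$, $r>0$. Let $\nu'\in\mathbb{R}$ satisfy $$\nu'<\min_{0\le\omega\le q_n-1}\Bigl[-\Bigl(q_n-1-\omega+\max\{q_j:\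 0\le j\le n,\ q_j-1<\omega\}\Bigr)\Bigr].$$ Put $\Lambda=\{\mu\in e^{i\phi}\Sigma_{\zeta\pi/2+\theta}:|\mu|\ge r\}$ and $\mathcal P_\mu=\sum_{i=0}^{n}\mu^{q_i}A_i$ with domain $\bigcap_{i=0}^nD(A_i)$. Assume: (i) for each $\mu\in\Lambda$ the operator $\mathcal P_\mu$ is injective and $\mathcal P_\mu^{-1}C\in L(X)$, and the family $\{(1+|\mu|)^{-\nu'}\mathcal P_\mu^{-1}C:\mu\in\Lambda\}$ is equicontinuous and strongly continuous in $\mu$; (ii) for each $0\le i\le n-1$, $A_i\mathcal P_\mu^{-1}C\in L(X)$ for all $\mu\in\Lambda$, the map $\mu\mapsto A_i\mathcal P_\mu^{-1}Cx$ is continuous on $\Lambda$ for every $x\in X$, and there is $v_i\in\mathbb{N}$ such that $\{(1+|\mu|)^{-v_i}A_i\mathcal P_\mu^{-1}C:\mu\in\Lambda\}$ is equicontinuous. Let $\mathfrak W$ (respectively $\mathfrak W_e$) be the set of all initial data, $(u_0,\dots,u_{q_n-1})\in X^{q_n}$ if $0<\zeta\le 1$ and $(u_0,\dots,u_{q_n-1};v_0,\dots,v_{q_n-1})\in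 X^{2q_n}$ if $1<\zeta\le 2$, of analytical solutions of $(\ast)$ on $\mathbb{C}\setminus(-\infty,0]$ (respectively, of entire solutions of $(\ast)$). Write $E=C\bigl(\bigcap_{j=0}^nD(A_j)\bigr)$, and let closures be taken in the product topology of $X^{q_n}$, respectively $X^{2q_n}$. Then $\mathfrak W$ is dense in $E^{q_n}$ if $0<\zeta<1$ and in $E^{2q_n}$ if $1<\zeta<2$; that is, $E^{q_n}\subseteq\overline{\mathfrak W}$, respectively $E^{2q_n}\subseteq\overline{\mathfrak W}$. Moreover $\mathfrak W_e$ is dense in $E^{q_n}$ if $\zeta=1$ and in $E^{2q_n}$ if $\zeta=2$; that is, $E^{q_n}\subseteq\overline{\mathfrak W_e}$, respectively $E^{2q_n}\subseteq\overline{\mathfrak W_e}$. -/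

import Mathlib

open Set Filter Topology

namespace MultiTermCaputo

noncomputable section

/-! ### Locally convex spaces, sectors and analytic functions -/

/-- Sequential completeness: every Cauchy sequence converges. -/
def SeqComplete (X : Type*) [UniformSpace X] : Prop :=
  ∀ u : ℕ → X, CauchySeq u → ∃ x, Tendsto u atTop (𝓝 x)

/-- The sector `Σ_α = {z ≠ 0 : |arg z| < α}`. -/
def sector (α : ℝ) : Set ℂ := {z | z ≠ 0 ∧ |z.arg| < α}

/-- The part `{μ ∈ e^{iφ} Σ_α : |μ| ≥ r}` of the rotated sector. -/
def truncatedSector (φ α r : ℝ) : Set ℂ :=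
  {μ | (∃ z ∈ sector α, μ = Complex.exp (Complex.I * φ) * z) ∧ r ≤ ‖μ‖}

section Analytic

variable {X : Type*} [AddCommGroup X] [Module ℂ X] [UniformSpace X]

/-- `f` is analytic on the open set `Ω`: near each point of `Ω` it is the sum of a uniformly
convergent power series with coefficients in `X`. -/
def IsAnalyticOn (f : ℂ → X) (Ω : Set ℂ) : Prop :=
  ∀ z₀ ∈ Ω, ∃ c : ℕ → X, ∃ ρ : ℝ, 0 < ρ ∧
    TendstoUniformlyOn (fun N z => ∑ k ∈ Finset.range N, (z - z₀) ^ k • c k) f atTop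
      (Metric.ball z₀ ρ)

/-- The function `f` on `[0,∞)` has an extension to `ℂ` that is analytic on `ℂ ∖ (-∞,0]` and
continuous on `ℂ ∖ (-∞,0)`. -/
def ExtendsToSlitPlane (f : ℝ → X) : Prop :=
  ∃ F : ℂ → X, (∀ t : ℝ, 0 ≤ t → F t = f t) ∧
    IsAnalyticOn F {z : ℂ | ∀ s : ℝ, s ≤ 0 → z ≠ s} ∧
    ContinuousOn F {z : ℂ | ∀ s : ℝ, s < 0 → z ≠ s}

/-- The function `f` on `[0,∞)` has an extension that is analytic on all of `ℂ`. -/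
def ExtendsToEntire (f : ℝ → X) : Prop :=
  ∃ F : ℂ → X, (∀ t : ℝ, 0 ≤ t → F t = f t) ∧ IsAnalyticOn F univ

end Analytic

/-- A complex topological vector space is also a real one. -/
instance instContinuousSMulReal {X : Type*} [AddCommGroup X] [Module ℂ X] [TopologicalSpace X]
    [ContinuousSMul ℂ X] : ContinuousSMul ℝ X :=
  ⟨((Complex.continuous_ofReal.comp continuous_fst).smul continuous_snd :
    Continuous fun p : ℝ × X => ((p.1 : ℝ) : ℂ) • p.2)⟩

/-! ### Caputo derivatives on `[0,∞)`

Functions on `[0,∞)` are represented by functions on `ℝ`, of which only the values on `[0,∞)`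
matter. -/

section Caputo

variable {X : Type*} [AddCommGroup X] [Module ℂ X] [TopologicalSpace X] [ContinuousSMul ℂ X]

/-- `v = u^{(p)}` on `[0,∞)` (with one-sided derivatives at `0`). -/
def IsIterDeriv : ℕ → (ℝ → X) → (ℝ → X) → Prop
  | 0, u, v => EqOn u v (Ici 0)
  | p + 1, u, v => ∃ w : ℝ → X, IsIterDeriv p u w ∧
      ∀ t : ℝ, 0 ≤ t → HasDerivWithinAt w (v t) (Ici 0) t

/-- `w = g_β ∗ f` on `[0,∞)` for continuous `f`, where `g_β(t) = t^{β-1}/Γ(β)` for `β > 0` and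
`g_0` is the Dirac distribution. The vector-valued integral `∫₀ᵗ g_β(t-s) f(s) ds` is the weak one:
the continuous linear functionals separate the points of a Hausdorff locally convex space. -/
def IsFracConv (β : ℝ) (f w : ℝ → X) : Prop :=
  if β = 0 then EqOn w f (Ici 0)
  else ∀ t : ℝ, 0 ≤ t → ∀ ℓ : X →L[ℂ] ℂ,
    ℓ (w t) = ∫ s in (0 : ℝ)..t, (((t - s) ^ (β - 1) / Real.Gamma β : ℝ) : ℂ) * ℓ (f s)

/-- The Caputo derivative `D_t^ζ u` is defined and equals `v` on `[0,∞)` (`ζ > 0`). With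
`m = ⌈ζ⌉`: `u ∈ C^{m-1}([0,∞) : X)` with `c j = u^{(j)}(0)`, the function
`w = g_{m-ζ} ∗ (u - ∑_{j<m} u^{(j)}(0) g_{j+1})` lies in `C^m([0,∞) : X)`, and `v = w^{(m)}`. -/
def IsCaputoDeriv (ζ : ℝ) (u v : ℝ → X) : Prop :=
  ∃ (c : ℕ → X) (w : ℝ → X),
    (∀ j < ⌈ζ⌉₊, ∃ d : ℝ → X, IsIterDeriv j u d ∧ ContinuousOn d (Ici 0) ∧ d 0 = c j) ∧
    IsFracConv (⌈ζ⌉₊ - ζ)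
      (fun t => u t - ∑ j ∈ Finset.range ⌈ζ⌉₊, (t ^ j / (j.factorial : ℝ)) • c j) w ∧
    IsIterDeriv ⌈ζ⌉₊ w v ∧ ContinuousOn v (Ici 0)

/-- The `p`-fold iterate `(D_t^ζ)^p u` is defined and equals `v` on `[0,∞)`. -/
def IsIterCaputo (ζ : ℝ) : ℕ → (ℝ → X) → (ℝ → X) → Prop
  | 0, u, v => EqOn u v (Ici 0)
  | p + 1, u, v => ∃ w : ℝ → X, IsIterCaputo ζ p u w ∧ IsCaputoDeriv ζ w v

end Caputo

/-! ### The multi-term problem -/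

section Problem

variable {X : Type*} [AddCommGroup X] [Module ℂ X]

/-- The operator `∑_{i=0}^{n} μ^{q i} A_i` with its natural domain `⋂_i D(A_i)`. -/
def pencil {n : ℕ} (q : Fin (n + 1) → ℕ) (A : Fin (n + 1) → X →ₗ.[ℂ] X) (μ : ℂ) :
    X →ₗ.[ℂ] X where
  domain := ⨅ i, (A i).domain
  toFun := ∑ i, μ ^ q i • (A i).toFun ∘ₗ Submodule.inclusion (iInf_le _ i)

variable [UniformSpace X]

/-- `P` is injective, `P⁻¹ C` is everywhere defined and equals the continuous operator `R`. -/
def IsRegularizedInverse (P : X →ₗ.[ℂ] X) (C R : X →L[ℂ] X) : Prop :=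
  (∀ x : P.domain, P x = 0 → x = 0) ∧ ∀ x : X, (R x, C x) ∈ P.graph

variable [ContinuousSMul ℂ X]

/-- `u` is a strong solution of `∑ A_i (D_t^ζ)^{q i} u(t) = 0`, `t ≥ 0`: it is continuous, each
term `A_i (D_t^ζ)^{q i} u` is well defined and continuous on `[0,∞)`, and their sum vanishes. -/
def IsStrongSolution {n : ℕ} (ζ : ℝ) (q : Fin (n + 1) → ℕ) (A : Fin (n + 1) → X →ₗ.[ℂ] X)
    (u : ℝ → X) : Prop :=
  ContinuousOn u (Ici 0) ∧
  ∃ T : Fin (n + 1) → ℝ → X,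
    (∀ i, ∃ v : ℝ → X, IsIterCaputo ζ (q i) u v ∧
      ∀ t : ℝ, 0 ≤ t → (v t, T i t) ∈ (A i).graph) ∧
    (∀ i, ContinuousOn (T i) (Ici 0)) ∧
    ∀ t : ℝ, 0 ≤ t → ∑ i, T i t = 0

/-- An analytical solution on `ℂ ∖ (-∞,0]`: a strong solution such that `u` and every term
`A_i (D_t^ζ)^p u` (which is required to be well defined) extend to `ℂ`, analytically on
`ℂ ∖ (-∞,0]` and continuously on `ℂ ∖ (-∞,0)`. -/
def IsAnalyticalSolution {n : ℕ} (ζ : ℝ) (q : Fin (n + 1) → ℕ) (A : Fin (n + 1) → X →ₗ.[ℂ] X)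
    (u : ℝ → X) : Prop :=
  IsStrongSolution ζ q A u ∧ ExtendsToSlitPlane u ∧
  ∀ (i : Fin (n + 1)) (p : ℕ), ∃ v T : ℝ → X, IsIterCaputo ζ p u v ∧
    (∀ t : ℝ, 0 ≤ t → (v t, T t) ∈ (A i).graph) ∧ ExtendsToSlitPlane T

/-- An entire solution: a strong solution such that `u` and every term `A_i u^{(p)}` extend to
entire functions. -/
def IsEntireSolution {n : ℕ} (ζ : ℝ) (q : Fin (n + 1) → ℕ) (A : Fin (n + 1) → X →ₗ.[ℂ] X)
    (u : ℝ → X) : Prop :=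
  IsStrongSolution ζ q A u ∧ ExtendsToEntire u ∧
  ∀ (i : Fin (n + 1)) (p : ℕ), ∃ v T : ℝ → X, IsIterDeriv p u v ∧
    (∀ t : ℝ, 0 ≤ t → (v t, T t) ∈ (A i).graph) ∧ ExtendsToEntire T

/-- The initial conditions `((D_t^ζ)^j u)(0) = x j` for `0 ≤ j < N`. -/
def HasInitialValues (ζ : ℝ) {N : ℕ} (u : ℝ → X) (x : Fin N → X) : Prop :=
  ∀ j : Fin N, ∃ v : ℝ → X, IsIterCaputo ζ j u v ∧ v 0 = x j

/-- The initial conditions `(d/dt (D_t^ζ)^j u)(0) = y j` for `0 ≤ j < N`. -/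
def HasInitialSlopes (ζ : ℝ) {N : ℕ} (u : ℝ → X) (y : Fin N → X) : Prop :=
  ∀ j : Fin N, ∃ v : ℝ → X, IsIterCaputo ζ j u v ∧ HasDerivWithinAt v (y j) (Ici 0) 0

/-- Initial data of the solutions satisfying `Sol`, for orders `0 < ζ ≤ 1`. -/
def initialData (ζ : ℝ) (N : ℕ) (Sol : (ℝ → X) → Prop) : Set (Fin N → X) :=
  {x | ∃ u : ℝ → X, Sol u ∧ HasInitialValues ζ u x}

/-- Initial data of the solutions satisfying `Sol`, for orders `1 < ζ ≤ 2`. -/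
def initialData₂ (ζ : ℝ) (N : ℕ) (Sol : (ℝ → X) → Prop) : Set ((Fin N → X) × (Fin N → X)) :=
  {p | ∃ u : ℝ → X, Sol u ∧ HasInitialValues ζ u p.1 ∧ HasInitialSlopes ζ u p.2}

/-- The subspace `C (⋂_j D(A_j))`. -/
def imageOfDomains {n : ℕ} (A : Fin (n + 1) → X →ₗ.[ℂ] X) (C : X →L[ℂ] X) : Set X :=
  C '' {x | ∀ j, x ∈ (A j).domain}

/-- The set `S_ω = {j : q j - 1 ≥ ω}`. -/
def indexSet {n : ℕ} (q : Fin (n + 1) → ℕ) (ω : ℕ) : Set (Fin (n + 1)) :=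
  {j | (ω : ℤ) ≤ (q j : ℤ) - 1}

/-- `ν < min_{0 ≤ ω ≤ q_n - 1} [-(q_n - 1 - ω + max {q_j : j ∉ S_ω})]`; the minimum and the
maximum are over finite nonempty sets (when `q 0 = 0 < q_n`), so they are unfolded. -/
def GrowthExponent {n : ℕ} (q : Fin (n + 1) → ℕ) (ν : ℝ) : Prop :=
  ∀ ω < q (Fin.last n), ∀ j ∉ indexSet q ω,
    ν < -((q (Fin.last n) : ℝ) - 1 - ω + q j)

end Problem

end

end MultiTermCaputo

open MultiTermCaputo

/-! The proof is by duality. Every sequence `y` with `∑ A_i y_{k + q i} = 0` for all `k` and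
moderate growth gives the solution `u(t) = ∑ t^{ζk}/Γ(ζk+1) y_k`. On such series `D_t^ζ` is the
shift of coefficients, so the initial values are `y_0, y_1, …`. Adding `∑ t^{ζk+1}/Γ(ζk+2) z_k` for
a second sequence `z` of the same kind prescribes the slopes independently. The series in `t^ζ` have
entire sums, which gives the analytic extensions. It remains to show that the initial segments of
length `q_n` of these sequences, which form a subspace (`solutionData`), are dense in `E^{q_n}`.

Sequences come from moments of the resolvent. Put `λ(w) = e^{iφ}(a - w)` and `y_k = ∫ exp(-ε w^b)
λ^k R(λ) z dw` over the boundary of the sector `|arg w| ≤ β`. The angle `β` is such that `λ` maps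
the complementary sector into the interior of `Λ`, and `1/ζ < b < π/(2β)`. The lower bound on `b`
makes the moments small against `Γ(ζk+1)`. The upper bound makes the kernel decay inside the sector,
so that `∑ A_i y_{k + q i} = ∫ exp(-ε w^b) λ^k C z dw = 0` by Cauchy's theorem
(`exists_isSolutionSeq`).

By Hahn–Banach, let the functional `ℓ = (L_k)` vanish on all such data, and let `ξ ∈ ⋂ D(A_j)`.
Multiply `∑_j λ^{q_j} R(λ) A_j ξ = C ξ` by `λ^{k-1-ω}`, apply `L_k`, integrate against the kernel
and sum over `k`. On the left, the terms with `q_j > ω` are values of `ℓ` on data of solutions and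
vanish. For `q_j ≤ ω` the bound on `ν` makes the integrand decay faster than `1/|w|`, and as `ε → 0`
the integral tends to an integral without kernel, which is zero by Cauchy's theorem outside the
sector. On the right, the powers other than `λ^{-1}` contribute nothing in the limit, while `λ^{-1}`
contributes `κ L_ω(C ξ)` with `κ ≠ 0`. Hence `L_ω(C ξ) = 0` for every `ω`
(`functional_single_eq_zero`).

Since `X` is only sequentially complete, integrals and sums are built weakly as limits of sequences.
Scalar estimates uniform over all `ℓ` with `|ℓ| ≤ p` become estimates in the seminorm `p` by
Hahn–Banach. -/

namespace MultiTermCaputo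

/-! ### Locally convex spaces seen through seminorms and functionals -/

section Seminorms

variable {V : Type*} [AddCommGroup V] [Module ℂ V]

open scoped ComplexOrder in
-- The nonnegative elements of `ℂ` in the order of `ComplexOrder` are the nonnegative reals, so
-- convexity over `ℂ` is the same as convexity over `ℝ`.
theorem locallyConvexSpace_complex [TopologicalSpace V] [IsTopologicalAddGroup V]
    [ContinuousSMul ℂ V] [LocallyConvexSpace ℝ V] : LocallyConvexSpace ℂ V := by
  refine ⟨fun x => ?_⟩
  refine (LocallyConvexSpace.convex_basis (𝕜 := ℝ) x).to_hasBasis (fun s hs => ?_) fun s hs => ?_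
  · refine ⟨s, ⟨hs.1, convex_of_nonneg_surjective_algebraMap ℂ (fun c hc => ?_) hs.2⟩, subset_rfl⟩
    obtain ⟨r, hr, rfl⟩ := RCLike.nonneg_iff_exists_ofReal.mp (show (0 : ℂ) ≤ c from hc)
    exact ⟨r, hr, rfl⟩
  · exact ⟨s, ⟨hs.1, hs.2.lift ℝ⟩, subset_rfl⟩

open scoped ComplexOrder in
theorem polynormableSpace_complex [TopologicalSpace V] [IsTopologicalAddGroup V]
    [ContinuousSMul ℂ V] [LocallyConvexSpace ℝ V] : PolynormableSpace ℂ V := by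
  have := locallyConvexSpace_complex (V := V)
  infer_instance

section Topological

variable [TopologicalSpace V] [IsTopologicalAddGroup V] [ContinuousSMul ℂ V]
  [LocallyConvexSpace ℝ V]

theorem tendsto_iff_forall_seminorm {ι : Type*} {l : Filter ι} {u : ι → V} {x : V} :
    Tendsto u l (𝓝 x) ↔
      ∀ p : Seminorm ℂ V, Continuous p → Tendsto (fun i => p (u i - x)) l (𝓝 0) := by
  have := polynormableSpace_complex (V := V)
  rw [(PolynormableSpace.withSeminorms ℂ V).tendsto_nhds]
  constructor
  · intro h p hp
    rw [Metric.tendsto_nhds]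
    intro ε hε
    filter_upwards [h ⟨p, hp⟩ ε hε] with i hi
    simpa [abs_of_nonneg (apply_nonneg p _)] using hi
  · intro h p ε hε
    filter_upwards [(h p.1 p.2).eventually (gt_mem_nhds hε)] with i hi using hi

open scoped ComplexOrder in
theorem exists_seminorm_ball_subset {U : Set V} (hU : U ∈ 𝓝 (0 : V)) :
    ∃ p : Seminorm ℂ V, Continuous p ∧ p.ball 0 1 ⊆ U := by
  have := locallyConvexSpace_complex (V := V)
  obtain ⟨s, hs, hsU⟩ := (nhds_hasBasis_absConvex_open ℂ V).mem_iff.1 hU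
  let S : AbsConvexOpenSets ℂ V := ⟨s, hs⟩
  exact ⟨gaugeSeminormFamily ℂ V S, with_gaugeSeminormFamily.continuous_seminorm _,
    (gaugeSeminormFamily_ball S).subset.trans hsU⟩

/-- Hahn–Banach: the functional `c • y ↦ c p(y)` on the line through `y` is dominated by `p` and
extends. This is the passage from scalar estimates, uniform in `ℓ`, to seminorm estimates. -/
theorem seminorm_le_of_forall_functional {p : Seminorm ℂ V} (hp : Continuous p) {y : V} {M : ℝ}
    (h : ∀ ℓ : V →L[ℂ] ℂ, (∀ x, ‖ℓ x‖ ≤ p x) → ‖ℓ y‖ ≤ M) : p y ≤ M := by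
  have := polynormableSpace_complex (V := V)
  by_cases hy : y = 0
  · have := h 0 (by simp)
    simpa [hy] using this
  let f : Module.Dual ℂ (ℂ ∙ y) :=
    ((p y : ℂ)) • (LinearEquiv.toSpanNonzeroSingleton ℂ V y hy).symm.toLinearMap
  have hf : ∀ c : ℂ, f ⟨c • y, Submodule.smul_mem _ _ (Submodule.mem_span_singleton_self y)⟩ =
      p y * c := by
    intro c
    have : (LinearEquiv.toSpanNonzeroSingleton ℂ V y hy).symm
        ⟨c • y, Submodule.smul_mem _ _ (Submodule.mem_span_singleton_self y)⟩ = c := by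
      rw [LinearEquiv.symm_apply_eq]
      rfl
    simp [f, this]
  obtain ⟨g, hg, hgp⟩ := Module.Dual.exists_continuous_extension_of_le_seminorm (ℂ ∙ y) f hp
    (by
      rintro ⟨x, hx⟩
      obtain ⟨c, rfl⟩ := Submodule.mem_span_singleton.1 hx
      rw [hf]
      simp [map_smul_eq_mul, mul_comm, abs_of_nonneg (apply_nonneg p y)])
  have h1 := h g hgp
  have h2 : g y = p y := by
    have := hg ⟨(1 : ℂ) • y, Submodule.smul_mem _ _ (Submodule.mem_span_singleton_self y)⟩
    rw [hf] at this
    simpa using this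
  simpa [h2, abs_of_nonneg (apply_nonneg p y)] using h1

theorem mem_closure_of_forall_functional (S : Submodule ℂ V) {x : V}
    (h : ∀ ℓ : V →L[ℂ] ℂ, (∀ y ∈ S, ℓ y = 0) → ℓ x = 0) : x ∈ closure (S : Set V) := by
  by_contra hx
  have hc : Convex ℝ (closure (S : Set V)) :=
    (S.restrictScalars ℝ).convex.closure
  obtain ⟨f, u, hu, hux⟩ :=
    RCLike.geometric_hahn_banach_closed_point (𝕜 := ℂ) hc isClosed_closure hx
  have h0 : ∀ y ∈ S, f y = 0 := by
    intro y hy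
    by_contra hne
    have hu0 := hu 0 (subset_closure S.zero_mem)
    -- A functional whose real part is bounded by `u` on a subspace vanishes there: otherwise this
    -- multiple of `y` is sent to `u + 1`.
    have h1 := hu _ (subset_closure (S.smul_mem ((u + 1 : ℂ) / f y) hy))
    rw [map_smul, smul_eq_mul, div_mul_cancel₀ _ hne] at h1
    simp at h1
    linarith
  have h1 := h f h0
  have hu0 := hu 0 (subset_closure S.zero_mem)
  rw [h1] at hux
  simp at hux hu0
  linarith

theorem eq_zero_of_forall_functional [T2Space V] {x : V} (h : ∀ ℓ : V →L[ℂ] ℂ, ℓ x = 0) :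
    x = 0 := by
  have := mem_closure_of_forall_functional (⊥ : Submodule ℂ V) (x := x) fun ℓ _ => h ℓ
  simpa using this

theorem eq_of_forall_functional [T2Space V] {x y : V} (h : ∀ ℓ : V →L[ℂ] ℂ, ℓ x = ℓ y) :
    x = y := by
  refine sub_eq_zero.1 (eq_zero_of_forall_functional fun ℓ => ?_)
  rw [map_sub, h, sub_self]

open scoped Pointwise in
/-- A weakly differentiable function whose weak derivative is continuous is differentiable. -/
theorem hasDerivWithinAt_of_forall_functional {u v : ℝ → V} {s : Set ℝ} (hs : Convex ℝ s)
    (hv : ContinuousOn v s)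
    (h : ∀ ℓ : V →L[ℂ] ℂ, ∀ t ∈ s, HasDerivWithinAt (fun x => ℓ (u x)) (ℓ (v t)) s t)
    {t : ℝ} (ht : t ∈ s) : HasDerivWithinAt u (v t) s t := by
  refine ⟨⟨fun U hU => ?_⟩⟩
  obtain ⟨p, hp, hpU⟩ := exists_seminorm_ball_subset hU
  refine ⟨Metric.ball 0 1, Metric.ball_mem_nhds _ one_pos, fun ε hε => ?_⟩
  have hε' : (0 : ℝ) < ε := by positivity
  have hev : ∀ᶠ x in 𝓝[s] t, p (v x - v t) < ε / 2 :=
    ((tendsto_iff_forall_seminorm.1 (hv t ht)) p hp).eventually (gt_mem_nhds (by positivity))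
  obtain ⟨δ, hδ, hball⟩ := Metric.mem_nhdsWithin_iff.1 hev
  -- The mean value inequality is applied to `ℓ ∘ u` minus its linear part, with a constant that is
  -- the same for all `ℓ` dominated by `p`.
  have hmain : ∀ᶠ x in 𝓝[s] t,
      p (u x - u t - (x - t) • v t) ≤ ε / 2 * |x - t| := by
    filter_upwards [self_mem_nhdsWithin, mem_nhdsWithin_of_mem_nhds (Metric.ball_mem_nhds t hδ)]
      with x hx hxδ
    refine seminorm_le_of_forall_functional hp fun ℓ hℓ => ?_
    have hconv : Convex ℝ (s ∩ Metric.ball t δ) := hs.inter (convex_ball t δ)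
    have hsub : s ∩ Metric.ball t δ ⊆ s := inter_subset_left
    have := hconv.norm_image_sub_le_of_norm_hasDerivWithin_le
      (f := fun y => ℓ (u y) - (y - t : ℝ) • ℓ (v t)) (f' := fun y => ℓ (v y) - ℓ (v t))
      (C := ε / 2) (x := t) (y := x) (fun y hy => by
        have h1 := (h ℓ y hy.1).mono hsub
        have h2 : HasDerivWithinAt (fun y : ℝ => (y - t : ℝ) • ℓ (v t)) ((1 : ℝ) • ℓ (v t))
            (s ∩ Metric.ball t δ) y :=
          (((hasDerivAt_id y).sub_const t).smul_const _).hasDerivWithinAt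
        simpa [Pi.sub_def] using h1.sub h2)
      (fun y hy => by
        rw [← map_sub]
        exact (hℓ _).trans (hball ⟨hy.2, hy.1⟩).le)
      ⟨ht, Metric.mem_ball_self hδ⟩ ⟨hx, hxδ⟩
    rw [map_sub, map_sub]
    have h3 : ℓ ((x - t) • v t) = (x - t) • ℓ (v t) := by
      rw [← Complex.coe_smul, map_smul, Complex.coe_smul]
    rw [h3]
    simpa [sub_sub, add_comm] using this
  rw [prod_pure, Filter.EventuallyLE, Filter.eventually_map]
  filter_upwards [hmain] with x hx
  have hlin : (ContinuousLinearMap.toSpanSingleton ℝ (v t)) (x - t) = (x - t) • v t := rfl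
  simp only [hlin]
  refine (egauge_anti ℝ hpU _).trans ?_
  rcases eq_or_ne x t with rfl | hne
  · have h0 : egauge ℝ (p.ball 0 1) (0 : V) = 0 :=
      egauge_zero_right ℝ ⟨0, by simp⟩
    simp [h0]
  have hc : (ε : ℝ) * (x - t) ≠ 0 := mul_ne_zero hε'.ne' (sub_ne_zero.2 hne)
  have habs : 0 < |x - t| := abs_pos.2 (sub_ne_zero.2 hne)
  -- The spare factor `1/2` in `hmain` gives the strict inequality needed for the open ball.
  have hmem : u x - u t - (x - t) • v t ∈ ((ε : ℝ) * (x - t)) • p.ball 0 1 := by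
    rw [mem_smul_set_iff_inv_smul_mem₀ hc, Seminorm.mem_ball_zero, ← Complex.coe_smul,
      map_smul_eq_mul, Complex.norm_real, norm_inv, norm_mul, Real.norm_eq_abs, Real.norm_eq_abs,
      abs_of_pos hε', inv_mul_lt_iff₀ (by positivity)]
    nlinarith
  refine (egauge_le_of_mem_smul hmem).trans ?_
  rw [enorm_mul]
  gcongr
  · simp
  · exact le_egauge_ball_one ℝ _

end Topological

section Uniform

variable [UniformSpace V] [IsUniformAddGroup V]

theorem mem_uniformity_of_seminorm {p : Seminorm ℂ V} (hp : Continuous p) :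
    {q : V × V | p (q.2 - q.1) < 1} ∈ uniformity V := by
  rw [uniformity_eq_comap_nhds_zero]
  refine ⟨{x | p x < 1}, ?_, fun q hq => hq⟩
  exact hp.continuousAt.eventually (gt_mem_nhds (by simp))

variable [ContinuousSMul ℂ V]

/-- Equicontinuity at `0` gives one `δ > 0` for which all images of `δ • x` have `p` less than `1`;
by homogeneity `δ⁻¹` is a bound. -/
theorem exists_seminorm_le_of_equicontinuous {ι : Type*} {T : ι → V →L[ℂ] V} {c : ι → ℝ}
    (h : Equicontinuous fun (i : ι) (x : V) => c i • T i x) {p : Seminorm ℂ V} (hp : Continuous p)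
    (x : V) : ∃ M, ∀ i, |c i| * p (T i x) ≤ M := by
  have h0 := h 0 _ (mem_uniformity_of_seminorm hp)
  have hlim : Tendsto (fun δ : ℝ => (δ : ℂ) • x) (𝓝[>] 0) (𝓝 0) := by
    have : Continuous fun δ : ℝ => (δ : ℂ) • x := by fun_prop
    exact (this.tendsto' 0 0 (by simp)).mono_left nhdsWithin_le_nhds
  obtain ⟨δ, hδ, hpos⟩ := ((hlim.eventually h0).and self_mem_nhdsWithin).exists
  have hpos : 0 < δ := hpos
  refine ⟨δ⁻¹, fun i => ?_⟩
  have h1 := hδ i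
  simp only [map_zero, smul_zero, sub_zero, mem_ofPred_eq, map_smul] at h1
  rw [← Complex.coe_smul, map_smul_eq_mul, map_smul_eq_mul, Complex.norm_real, Complex.norm_real,
    Real.norm_eq_abs, Real.norm_eq_abs, abs_of_pos hpos] at h1
  rw [← one_div, le_div_iff₀ hpos]
  linarith

variable [LocallyConvexSpace ℝ V]

theorem exists_seminorm_of_mem_uniformity {U : Set (V × V)} (hU : U ∈ uniformity V) :
    ∃ p : Seminorm ℂ V, Continuous p ∧ ∀ x y, p (x - y) < 1 → (x, y) ∈ U := by
  rw [uniformity_eq_comap_nhds_zero_swapped V, mem_comap] at hU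
  obtain ⟨W, hW, hWU⟩ := hU
  obtain ⟨p, hp, hpW⟩ := exists_seminorm_ball_subset hW
  exact ⟨p, hp, fun x y hxy => hWU (hpW (by simpa [Seminorm.mem_ball_zero] using hxy))⟩

theorem cauchySeq_of_seminorm {u : ℕ → V} (h : ∀ p : Seminorm ℂ V, Continuous p →
    ∀ ε > 0, ∃ N, ∀ m ≥ N, ∀ n ≥ N, p (u m - u n) ≤ ε) : CauchySeq u := by
  rw [cauchySeq_iff]
  intro U hU
  obtain ⟨p, hp, hpU⟩ := exists_seminorm_of_mem_uniformity hU
  obtain ⟨N, hN⟩ := h p hp (1 / 2) (by norm_num)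
  exact ⟨N, fun m hm n hn => hpU _ _ ((hN m hm n hn).trans_lt (by norm_num))⟩

theorem tendstoUniformlyOn_of_seminorm {ι : Type*} {F : ℕ → ι → V} {f : ι → V} {s : Set ι}
    (h : ∀ p : Seminorm ℂ V, Continuous p →
      ∃ b : ℕ → ℝ, Tendsto b atTop (𝓝 0) ∧ ∀ n, ∀ x ∈ s, p (f x - F n x) ≤ b n) :
    TendstoUniformlyOn F f atTop s := by
  intro U hU
  obtain ⟨p, hp, hpU⟩ := exists_seminorm_of_mem_uniformity hU
  obtain ⟨b, hb, hfb⟩ := h p hp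
  filter_upwards [hb.eventually (gt_mem_nhds one_pos)] with n hn x hx
  exact hpU _ _ ((hfb n x hx).trans_lt hn)

end Uniform
end Seminorms

section

open MeasureTheory

/-! ### Weak integrals in sequentially complete spaces -/

section WeakIntegral

/-- The error depends on `h` only through its oscillation at scale `1 / N`, so it is uniform over
all `ℓ ∘ g` with `ℓ` dominated by a given seminorm. -/
theorem norm_riemannSum_sub_integral_le {h : ℝ → ℂ} (hc : Continuous h) {N : ℕ} (hN : 0 < N)
    {ω : ℝ} (hω : ∀ x ∈ Icc (0 : ℝ) 1, ∀ y ∈ Icc (0 : ℝ) 1, |x - y| ≤ 1 / N → ‖h x - h y‖ ≤ ω) :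
    ‖((N : ℂ)⁻¹ * ∑ j ∈ Finset.range N, h (j / N)) - ∫ x in (0 : ℝ)..1, h x‖ ≤ ω := by
  have hN' : (0 : ℝ) < N := by exact_mod_cast hN
  have hsum : ∫ x in (0 : ℝ)..1, h x =
      ∑ j ∈ Finset.range N, ∫ x in ((j : ℝ) / N)..((j + 1 : ℕ) : ℝ) / N, h x := by
    rw [intervalIntegral.sum_integral_adjacent_intervals (a := fun j : ℕ => (j : ℝ) / N)
      (fun k _ => hc.intervalIntegrable _ _)]
    simp [hN'.ne']
  have hconst : ∀ j : ℕ, (N : ℂ)⁻¹ * h (j / N) =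
      ∫ x in ((j : ℝ) / N)..((j + 1 : ℕ) : ℝ) / N, h (j / N) := by
    intro j
    rw [intervalIntegral.integral_const]
    have : ((j + 1 : ℕ) : ℝ) / N - (j : ℝ) / N = (N : ℝ)⁻¹ := by push_cast; field_simp; ring
    rw [this, Complex.real_smul]
    simp
  rw [hsum, Finset.mul_sum, ← Finset.sum_sub_distrib]
  have hterm : ∀ j ∈ Finset.range N, ‖(N : ℂ)⁻¹ * h (j / N) -
      ∫ x in ((j : ℝ) / N)..((j + 1 : ℕ) : ℝ) / N, h x‖ ≤ ω * (N : ℝ)⁻¹ := by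
    intro j hj
    have hj' : ((j + 1 : ℕ) : ℝ) ≤ N := by exact_mod_cast Finset.mem_range.1 hj
    have hle : (j : ℝ) / N ≤ ((j + 1 : ℕ) : ℝ) / N := by gcongr; simp
    have hdiff : ((j + 1 : ℕ) : ℝ) / N - (j : ℝ) / N = (N : ℝ)⁻¹ := by push_cast; field_simp; ring
    have h1 : ((j + 1 : ℕ) : ℝ) / N ≤ 1 := (div_le_one hN').2 hj'
    have h0 : 0 ≤ (j : ℝ) / N := by positivity
    rw [hconst, ← intervalIntegral.integral_sub (by simp) (hc.intervalIntegrable _ _)]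
    refine (intervalIntegral.norm_integral_le_of_norm_le_const (C := ω) fun x hx => ?_).trans ?_
    · rw [uIoc_of_le hle] at hx
      refine hω _ ⟨h0, by linarith⟩ _ ⟨by linarith [hx.1], by linarith [hx.2]⟩ ?_
      rw [abs_sub_comm, abs_of_nonneg (by linarith [hx.1]), one_div]
      linarith [hx.2]
    · rw [hdiff, abs_of_pos (by positivity)]
  refine (norm_sum_le_of_le _ hterm).trans ?_
  simp [mul_comm ω, hN'.ne']

variable {V : Type*} [AddCommGroup V] [Module ℂ V] [UniformSpace V] [IsUniformAddGroup V]
  [ContinuousSMul ℂ V] [LocallyConvexSpace ℝ V]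

/-- The Riemann sums form a sequence that is Cauchy in each seminorm `p`, because their distance
from the scalar integrals is small uniformly in `|ℓ| ≤ p`. -/
theorem exists_weakIntegral_unitInterval (hV : SeqComplete V) {g : ℝ → V} (hg : Continuous g) :
    ∃ y : V, ∀ ℓ : V →L[ℂ] ℂ, ℓ y = ∫ x in (0 : ℝ)..1, ℓ (g x) := by
  let S : ℕ → V := fun N => ((N + 1 : ℕ) : ℂ)⁻¹ • ∑ j ∈ Finset.range (N + 1), g (j / (N + 1 : ℕ))
  have hS : ∀ (ℓ : V →L[ℂ] ℂ) (N : ℕ), ℓ (S N) = ((N + 1 : ℕ) : ℂ)⁻¹ *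
      ∑ j ∈ Finset.range (N + 1), ℓ (g (j / (N + 1 : ℕ))) := by
    intro ℓ N; simp [S]
  have key : ∀ p : Seminorm ℂ V, Continuous p → ∀ ε > 0, ∃ N₀ : ℕ, ∀ N ≥ N₀,
      ∀ ℓ : V →L[ℂ] ℂ, (∀ x, ‖ℓ x‖ ≤ p x) → ‖ℓ (S N) - ∫ x in (0 : ℝ)..1, ℓ (g x)‖ ≤ ε := by
    intro p hp ε hε
    have huc : UniformContinuousOn g (Icc 0 1) :=
      isCompact_Icc.uniformContinuousOn_of_continuous hg.continuousOn
    have hU : {q : V × V | p (q.2 - q.1) < ε} ∈ uniformity V := by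
      rw [uniformity_eq_comap_nhds_zero]
      exact ⟨{x | p x < ε}, hp.continuousAt.eventually (gt_mem_nhds (by simpa)), fun q hq => hq⟩
    obtain ⟨δ, hδ, hδU⟩ := Metric.mem_uniformity_dist.1 (mem_inf_principal.1 (huc hU))
    obtain ⟨N₀, hN₀⟩ := exists_nat_one_div_lt hδ
    refine ⟨N₀, fun N hN ℓ hℓ => ?_⟩
    rw [hS]
    refine norm_riemannSum_sub_integral_le (ℓ.continuous.comp hg) N.succ_pos
      fun x hx y hy hxy => ?_
    rw [norm_sub_rev, Function.comp, Function.comp, ← map_sub]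
    refine (hℓ _).trans (le_of_lt ?_)
    refine hδU (a := x) (b := y) ?_ ⟨hx, hy⟩
    rw [Real.dist_eq]
    refine hxy.trans_lt (lt_of_le_of_lt ?_ hN₀)
    push_cast
    gcongr
  obtain ⟨y, hy⟩ := hV S (cauchySeq_of_seminorm fun p hp ε hε => by
    obtain ⟨N₀, hN₀⟩ := key p hp (ε / 2) (half_pos hε)
    refine ⟨N₀, fun m hm n hn => seminorm_le_of_forall_functional hp fun ℓ hℓ => ?_⟩
    have h1 := hN₀ m hm ℓ hℓ
    have h2 := hN₀ n hn ℓ hℓ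
    rw [map_sub, ← sub_sub_sub_cancel_right _ _ (∫ x in (0 : ℝ)..1, ℓ (g x))]
    exact (norm_sub_le _ _).trans (by linarith))
  refine ⟨y, fun ℓ => ?_⟩
  have h1 : Tendsto (fun N => ℓ (S N)) atTop (𝓝 (ℓ y)) := (ℓ.continuous.tendsto y).comp hy
  refine tendsto_nhds_unique h1 ?_
  rw [tendsto_iff_norm_sub_tendsto_zero, Metric.tendsto_atTop]
  intro ε hε
  obtain ⟨N₀, hN₀⟩ := key ℓ.toSeminorm ℓ.continuous.norm (ε / 2) (half_pos hε)
  refine ⟨N₀, fun n hn => ?_⟩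
  have := hN₀ n hn ℓ fun x => le_rfl
  simp only [dist_zero_right, norm_norm]
  linarith

theorem exists_weakIntegral_interval (hV : SeqComplete V) {g : ℝ → V} (hg : Continuous g)
    (a b : ℝ) : ∃ y : V, ∀ ℓ : V →L[ℂ] ℂ, ℓ y = ∫ x in a..b, ℓ (g x) := by
  obtain ⟨y, hy⟩ := exists_weakIntegral_unitInterval hV
    (g := fun x => ((b - a : ℝ) : ℂ) • g ((b - a) * x + a)) (by fun_prop)
  refine ⟨y, fun ℓ => ?_⟩
  rw [hy]
  simp only [map_smul, smul_eq_mul]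
  rw [intervalIntegral.integral_const_mul, ← Complex.real_smul,
    intervalIntegral.smul_integral_comp_mul_add (fun x => ℓ (g x))]
  simp

/-- Continuous functions on the line that are dominated, in each continuous seminorm, by an
integrable function have a weak integral in a sequentially complete space. -/
theorem exists_weakIntegral (hV : SeqComplete V) {g : ℝ → V} (hg : Continuous g)
    (hdom : ∀ p : Seminorm ℂ V, Continuous p → ∃ H : ℝ → ℝ, Integrable H ∧ ∀ x, p (g x) ≤ H x) :
    ∃ y : V, ∀ ℓ : V →L[ℂ] ℂ, ℓ y = ∫ x, ℓ (g x) := by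
  choose S hS using fun N : ℕ => exists_weakIntegral_interval hV hg (-N) N
  have hint : ∀ ℓ : V →L[ℂ] ℂ, Integrable fun x => ℓ (g x) := by
    intro ℓ
    obtain ⟨H, hH, hgH⟩ := hdom ℓ.toSeminorm ℓ.continuous.norm
    exact hH.mono' (ℓ.continuous.comp hg).aestronglyMeasurable (.of_forall hgH)
  have hlim : ∀ f : ℝ → ℝ, Integrable f →
      Tendsto (fun N : ℕ => ∫ x in (-N : ℝ)..N, f x) atTop (𝓝 (∫ x, f x)) := fun f hf =>
    intervalIntegral_tendsto_integral hf
      (tendsto_neg_atTop_atBot.comp tendsto_natCast_atTop_atTop) tendsto_natCast_atTop_atTop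
  have hlimc : ∀ f : ℝ → ℂ, Integrable f →
      Tendsto (fun N : ℕ => ∫ x in (-N : ℝ)..N, f x) atTop (𝓝 (∫ x, f x)) := fun f hf =>
    intervalIntegral_tendsto_integral hf
      (tendsto_neg_atTop_atBot.comp tendsto_natCast_atTop_atTop) tendsto_natCast_atTop_atTop
  -- The truncation error is controlled by the majorant alone. Hence the integrals over `[-N, N]`
  -- are Cauchy in the seminorm that provided `H`.
  have htail : ∀ (f : ℝ → ℂ) (H : ℝ → ℝ), Integrable f → Integrable H → (∀ x, ‖f x‖ ≤ H x) →
      ∀ N : ℕ, ‖(∫ x in (-N : ℝ)..N, f x) - ∫ x, f x‖ ≤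
        (∫ x, H x) - ∫ x in (-N : ℝ)..N, H x := by
    intro f H hf hH hfH N
    have hle : (-N : ℝ) ≤ N := by linarith [(Nat.cast_nonneg N : (0 : ℝ) ≤ N)]
    rw [intervalIntegral.integral_of_le hle, intervalIntegral.integral_of_le hle,
      ← integral_add_compl (measurableSet_Ioc (a := (-N : ℝ)) (b := N)) hf,
      ← integral_add_compl (measurableSet_Ioc (a := (-N : ℝ)) (b := N)) hH,
      sub_add_cancel_left, norm_neg, add_sub_cancel_left]
    exact norm_integral_le_of_norm_le hH.integrableOn (.of_forall hfH)
  obtain ⟨y, hy⟩ := hV S (cauchySeq_of_seminorm fun p hp ε hε => by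
    obtain ⟨H, hH, hgH⟩ := hdom p hp
    obtain ⟨N₀, hN₀⟩ := Metric.tendsto_atTop.1 (hlim H hH) (ε / 2) (half_pos hε)
    refine ⟨N₀, fun m hm n hn => seminorm_le_of_forall_functional hp fun ℓ hℓ => ?_⟩
    have hm' := htail _ H (hint ℓ) hH (fun x => (hℓ _).trans (hgH x)) m
    have hn' := htail _ H (hint ℓ) hH (fun x => (hℓ _).trans (hgH x)) n
    have h1 := hN₀ m hm
    have h2 := hN₀ n hn
    rw [Real.dist_eq] at h1 h2
    have h1' := (abs_lt.1 h1).1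
    have h2' := (abs_lt.1 h2).1
    rw [map_sub, hS, hS, ← sub_sub_sub_cancel_right _ _ (∫ x, ℓ (g x))]
    exact (norm_sub_le _ _).trans (by linarith))
  refine ⟨y, fun ℓ => ?_⟩
  have h1 : Tendsto (fun N => ℓ (S N)) atTop (𝓝 (ℓ y)) := (ℓ.continuous.tendsto y).comp hy
  simp only [hS] at h1
  exact tendsto_nhds_unique h1 (hlimc _ (hint ℓ))

end WeakIntegral

/-! ### Closed operators and pairs of functionals -/

section Graph

variable {V : Type*} [AddCommGroup V] [Module ℂ V] [TopologicalSpace V] [IsTopologicalAddGroup V]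
  [ContinuousSMul ℂ V] [LocallyConvexSpace ℝ V]

/-- Membership in the graph of a closed operator can be tested by pairs of functionals. -/
theorem mem_graph_of_forall_functional {T : V →ₗ.[ℂ] V} (hT : T.IsClosed) {y a : V}
    (h : ∀ ℓ ℓ' : V →L[ℂ] ℂ, (∀ x z, (x, z) ∈ T.graph → ℓ x + ℓ' z = 0) → ℓ y + ℓ' a = 0) :
    (y, a) ∈ T.graph := by
  have hcl : IsClosed (T.graph : Set (V × V)) := hT
  have := mem_closure_of_forall_functional T.graph (x := (y, a)) fun L hL => by
    have hdec : ∀ x z : V, L (x, z) = (L.comp (ContinuousLinearMap.inl ℂ V V)) x +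
        (L.comp (ContinuousLinearMap.inr ℂ V V)) z := by
      intro x z
      simp [← map_add]
    rw [hdec]
    exact h _ _ fun x z hxz => by rw [← hdec]; exact hL _ hxz
  rwa [hcl.closure_eq] at this

end Graph

/-! ### Weakly holomorphic functions -/

section WeaklyAnalytic

variable {V : Type*} [AddCommGroup V] [Module ℂ V] [UniformSpace V]

theorem exists_seminorm_bound_on_circle {F : ℂ → V} {z₀ : ℂ} {R : ℝ}
    (hF : Continuous fun θ : ℝ => F (circleMap z₀ R θ)) {p : Seminorm ℂ V} (hp : Continuous p) :
    ∃ M, 0 ≤ M ∧ ∀ θ ∈ Icc 0 (2 * Real.pi), p (F (circleMap z₀ R θ)) ≤ M := by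
  obtain ⟨M, hM⟩ := (isCompact_Icc (a := (0 : ℝ)) (b := 2 * Real.pi)).exists_bound_of_continuousOn
    (hp.comp hF).continuousOn
  refine ⟨max M 0, le_max_right _ _, fun θ hθ => ((le_abs_self _).trans (hM θ hθ)).trans
    (le_max_left _ _)⟩

variable [IsUniformAddGroup V] [ContinuousSMul ℂ V] [LocallyConvexSpace ℝ V]

/-- A continuous, weakly holomorphic function with values in a sequentially complete space is
analytic. -/
theorem isAnalyticOn_of_forall_functional (hV : SeqComplete V) {F : ℂ → V} {Ω : Set ℂ}
    (hΩ : IsOpen Ω) (hF : ContinuousOn F Ω)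
    (hd : ∀ ℓ : V →L[ℂ] ℂ, DifferentiableOn ℂ (fun z => ℓ (F z)) Ω) : IsAnalyticOn F Ω := by
  intro z₀ hz₀
  obtain ⟨R, hR, hball⟩ := Metric.nhds_basis_closedBall.mem_iff.1 (hΩ.mem_nhds hz₀)
  have hmem : ∀ θ : ℝ, circleMap z₀ R θ ∈ Ω := fun θ =>
    hball (circleMap_mem_closedBall _ hR.le _)
  have hcirc : Continuous fun θ : ℝ => F (circleMap z₀ R θ) :=
    hF.comp_continuous (continuous_circleMap _ _) hmem
  have hne : ∀ θ : ℝ, circleMap 0 R θ ≠ 0 := fun θ => circleMap_ne_center hR.ne'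
  -- The Taylor coefficients are weak Cauchy integrals over the circle. They are fixed before any
  -- functional is chosen, and so serve all functionals at once.
  choose c hc using fun k : ℕ => exists_weakIntegral_interval hV
    (g := fun θ : ℝ => ((2 * Real.pi : ℝ) : ℂ)⁻¹ • ((circleMap 0 R θ)⁻¹) ^ k •
      F (circleMap z₀ R θ)) (continuous_const.smul
        ((((continuous_circleMap 0 R).inv₀ hne).pow k).smul hcirc)) 0 (2 * Real.pi)
  have hsum : ∀ (ℓ : V →L[ℂ] ℂ), ∀ z ∈ Metric.ball z₀ (R / 2),
      HasSum (fun k => (z - z₀) ^ k * ℓ (c k)) (ℓ (F z)) := by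
    intro ℓ z hz
    have hRn : ((R.toNNReal : NNReal) : ℝ) = R := Real.coe_toNNReal R hR.le
    have h1 := DifferentiableOn.hasFPowerSeriesOnBall (R := R.toNNReal) (c := z₀)
      (f := fun z => ℓ (F z)) (by rw [hRn]; exact (hd ℓ).mono hball) (by simpa using hR)
    have hz' : z - z₀ ∈ Metric.eball (0 : ℂ) (R.toNNReal : ENNReal) := by
      rw [Metric.eball_coe, hRn]
      rw [Metric.mem_ball, dist_eq_norm] at hz
      simpa using hz.trans (half_lt_self hR)
    have h2 := h1.hasSum hz'
    rw [add_sub_cancel, hRn] at h2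
    refine (congrArg (fun f : ℕ → ℂ => HasSum f (ℓ (F z))) (funext fun k => ?_)).mp h2
    rw [cauchyPowerSeries_apply, hc, circleIntegral, ← intervalIntegral.integral_const_mul,
      ← intervalIntegral.integral_smul]
    refine intervalIntegral.integral_congr fun θ _ => ?_
    have h0 := hne θ
    have hpi : (Real.pi : ℂ) ≠ 0 := by exact_mod_cast Real.pi_ne_zero
    simp only [map_smul, smul_eq_mul, deriv_circleMap, circleMap_sub_center]
    push_cast
    rw [div_eq_mul_inv, mul_pow]
    field_simp
  refine ⟨c, R / 2, half_pos hR, tendstoUniformlyOn_of_seminorm fun p hp => ?_⟩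
  obtain ⟨M, hM0, hM⟩ := exists_seminorm_bound_on_circle hcirc hp
  refine ⟨fun n => M * (1 / 2) ^ n / (1 - 1 / 2), ?_, fun n z hz => ?_⟩
  · have := (tendsto_pow_atTop_nhds_zero_of_lt_one (r := (1 / 2 : ℝ)) (by norm_num)
      (by norm_num)).const_mul M |>.div_const (1 - 1 / 2)
    simpa using this
  refine seminorm_le_of_forall_functional hp fun ℓ hℓ => ?_
  -- Cauchy's estimates, with one `M` for all `ℓ` dominated by `p`; on the ball of radius `R / 2`
  -- they yield geometric convergence with ratio `1 / 2`.
  have hcb : ∀ k, ‖ℓ (c k)‖ ≤ M * (R⁻¹) ^ k := by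
    intro k
    rw [hc]
    refine (intervalIntegral.norm_integral_le_of_norm_le_const
      (C := (2 * Real.pi)⁻¹ * (M * (R⁻¹) ^ k)) fun θ hθ => ?_).trans (le_of_eq ?_)
    · rw [uIoc_of_le Real.two_pi_pos.le] at hθ
      rw [map_smul, map_smul, norm_smul, norm_smul, norm_pow, norm_inv, norm_inv,
        norm_circleMap_zero, Complex.norm_real, Real.norm_of_nonneg Real.two_pi_pos.le,
        abs_of_pos hR, mul_comm M]
      gcongr
      exact (hℓ _).trans (hM θ ⟨hθ.1.le, hθ.2⟩)
    · rw [sub_zero, abs_of_pos Real.two_pi_pos]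
      field_simp
  have := norm_sub_le_of_geometric_bound_of_hasSum (r := 1 / 2) (C := M) (by norm_num)
    (fun k => ?_) (hsum ℓ z hz) n
  · rw [norm_sub_rev] at this
    simpa using this
  · rw [norm_mul, norm_pow]
    rw [Metric.mem_ball, dist_eq_norm] at hz
    calc ‖z - z₀‖ ^ k * ‖ℓ (c k)‖ ≤ (R / 2) ^ k * (M * (R⁻¹) ^ k) := by
          gcongr
          exact hcb k
      _ = M * (1 / 2) ^ k := by
          rw [div_eq_mul_inv, mul_pow, inv_pow, inv_pow, one_div, inv_pow]
          have : R ^ k ≠ 0 := by positivity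
          field_simp

end WeaklyAnalytic

/-! ### Vector-valued entire power series -/

section EntireSeries

variable {V : Type*} [AddCommGroup V] [Module ℂ V] [UniformSpace V]

/-- Coefficient sequences of everywhere convergent power series. -/
def IsEntireCoeff (b : ℕ → V) : Prop :=
  ∀ p : Seminorm ℂ V, Continuous p → ∀ ρ : ℝ, 0 < ρ → ∃ M, ∀ k, p (b k) * ρ ^ k ≤ M

/-- The sum of the power series with coefficients `b`. -/
noncomputable def entireSum (b : ℕ → V) (w : ℂ) : V :=
  haveI : Nonempty V := ⟨0⟩
  limUnder atTop fun N => ∑ k ∈ Finset.range N, w ^ k • b k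

/-- The coefficient bound at radius `2R` leaves a factor `(1/2)^k` on the disc of radius `R`. The
constant does not depend on `ℓ`. -/
theorem IsEntireCoeff.exists_geometric {b : ℕ → V} (hb : IsEntireCoeff b) {p : Seminorm ℂ V}
    (hp : Continuous p) {R : ℝ} (hR : 0 < R) :
    ∃ M, ∀ ℓ : V →L[ℂ] ℂ, (∀ x, ‖ℓ x‖ ≤ p x) → ∀ w : ℂ, ‖w‖ ≤ R → ∀ k,
      ‖w ^ k * ℓ (b k)‖ ≤ M * (1 / 2) ^ k := by
  obtain ⟨M, hM⟩ := hb p hp (2 * R) (by positivity)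
  refine ⟨M, fun ℓ hℓ w hw k => ?_⟩
  rw [norm_mul, norm_pow]
  calc ‖w‖ ^ k * ‖ℓ (b k)‖ ≤ R ^ k * p (b k) := by gcongr; exact hℓ _
    _ = p (b k) * (2 * R) ^ k * (1 / 2) ^ k := by
      rw [mul_assoc, ← mul_pow]; ring_nf
    _ ≤ M * (1 / 2) ^ k := by gcongr; exact hM k

variable [IsUniformAddGroup V] [ContinuousSMul ℂ V] [LocallyConvexSpace ℝ V]

theorem IsEntireCoeff.tendsto_entireSum (hV : SeqComplete V) {b : ℕ → V} (hb : IsEntireCoeff b)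
    (w : ℂ) : Tendsto (fun N => ∑ k ∈ Finset.range N, w ^ k • b k) atTop
      (𝓝 (entireSum b w)) := by
  have hc : CauchySeq fun N => ∑ k ∈ Finset.range N, w ^ k • b k := by
    refine cauchySeq_of_seminorm fun p hp ε hε => ?_
    obtain ⟨M, hM⟩ := hb.exists_geometric hp (R := ‖w‖ + 1) (by positivity)
    have hlim : Tendsto (fun N : ℕ => M * (1 / 2 : ℝ) ^ N / (1 - 1 / 2)) atTop (𝓝 0) := by
      have := (tendsto_pow_atTop_nhds_zero_of_lt_one (r := (1 / 2 : ℝ)) (by norm_num)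
        (by norm_num)).const_mul M |>.div_const (1 - 1 / 2)
      simpa using this
    obtain ⟨N₀, hN₀⟩ := eventually_atTop.1 (hlim.eventually (gt_mem_nhds (half_pos hε)))
    refine ⟨N₀, fun m hm n hn => seminorm_le_of_forall_functional hp fun ℓ hℓ => ?_⟩
    have hg := hM ℓ hℓ w (by linarith)
    have hs : Summable fun k => w ^ k * ℓ (b k) :=
      Summable.of_norm_bounded ((summable_geometric_of_lt_one (by norm_num)
        (by norm_num)).mul_left M) hg
    have h1 := norm_sub_le_of_geometric_bound_of_hasSum (by norm_num) hg hs.hasSum m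
    have h2 := norm_sub_le_of_geometric_bound_of_hasSum (by norm_num) hg hs.hasSum n
    simp only [map_sub, map_sum, map_smul, smul_eq_mul]
    rw [← sub_sub_sub_cancel_right _ _ (∑' k, w ^ k * ℓ (b k))]
    refine (norm_sub_le _ _).trans ?_
    linarith [hN₀ m hm, hN₀ n hn]
  obtain ⟨x, hx⟩ := hV _ hc
  have : Nonempty V := ⟨0⟩
  exact tendsto_nhds_limUnder ⟨x, hx⟩

theorem IsEntireCoeff.hasSum (hV : SeqComplete V) {b : ℕ → V} (hb : IsEntireCoeff b)
    (ℓ : V →L[ℂ] ℂ) (w : ℂ) : HasSum (fun k => w ^ k * ℓ (b k)) (ℓ (entireSum b w)) := by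
  obtain ⟨M, hM⟩ := hb.exists_geometric (p := ℓ.toSeminorm) ℓ.continuous.norm (R := ‖w‖ + 1)
    (by positivity)
  have hs : Summable fun k => w ^ k * ℓ (b k) :=
    Summable.of_norm_bounded ((summable_geometric_of_lt_one (by norm_num)
      (by norm_num)).mul_left M) (hM ℓ (fun x => le_rfl) w (by linarith))
  have h1 := (ℓ.continuous.tendsto _).comp (hb.tendsto_entireSum hV w)
  have h2 := hs.hasSum.tendsto_sum_nat
  have h3 : ℓ (entireSum b w) = ∑' k, w ^ k * ℓ (b k) :=
    tendsto_nhds_unique h1 (h2.congr fun N => by simp)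
  rw [h3]
  exact hs.hasSum

theorem IsEntireCoeff.tendstoUniformlyOn (hV : SeqComplete V) {b : ℕ → V} (hb : IsEntireCoeff b)
    {R : ℝ} (hR : 0 < R) :
    TendstoUniformlyOn (fun N w => ∑ k ∈ Finset.range N, w ^ k • b k) (entireSum b) atTop
      (Metric.ball 0 R) := by
  refine tendstoUniformlyOn_of_seminorm fun p hp => ?_
  obtain ⟨M, hM⟩ := hb.exists_geometric hp hR
  refine ⟨fun N : ℕ => M * (1 / 2 : ℝ) ^ N / (1 - 1 / 2), ?_, fun n w hw => ?_⟩
  · have := (tendsto_pow_atTop_nhds_zero_of_lt_one (r := (1 / 2 : ℝ)) (by norm_num)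
      (by norm_num)).const_mul M |>.div_const (1 - 1 / 2)
    simpa using this
  refine seminorm_le_of_forall_functional hp fun ℓ hℓ => ?_
  have := norm_sub_le_of_geometric_bound_of_hasSum (by norm_num)
    (hM ℓ hℓ w (by simpa using (Metric.mem_ball.1 hw).le)) (hb.hasSum hV ℓ w) n
  rw [norm_sub_rev] at this
  simpa using this

theorem IsEntireCoeff.continuous_entireSum (hV : SeqComplete V) {b : ℕ → V}
    (hb : IsEntireCoeff b) : Continuous (entireSum b) := by
  rw [continuous_iff_continuousAt]
  intro w
  have h := (hb.tendstoUniformlyOn hV (R := ‖w‖ + 1) (by positivity)).continuousOn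
    (.of_forall fun N => Continuous.continuousOn (by fun_prop))
  exact h.continuousAt (Metric.isOpen_ball.mem_nhds (by simp))

theorem IsEntireCoeff.differentiable (hV : SeqComplete V) {b : ℕ → V} (hb : IsEntireCoeff b)
    (ℓ : V →L[ℂ] ℂ) : Differentiable ℂ fun w => ℓ (entireSum b w) := by
  intro w
  have h1 := ℓ.uniformContinuous.comp_tendstoUniformlyOn
    (hb.tendstoUniformlyOn hV (R := ‖w‖ + 1) (by positivity))
  have h2 := h1.tendstoLocallyUniformlyOn.differentiableOn
    (.of_forall fun N => Differentiable.differentiableOn (by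
      simp only [Function.comp_def, map_sum, map_smul]
      fun_prop)) Metric.isOpen_ball
  exact h2.differentiableAt (Metric.isOpen_ball.mem_nhds (by simp))

end EntireSeries

/-! ### Gamma and Beta function estimates -/

section FractionalSeries

open Real (Gamma)

/-- Monotonicity of `Γ` is used on `[2, ∞)`, hence at `x + 1`; the functional equation brings in the
factor `(x + e)/x ≤ 1 + e`. -/
theorem Gamma_le_mul_Gamma_add {x e : ℝ} (hx : 1 ≤ x) (he : 0 ≤ e) :
    Gamma x ≤ (1 + e) * Gamma (x + e) := by
  have h1 : Gamma (x + 1) ≤ Gamma (x + e + 1) :=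
    Real.Gamma_strictMonoOn_Ici.monotoneOn (by simp; linarith) (by simp; linarith) (by linarith)
  rw [Real.Gamma_add_one (by linarith), Real.Gamma_add_one (by linarith)] at h1
  have h2 : 0 < Gamma (x + e) := Real.Gamma_pos_of_pos (by linarith)
  have h3 : 0 < Gamma x := Real.Gamma_pos_of_pos (by linarith)
  nlinarith [mul_nonneg (mul_nonneg he (by linarith : 0 ≤ x - 1)) h2.le]

/-- Euler's Beta integral, in the form of the convolution law `g_β ∗ g_{κ+1} = g_{κ+β+1}`. -/
theorem integral_rpow_mul_rpow {t β κ : ℝ} (ht : 0 ≤ t) (hβ : 0 < β) (hκ : 0 ≤ κ) :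
    ∫ s in (0 : ℝ)..t, (t - s) ^ (β - 1) / Gamma β * (s ^ κ / Gamma (κ + 1)) =
      t ^ (κ + β) / Gamma (κ + β + 1) := by
  rcases ht.eq_or_lt with rfl | ht
  · rw [intervalIntegral.integral_same, Real.zero_rpow (by linarith), zero_div]
  have h := Complex.betaIntegral_scaled ((κ + 1 : ℝ) : ℂ) ((β : ℝ) : ℂ) ht
  have hΓ : Complex.betaIntegral ((κ + 1 : ℝ) : ℂ) ((β : ℝ) : ℂ) =
      ((Gamma (κ + 1) * Gamma β / Gamma (κ + 1 + β) : ℝ) : ℂ) := by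
    rw [eq_comm]
    push_cast [Complex.Gamma_ofReal, ← Complex.Gamma_ofReal]
    rw [div_eq_iff]
    · have := Complex.Gamma_mul_Gamma_eq_betaIntegral (s := ((κ + 1 : ℝ) : ℂ)) (t := (β : ℂ))
        (by simpa using by linarith) (by simpa using hβ)
      push_cast at this
      rw [this, mul_comm]
    · have : Gamma (κ + 1 + β) ≠ 0 := (Real.Gamma_pos_of_pos (by linarith)).ne'
      have h2 : ((Gamma (κ + 1 + β) : ℝ) : ℂ) ≠ 0 := by exact_mod_cast this
      rw [← Complex.Gamma_ofReal] at h2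
      push_cast at h2
      exact h2
  have hreal : (∫ s in (0 : ℝ)..t, s ^ κ * (t - s) ^ (β - 1)) =
      t ^ (κ + β) * (Gamma (κ + 1) * Gamma β / Gamma (κ + 1 + β)) := by
    rw [hΓ] at h
    have h' : ((∫ s in (0 : ℝ)..t, s ^ κ * (t - s) ^ (β - 1) : ℝ) : ℂ) =
        ((t ^ (κ + β) * (Gamma (κ + 1) * Gamma β / Gamma (κ + 1 + β)) : ℝ) : ℂ) := by
      rw [← intervalIntegral.integral_ofReal]
      convert h using 1
      · refine intervalIntegral.integral_congr fun s hs => ?_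
        rw [uIcc_of_le ht.le] at hs
        rw [Complex.ofReal_mul, Complex.ofReal_cpow hs.1, Complex.ofReal_cpow (by linarith [hs.2])]
        push_cast
        ring_nf
      · rw [Complex.ofReal_mul, Complex.ofReal_cpow ht.le]
        push_cast
        ring_nf
    exact_mod_cast h'
  have h1 : Gamma β ≠ 0 := (Real.Gamma_pos_of_pos hβ).ne'
  have h2 : Gamma (κ + 1) ≠ 0 := (Real.Gamma_pos_of_pos (by linarith)).ne'
  have : (fun s : ℝ => (t - s) ^ (β - 1) / Gamma β * (s ^ κ / Gamma (κ + 1))) =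
      fun s => (Gamma β * Gamma (κ + 1))⁻¹ * (s ^ κ * (t - s) ^ (β - 1)) := by
    funext s; field_simp
  rw [this, intervalIntegral.integral_const_mul, hreal, add_right_comm κ 1 β]
  field_simp

theorem intervalIntegrable_sub_rpow_mul {t β : ℝ} (hβ : 0 < β) {f : ℝ → ℝ} (hf : Continuous f) :
    IntervalIntegrable (fun s => (t - s) ^ (β - 1) / Gamma β * f s) volume 0 t := by
  have h1 : IntervalIntegrable (fun s : ℝ => (t - s) ^ (β - 1)) volume 0 t := by
    have := (intervalIntegral.intervalIntegrable_rpow' (r := β - 1) (a := t) (b := 0)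
      (by linarith)).comp_sub_left t
    simpa using this
  exact (h1.div_const _).mul_continuousOn hf.continuousOn

end FractionalSeries

end

section

open MeasureTheory
open Real (Gamma)

/-! ### Series in fractional powers of `t` -/

section FracSeries

variable {V : Type*} [AddCommGroup V] [Module ℂ V] [UniformSpace V]

/-- The growth condition under which `∑ t^{ζk+e} / Γ(ζk+e+1) y_k` converges for all `t`. -/
def HasMLGrowth (ζ : ℝ) (y : ℕ → V) : Prop :=
  ∀ p : Seminorm ℂ V, Continuous p → ∀ ρ : ℝ, 0 < ρ → ∃ M, ∀ k, p (y k) * ρ ^ k ≤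
    M * Gamma (ζ * k + 1)

/-- The coefficients `y_k / Γ(ζk+e+1)`. -/
noncomputable def mlCoeff (ζ e : ℝ) (y : ℕ → V) (k : ℕ) : V :=
  ((Gamma (ζ * k + e + 1))⁻¹ : ℂ) • y k

/-- The function `∑ t^{ζk+e} / Γ(ζk+e+1) y_k` of `t ≥ 0`. -/
noncomputable def fracSeries (ζ e : ℝ) (y : ℕ → V) (t : ℝ) : V :=
  ((t ^ e : ℝ) : ℂ) • entireSum (mlCoeff ζ e y) ((t ^ ζ : ℝ) : ℂ)

variable {ζ e : ℝ} {y : ℕ → V}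

theorem HasMLGrowth.isEntireCoeff (hy : HasMLGrowth ζ y) (hζ : 0 < ζ) (he : 0 ≤ e) :
    IsEntireCoeff (mlCoeff ζ e y) := by
  intro p hp ρ hρ
  obtain ⟨M, hM⟩ := hy p hp ρ hρ
  refine ⟨|M| * (1 + e), fun k => ?_⟩
  have hk : 0 ≤ ζ * k := by positivity
  have hΓ : 0 < Gamma (ζ * k + e + 1) := Real.Gamma_pos_of_pos (by linarith)
  have hle := Gamma_le_mul_Gamma_add (x := ζ * k + 1) (by linarith) he
  rw [add_right_comm] at hle
  rw [mlCoeff, map_smul_eq_mul, norm_inv, Complex.norm_real, Real.norm_of_nonneg hΓ.le, mul_assoc,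
    inv_mul_le_iff₀ hΓ]
  have h0 : 0 < Gamma (ζ * k + 1) := Real.Gamma_pos_of_pos (by linarith)
  calc p (y k) * ρ ^ k ≤ M * Gamma (ζ * k + 1) := hM k
    _ ≤ |M| * Gamma (ζ * k + 1) := by gcongr; exact le_abs_self M
    _ ≤ |M| * ((1 + e) * Gamma (ζ * k + e + 1)) := by gcongr
    _ = _ := by ring

theorem HasMLGrowth.zero : HasMLGrowth ζ (0 : ℕ → V) := by
  intro p hp ρ hρ
  exact ⟨0, fun k => by simp⟩

theorem HasMLGrowth.add {z : ℕ → V} (hy : HasMLGrowth ζ y) (hz : HasMLGrowth ζ z) :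
    HasMLGrowth ζ (y + z) := by
  intro p hp ρ hρ
  obtain ⟨M, hM⟩ := hy p hp ρ hρ
  obtain ⟨N, hN⟩ := hz p hp ρ hρ
  refine ⟨M + N, fun k => ?_⟩
  calc p (y k + z k) * ρ ^ k ≤ (p (y k) + p (z k)) * ρ ^ k := by
        gcongr; exact map_add_le_add p _ _
    _ ≤ _ := by linarith [hM k, hN k]

theorem HasMLGrowth.smul (c : ℂ) (hy : HasMLGrowth ζ y) : HasMLGrowth ζ (c • y) := by
  intro p hp ρ hρ
  obtain ⟨M, hM⟩ := hy p hp ρ hρ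
  refine ⟨‖c‖ * M, fun k => ?_⟩
  rw [Pi.smul_apply, map_smul_eq_mul, mul_assoc, mul_assoc]
  exact mul_le_mul_of_nonneg_left (hM k) (norm_nonneg c)

theorem fracSeries_zero_right (he : e ≠ 0) : fracSeries ζ e y 0 = 0 := by
  rw [fracSeries, Real.zero_rpow he]
  simp

variable [IsUniformAddGroup V] [ContinuousSMul ℂ V] [LocallyConvexSpace ℝ V]

theorem HasMLGrowth.hasSum (hV : SeqComplete V) (hy : HasMLGrowth ζ y) (hζ : 0 < ζ) (he : 0 ≤ e)
    (ℓ : V →L[ℂ] ℂ) {t : ℝ} (ht : 0 ≤ t) :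
    HasSum (fun k : ℕ => ((t ^ (ζ * k + e) / Gamma (ζ * k + e + 1) : ℝ) : ℂ) * ℓ (y k))
      (ℓ (fracSeries ζ e y t)) := by
  have h := ((hy.isEntireCoeff hζ he).hasSum hV ℓ ((t ^ ζ : ℝ) : ℂ)).mul_left ((t ^ e : ℝ) : ℂ)
  rw [fracSeries, map_smul, smul_eq_mul]
  refine (congrArg (fun f : ℕ → ℂ => HasSum f _) (funext fun k => ?_)).mp h
  have hk : (0 : ℝ) ≤ ζ * k := by positivity
  rw [mlCoeff, map_smul, smul_eq_mul, Real.rpow_add_of_nonneg ht hk he, Real.rpow_mul ht,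
    Real.rpow_natCast]
  push_cast
  ring

theorem HasMLGrowth.continuous_fracSeries (hV : SeqComplete V) (hy : HasMLGrowth ζ y) (hζ : 0 < ζ)
    (he : 0 ≤ e) : Continuous (fracSeries ζ e y) := by
  have h1 : Continuous fun t : ℝ => ((t ^ e : ℝ) : ℂ) :=
    Complex.continuous_ofReal.comp (Real.continuous_rpow_const he)
  have h2 : Continuous fun t : ℝ => ((t ^ ζ : ℝ) : ℂ) :=
    Complex.continuous_ofReal.comp (Real.continuous_rpow_const hζ.le)
  exact h1.smul (((hy.isEntireCoeff hζ he).continuous_entireSum hV).comp h2)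

/-- A pair of functionals that annihilates the graph annihilates each pair of terms, hence the pair
of sums; closedness of `T` does the rest. -/
theorem HasMLGrowth.mem_graph (hV : SeqComplete V) {T : V →ₗ.[ℂ] V} (hT : T.IsClosed)
    {a : ℕ → V} (hy : HasMLGrowth ζ y) (ha : HasMLGrowth ζ a) (hζ : 0 < ζ) (he : 0 ≤ e)
    (hya : ∀ k, (y k, a k) ∈ T.graph) {t : ℝ} (ht : 0 ≤ t) :
    (fracSeries ζ e y t, fracSeries ζ e a t) ∈ T.graph := by
  refine mem_graph_of_forall_functional hT fun ℓ ℓ' h => ?_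
  refine ((hy.hasSum hV hζ he ℓ ht).add (ha.hasSum hV hζ he ℓ' ht)).unique ?_
  have : (fun k : ℕ => ((t ^ (ζ * k + e) / Gamma (ζ * k + e + 1) : ℝ) : ℂ) * ℓ (y k) +
      ((t ^ (ζ * k + e) / Gamma (ζ * k + e + 1) : ℝ) : ℂ) * ℓ' (a k)) = fun _ => 0 := by
    funext k
    rw [← mul_add, h _ _ (hya k), mul_zero]
  rw [this]
  exact hasSum_zero

/-- `g_β ∗ ∑ g_{ζk+e+1} y_k = ∑ g_{ζk+e+β+1} y_k`. -/
theorem HasMLGrowth.functional_fracSeries_add (hV : SeqComplete V) (hy : HasMLGrowth ζ y)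
    (hζ : 0 < ζ) (he : 0 ≤ e) {β : ℝ} (hβ : 0 < β) (ℓ : V →L[ℂ] ℂ) {t : ℝ} (ht : 0 ≤ t) :
    ℓ (fracSeries ζ (e + β) y t) =
      ∫ s in (0 : ℝ)..t, (((t - s) ^ (β - 1) / Gamma β : ℝ) : ℂ) * ℓ (fracSeries ζ e y s) := by
  have hk : ∀ k : ℕ, 0 ≤ ζ * k + e := fun k => by positivity
  let f : ℕ → ℝ → ℝ := fun k s =>
    (t - s) ^ (β - 1) / Gamma β * (s ^ (ζ * k + e) / Gamma (ζ * k + e + 1))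
  have hfint : ∀ k, IntervalIntegrable (f k) volume 0 t := fun k =>
    intervalIntegrable_sub_rpow_mul hβ ((Real.continuous_rpow_const (hk k)).div_const _)
  have hfval : ∀ k, ∫ s in (0 : ℝ)..t, f k s =
      t ^ (ζ * k + (e + β)) / Gamma (ζ * k + (e + β) + 1) := fun k => by
    rw [integral_rpow_mul_rpow ht hβ (hk k), add_assoc (ζ * k)]
  have hf0 : ∀ k, ∀ s ∈ Icc 0 t, 0 ≤ f k s := fun k s hs => by
    have h1 : 0 ≤ t - s := by linarith [hs.2]
    have h2 : 0 < Gamma β := Real.Gamma_pos_of_pos hβ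
    have h3 : 0 < Gamma (ζ * k + e + 1) := Real.Gamma_pos_of_pos (by linarith [hk k])
    have h4 := hs.1
    positivity
  have hsum := hy.hasSum hV hζ (add_nonneg he hβ.le) ℓ ht
  have hF : ∀ k, Integrable (fun s => ((f k s : ℝ) : ℂ) * ℓ (y k))
      (volume.restrict (Ioc 0 t)) := fun k =>
    (((intervalIntegrable_iff_integrableOn_Ioc_of_le ht).1 (hfint k)).ofReal).mul_const _
  -- The kernels `f k` are nonnegative, so the integral of the norm of the `k`-th term is the norm
  -- of the `k`-th term of the integrated series, which is already known to converge absolutely.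
  -- This justifies termwise integration.
  have hnorm : Summable fun k => ∫ s in Ioc 0 t, ‖((f k s : ℝ) : ℂ) * ℓ (y k)‖ := by
    refine hsum.summable.norm.congr fun k => ?_
    rw [← hfval, intervalIntegral.integral_of_le ht, norm_mul, Complex.norm_real,
      Real.norm_of_nonneg (setIntegral_nonneg measurableSet_Ioc fun s hs =>
        hf0 k s (Ioc_subset_Icc_self hs)), ← integral_mul_const]
    refine setIntegral_congr_fun measurableSet_Ioc fun s hs => ?_
    simp only [norm_mul, Complex.norm_real,
      Real.norm_of_nonneg (hf0 k s (Ioc_subset_Icc_self hs))]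
  have h1 := hasSum_integral_of_summable_integral_norm hF hnorm
  rw [intervalIntegral.integral_of_le ht]
  have h2 : ∫ s in Ioc 0 t, (((t - s) ^ (β - 1) / Gamma β : ℝ) : ℂ) * ℓ (fracSeries ζ e y s) =
      ∫ s in Ioc 0 t, ∑' k, ((f k s : ℝ) : ℂ) * ℓ (y k) := by
    refine setIntegral_congr_fun measurableSet_Ioc fun s hs => ?_
    have h3 := (hy.hasSum hV hζ he ℓ hs.1.le).mul_left (((t - s) ^ (β - 1) / Gamma β : ℝ) : ℂ)
    rw [← h3.tsum_eq]
    refine tsum_congr fun k => ?_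
    simp only [f]
    push_cast
    ring
  rw [h2]
  refine hsum.unique ((congrArg (fun g : ℕ → ℂ => HasSum g _) (funext fun k => ?_)).mp h1)
  rw [integral_mul_const, integral_complex_ofReal, ← intervalIntegral.integral_of_le ht, hfval]

/-- Convolution with `g_1` is integration, so `functional_fracSeries_add` with `β = 1` gives the
weak derivative. It is continuous, hence a derivative in the topology of `V`. -/
theorem HasMLGrowth.hasDerivWithinAt_fracSeries (hV : SeqComplete V) (hy : HasMLGrowth ζ y)
    (hζ : 0 < ζ) (he : 0 ≤ e) {t : ℝ} (ht : 0 ≤ t) :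
    HasDerivWithinAt (fracSeries ζ (e + 1) y) (fracSeries ζ e y t) (Ici 0) t := by
  refine hasDerivWithinAt_of_forall_functional (convex_Ici 0)
    (hy.continuous_fracSeries hV hζ he).continuousOn (fun ℓ s hs => ?_) ht
  have hc : Continuous fun s => ℓ (fracSeries ζ e y s) :=
    ℓ.continuous.comp (hy.continuous_fracSeries hV hζ he)
  have h1 : HasDerivAt (fun u => ∫ s in (0 : ℝ)..u, ℓ (fracSeries ζ e y s))
      (ℓ (fracSeries ζ e y s)) s :=
    intervalIntegral.integral_hasDerivAt_right (hc.intervalIntegrable _ _)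
      (hc.stronglyMeasurableAtFilter _ _) hc.continuousAt
  refine h1.hasDerivWithinAt.congr_of_mem (fun u hu => ?_) hs
  rw [hy.functional_fracSeries_add hV hζ he one_pos ℓ hu]
  simp

variable [T2Space V]

theorem HasMLGrowth.fracSeries_eq_add (hV : SeqComplete V) (hy : HasMLGrowth ζ y)
    (hy' : HasMLGrowth ζ fun k => y (k + 1)) (hζ : 0 < ζ) (he : 0 ≤ e) {t : ℝ} (ht : 0 ≤ t) :
    fracSeries ζ e y t = (t ^ e / Gamma (e + 1)) • y 0 +
      fracSeries ζ (e + ζ) (fun k => y (k + 1)) t := by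
  refine eq_of_forall_functional fun ℓ => ?_
  have h1 := hy'.hasSum hV hζ (add_nonneg he hζ.le) ℓ ht
  have h2 := (hasSum_nat_add_iff' 1).2 (hy.hasSum hV hζ he ℓ ht)
  have h3 := h1.unique ((congrArg (fun f : ℕ → ℂ => HasSum f _) (funext fun k => ?_)).mp h2)
  · rw [map_add, h3, ← Complex.coe_smul, map_smul]
    simp
  · have : ζ * ((k + 1 : ℕ) : ℝ) + e = ζ * k + (e + ζ) := by push_cast; ring
    rw [this]

theorem HasMLGrowth.fracSeries_zero_zero (hV : SeqComplete V) (hy : HasMLGrowth ζ y) (hζ : 0 < ζ) :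
    fracSeries ζ 0 y 0 = y 0 := by
  refine eq_of_forall_functional fun ℓ => (hy.hasSum hV hζ le_rfl ℓ le_rfl).unique ?_
  have := hasSum_single (f := fun k : ℕ =>
    (((0 : ℝ) ^ (ζ * k + 0) / Gamma (ζ * k + 0 + 1) : ℝ) : ℂ) * ℓ (y k)) 0 fun k hk => by
    have : ζ * (k : ℝ) ≠ 0 := mul_ne_zero hζ.ne' (by exact_mod_cast hk)
    simp [Real.zero_rpow this]
  simpa using this

end FracSeries

/-! ### Mittag-Leffler type functions and their Caputo derivatives -/

section Solution

variable {V : Type*} [AddCommGroup V] [Module ℂ V] [UniformSpace V]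

/-- The shift by `ζ` is compared with a shift by `2`. With `s = ζ k ≤ 2k` this gives `Γ(s+1+ζ) ≤ 3
Γ(s+3) = 3 (s+2)(s+1) Γ(s+1)`, and both linear factors are at most `2 · 2^k`. -/
theorem Gamma_shift_le {ζ : ℝ} (hζ : 0 < ζ) (hζ2 : ζ ≤ 2) (k : ℕ) :
    Gamma (ζ * ((k + 1 : ℕ) : ℝ) + 1) ≤ 12 * 4 ^ k * Gamma (ζ * k + 1) := by
  have hk : 0 ≤ ζ * k := by positivity
  have hk2 : ζ * k ≤ 2 * k := by gcongr
  have hpow : (k : ℝ) + 1 ≤ 2 ^ k := by exact_mod_cast Nat.lt_two_pow_self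
  have h1 := Gamma_le_mul_Gamma_add (x := ζ * k + 1 + ζ) (e := 2 - ζ) (by linarith) (by linarith)
  have h2 : ζ * k + 1 + ζ + (2 - ζ) = ζ * k + 1 + 1 + 1 := by ring
  have hΓ : 0 < Gamma (ζ * k + 1) := Real.Gamma_pos_of_pos (by linarith)
  rw [h2, Real.Gamma_add_one (by linarith), Real.Gamma_add_one (by linarith)] at h1
  have h3 : ζ * ((k + 1 : ℕ) : ℝ) + 1 = ζ * k + 1 + ζ := by push_cast; ring
  rw [h3]
  refine h1.trans ?_
  have h4 : (4 : ℝ) ^ k = 2 ^ k * 2 ^ k := by rw [← mul_pow]; norm_num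
  calc (1 + (2 - ζ)) * ((ζ * k + 1 + 1) * ((ζ * k + 1) * Gamma (ζ * k + 1)))
      ≤ 3 * ((2 * 2 ^ k) * ((2 * 2 ^ k) * Gamma (ζ * k + 1))) := by
        gcongr <;> linarith
    _ = 12 * 4 ^ k * Gamma (ζ * k + 1) := by rw [h4]; ring

theorem HasMLGrowth.succ {ζ : ℝ} {y : ℕ → V} (hy : HasMLGrowth ζ y) (hζ : 0 < ζ) (hζ2 : ζ ≤ 2) :
    HasMLGrowth ζ fun k => y (k + 1) := by
  intro p hp ρ hρ
  -- The larger radius absorbs the factor `4 ^ k` of `Gamma_shift_le`.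
  obtain ⟨M, hM⟩ := hy p hp (4 * ρ) (by positivity)
  refine ⟨|M| * 3 / ρ, fun k => ?_⟩
  have hΓ : 0 < Gamma (ζ * k + 1) := Real.Gamma_pos_of_pos (by positivity)
  have h1 : p (y (k + 1)) * (4 * ρ) ^ (k + 1) ≤ |M| * (12 * 4 ^ k * Gamma (ζ * k + 1)) :=
    (hM (k + 1)).trans <| (mul_le_mul_of_nonneg_right (le_abs_self M)
      (Real.Gamma_pos_of_pos (by positivity)).le).trans
      (mul_le_mul_of_nonneg_left (Gamma_shift_le hζ hζ2 k) (abs_nonneg M))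
  rw [div_mul_eq_mul_div, le_div_iff₀ hρ]
  refine le_of_mul_le_mul_right ?_ (by positivity : (0 : ℝ) < 4 * 4 ^ k)
  calc p (y (k + 1)) * ρ ^ k * ρ * (4 * 4 ^ k) = p (y (k + 1)) * (4 * ρ) ^ (k + 1) := by
        rw [mul_pow]; ring
    _ ≤ _ := h1
    _ = _ := by ring

theorem HasMLGrowth.shift {ζ : ℝ} {y : ℕ → V} (hy : HasMLGrowth ζ y) (hζ : 0 < ζ) (hζ2 : ζ ≤ 2)
    (d : ℕ) : HasMLGrowth ζ fun k => y (k + d) := by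
  induction d with
  | zero => exact hy
  | succ d ih => simpa only [add_assoc, add_comm 1] using ih.succ hζ hζ2

/-- The function `∑ t^{ζk}/Γ(ζk+1) y_k + ∑ t^{ζk+1}/Γ(ζk+2) z_k`. -/
noncomputable def mlSolution (ζ : ℝ) (y z : ℕ → V) (t : ℝ) : V :=
  fracSeries ζ 0 y t + fracSeries ζ 1 z t

variable [ContinuousSMul ℂ V]

theorem HasDerivWithinAt.congr_of_tvs {u₁ u₂ : ℝ → V} {v : V} {s : Set ℝ} {t : ℝ}
    (h₁ : HasDerivWithinAt u₁ v s t) (h : EqOn u₁ u₂ s) (ht : t ∈ s) :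
    HasDerivWithinAt u₂ v s t := by
  refine ⟨h₁.isLittleOTVS.congr' ?_ .rfl⟩
  rw [prod_pure, Filter.EventuallyEq, eventually_map]
  filter_upwards [self_mem_nhdsWithin] with x hx
  rw [h hx, h ht]

variable [IsUniformAddGroup V]

theorem HasDerivWithinAt.add_of_tvs {u₁ u₂ : ℝ → V} {v₁ v₂ : V} {s : Set ℝ} {t : ℝ}
    (h₁ : HasDerivWithinAt u₁ v₁ s t) (h₂ : HasDerivWithinAt u₂ v₂ s t) :
    HasDerivWithinAt (fun x => u₁ x + u₂ x) (v₁ + v₂) s t := by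
  refine ⟨(h₁.isLittleOTVS.add h₂.isLittleOTVS).congr_left fun p => ?_⟩
  simp
  abel

variable [LocallyConvexSpace ℝ V] {ζ : ℝ} {y z : ℕ → V}

theorem HasMLGrowth.isFracConv (hV : SeqComplete V) (hy : HasMLGrowth ζ y) (hz : HasMLGrowth ζ z)
    (hζ : 0 < ζ) {e e' β : ℝ} (he : 0 ≤ e) (he' : 0 ≤ e') (hβ : 0 ≤ β) {f : ℝ → V}
    (hf : ∀ t, 0 ≤ t → f t = fracSeries ζ e y t + fracSeries ζ e' z t) :
    IsFracConv β f fun t => fracSeries ζ (e + β) y t + fracSeries ζ (e' + β) z t := by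
  unfold IsFracConv
  split_ifs with h0
  · intro t ht
    simp only [h0, add_zero]
    exact (hf t ht).symm
  · intro t ht ℓ
    have hpos : 0 < β := lt_of_le_of_ne hβ (Ne.symm h0)
    have hint : ∀ g : ℝ → V, Continuous g → IntervalIntegrable
        (fun s => (((t - s) ^ (β - 1) / Gamma β : ℝ) : ℂ) * ℓ (g s)) volume 0 t := fun g hg => by
      have h1 := intervalIntegrable_sub_rpow_mul (t := t) hpos continuous_one
      simp only [Pi.one_apply, mul_one] at h1
      have h2 : IntervalIntegrable (fun s => (((t - s) ^ (β - 1) / Gamma β : ℝ) : ℂ)) volume 0 t :=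
        ⟨h1.1.ofReal, h1.2.ofReal⟩
      exact h2.mul_continuousOn (ℓ.continuous.comp hg).continuousOn
    rw [map_add, hy.functional_fracSeries_add hV hζ he hpos ℓ ht,
      hz.functional_fracSeries_add hV hζ he' hpos ℓ ht, ← intervalIntegral.integral_add
      (hint _ (hy.continuous_fracSeries hV hζ he)) (hint _ (hz.continuous_fracSeries hV hζ he'))]
    refine intervalIntegral.integral_congr fun s hs => ?_
    rw [uIcc_of_le ht] at hs
    simp only [hf s hs.1, map_add, mul_add]

theorem HasMLGrowth.hasDerivWithinAt_add (hV : SeqComplete V) (hy : HasMLGrowth ζ y)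
    (hz : HasMLGrowth ζ z) (hζ : 0 < ζ) {e e' : ℝ} (he : 0 ≤ e) (he' : 0 ≤ e') {t : ℝ}
    (ht : 0 ≤ t) :
    HasDerivWithinAt (fun t => fracSeries ζ (e + 1) y t + fracSeries ζ (e' + 1) z t)
      (fracSeries ζ e y t + fracSeries ζ e' z t) (Ici 0) t :=
  HasDerivWithinAt.add_of_tvs (hy.hasDerivWithinAt_fracSeries hV hζ he ht)
    (hz.hasDerivWithinAt_fracSeries hV hζ he' ht)

theorem HasMLGrowth.continuous_mlSolution (hV : SeqComplete V) (hy : HasMLGrowth ζ y)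
    (hz : HasMLGrowth ζ z) (hζ : 0 < ζ) : Continuous (mlSolution ζ y z) :=
  (hy.continuous_fracSeries hV hζ le_rfl).add (hz.continuous_fracSeries hV hζ zero_le_one)

theorem HasMLGrowth.mlSolution_mem_graph (hV : SeqComplete V) {T : V →ₗ.[ℂ] V} (hT : T.IsClosed)
    {a b : ℕ → V} (hy : HasMLGrowth ζ y) (hz : HasMLGrowth ζ z) (ha : HasMLGrowth ζ a)
    (hb : HasMLGrowth ζ b) (hζ : 0 < ζ) (hya : ∀ k, (y k, a k) ∈ T.graph)
    (hzb : ∀ k, (z k, b k) ∈ T.graph) {t : ℝ} (ht : 0 ≤ t) :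
    (mlSolution ζ y z t, mlSolution ζ a b t) ∈ T.graph :=
  T.graph.add_mem (hy.mem_graph hV hT ha hζ le_rfl hya ht)
    (hz.mem_graph hV hT hb hζ zero_le_one hzb ht)

theorem isAnalyticOn_mlExtension (hV : SeqComplete V) (hy : HasMLGrowth ζ y)
    (hz : HasMLGrowth ζ z) (hζ : 0 < ζ) {g : ℂ → ℂ} {Ω : Set ℂ} (hΩ : IsOpen Ω)
    (hg : DifferentiableOn ℂ g Ω) :
    IsAnalyticOn (fun w => entireSum (mlCoeff ζ 0 y) (g w) +
      w • entireSum (mlCoeff ζ 1 z) (g w)) Ω := by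
  have hy' := hy.isEntireCoeff hζ le_rfl
  have hz' := hz.isEntireCoeff hζ zero_le_one
  refine isAnalyticOn_of_forall_functional hV hΩ ?_ fun ℓ => ?_
  · exact ((hy'.continuous_entireSum hV).comp_continuousOn hg.continuousOn).add
      (continuousOn_id.smul ((hz'.continuous_entireSum hV).comp_continuousOn hg.continuousOn))
  · simp only [map_add, map_smul, smul_eq_mul]
    exact ((hy'.differentiable hV ℓ).comp_differentiableOn hg).add
      (differentiableOn_id.mul ((hz'.differentiable hV ℓ).comp_differentiableOn hg))

theorem HasMLGrowth.extendsToSlitPlane (hV : SeqComplete V) (hy : HasMLGrowth ζ y)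
    (hz : HasMLGrowth ζ z) (hζ : 0 < ζ) : ExtendsToSlitPlane (mlSolution ζ y z) := by
  have hΩ : {z : ℂ | ∀ s : ℝ, s ≤ 0 → z ≠ s} = Complex.slitPlane := by
    ext w
    rw [Complex.mem_slitPlane_iff_not_le_zero, Set.mem_ofPred_eq]
    constructor
    · intro h hle
      obtain ⟨h1, h2⟩ := Complex.le_def.1 hle
      exact h w.re h1 (Complex.ext rfl h2)
    · rintro h s hs rfl
      exact h (by exact_mod_cast hs)
  have hd : DifferentiableOn ℂ (fun w : ℂ => w ^ (ζ : ℂ)) Complex.slitPlane := fun w hw =>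
    (differentiableAt_id.cpow_const hw).differentiableWithinAt
  refine ⟨fun w => entireSum (mlCoeff ζ 0 y) (w ^ (ζ : ℂ)) +
      w • entireSum (mlCoeff ζ 1 z) (w ^ (ζ : ℂ)), fun t ht => ?_, ?_, ?_⟩
  · simp [mlSolution, fracSeries, Complex.ofReal_cpow ht]
  · rw [hΩ]
    exact isAnalyticOn_mlExtension hV hy hz hζ Complex.isOpen_slitPlane hd
  · have hc : ContinuousOn (fun w : ℂ => w ^ (ζ : ℂ)) {z : ℂ | ∀ s : ℝ, s < 0 → z ≠ s} := by
      intro w hw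
      by_cases h0 : w = 0
      · subst h0
        -- The origin is outside the slit plane; continuity of `w^ζ` there rests on `Re ζ > 0`.
        refine ContinuousAt.continuousWithinAt ?_
        exact Complex.continuousAt_cpow_zero_of_re_pos (z := (ζ : ℂ)) (by simpa using hζ) |>.comp
          (f := fun w : ℂ => (w, (ζ : ℂ))) (by fun_prop)
      · refine (hd w ?_).continuousWithinAt.continuousAt
          (Complex.isOpen_slitPlane.mem_nhds ?_) |>.continuousWithinAt
        all_goals
          rw [← hΩ]
          intro s hs
          rcases hs.eq_or_lt with rfl | hs
          · simpa using h0
          · exact hw s hs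
    exact (((hy.isEntireCoeff hζ le_rfl).continuous_entireSum hV).comp_continuousOn hc).add
      (continuousOn_id.smul
        (((hz.isEntireCoeff hζ zero_le_one).continuous_entireSum hV).comp_continuousOn hc))

theorem HasMLGrowth.extendsToEntire (hV : SeqComplete V) (hy : HasMLGrowth ζ y)
    (hz : HasMLGrowth ζ z) (hζ : 0 < ζ) {m : ℕ} (hm : ζ = m) :
    ExtendsToEntire (mlSolution ζ y z) := by
  refine ⟨fun w => entireSum (mlCoeff ζ 0 y) (w ^ m) + w • entireSum (mlCoeff ζ 1 z) (w ^ m),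
    fun t ht => ?_, isAnalyticOn_mlExtension hV hy hz hζ isOpen_univ (by fun_prop)⟩
  have : t ^ ζ = t ^ m := by rw [hm, Real.rpow_natCast]
  simp [mlSolution, fracSeries, this]

variable [T2Space V]

theorem fracSeries_zero_left (hV : SeqComplete V) (hζ : 0 < ζ) {e : ℝ} (he : 0 ≤ e) {t : ℝ}
    (ht : 0 ≤ t) : fracSeries ζ e (0 : ℕ → V) t = 0 := by
  refine eq_zero_of_forall_functional fun ℓ =>
    (HasMLGrowth.zero.hasSum hV hζ he ℓ ht).unique ?_
  simp

theorem HasMLGrowth.mlSolution_zero (hV : SeqComplete V) (hy : HasMLGrowth ζ y) (hζ : 0 < ζ) :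
    mlSolution ζ y z 0 = y 0 := by
  rw [mlSolution, hy.fracSeries_zero_zero hV hζ, fracSeries_zero_right one_ne_zero, add_zero]

theorem HasMLGrowth.mlSolution_eq (hV : SeqComplete V) (hy : HasMLGrowth ζ y) (hζ : 0 < ζ)
    (hζ2 : ζ ≤ 2) {t : ℝ} (ht : 0 ≤ t) : mlSolution ζ y z t =
      y 0 + (fracSeries ζ ζ (fun k => y (k + 1)) t + fracSeries ζ 1 z t) := by
  rw [mlSolution, hy.fracSeries_eq_add hV (hy.succ hζ hζ2) hζ le_rfl ht]
  simp [add_assoc]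

theorem HasMLGrowth.hasDerivWithinAt_mlSolution (hV : SeqComplete V) (hy : HasMLGrowth ζ y)
    (hz : HasMLGrowth ζ z) (hζ : 1 ≤ ζ) (hζ2 : ζ ≤ 2) {t : ℝ} (ht : 0 ≤ t) :
    HasDerivWithinAt (mlSolution ζ y z)
      (fracSeries ζ (ζ - 1) (fun k => y (k + 1)) t + fracSeries ζ 0 z t) (Ici 0) t := by
  have hζ0 : 0 < ζ := by linarith
  have h1 := (hy.succ hζ0 hζ2).hasDerivWithinAt_add hV hz hζ0 (e := ζ - 1) (e' := 0)
    (by linarith) le_rfl ht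
  have h2 : HasDerivWithinAt (fun _ : ℝ => y 0) 0 (Ici 0) t :=
    ⟨(Asymptotics.IsLittleOTVS.zero _ _).congr_left fun p => by simp⟩
  have h3 := HasDerivWithinAt.add_of_tvs h2 h1
  rw [zero_add (fracSeries ζ (ζ - 1) (fun k => y (k + 1)) t + fracSeries ζ 0 z t)] at h3
  refine HasDerivWithinAt.congr_of_tvs h3 (fun s hs => ?_) ht
  simp only [sub_add_cancel, zero_add]
  rw [hy.mlSolution_eq hV hζ0 hζ2 hs]

/-- The Caputo derivative of a solution given by `(y, z)` is given by the shifted sequences. -/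
theorem HasMLGrowth.isCaputoDeriv (hV : SeqComplete V) (hy : HasMLGrowth ζ y)
    (hz : HasMLGrowth ζ z) (hζ : 0 < ζ) (hζ2 : ζ ≤ 2) (h : z = 0 ∨ 1 < ζ) :
    IsCaputoDeriv ζ (mlSolution ζ y z)
      (mlSolution ζ (fun k => y (k + 1)) fun k => z (k + 1)) := by
  have hy1 := hy.succ hζ hζ2
  have hz1 := hz.succ hζ hζ2
  have hcont := hy1.continuous_mlSolution hV hz1 hζ
  have hcont0 := hy.continuous_mlSolution hV hz hζ
  -- Only `j = 0, 1` occur because `⌈ζ⌉ ≤ 2`. Removing the Taylor part leaves series starting at the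
  -- exponents `ζ` and `1 + ζ`. Convolution with `g_{m-ζ}` raises these to `m` and `m + 1`, and `m`
  -- derivatives bring them back to `0` and `1`.
  refine ⟨fun j => if j = 0 then y 0 else z 0,
    fun t => fracSeries ζ (ζ + (⌈ζ⌉₊ - ζ)) (fun k => y (k + 1)) t +
      fracSeries ζ (1 + ζ + (⌈ζ⌉₊ - ζ)) (fun k => z (k + 1)) t, ?_, ?_, ?_, hcont.continuousOn⟩
  · intro j hj
    rcases Nat.eq_zero_or_pos j with rfl | hjpos
    · exact ⟨_, fun t _ => rfl, hcont0.continuousOn, hy.mlSolution_zero hV hζ⟩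
    · have hζ1 : 1 < ζ := by
        have := Nat.lt_ceil.1 hj
        exact lt_of_le_of_lt (by exact_mod_cast hjpos) this
      have hj1 : j = 1 := by
        have h2 : ⌈ζ⌉₊ ≤ 2 := Nat.ceil_le.2 (by exact_mod_cast hζ2)
        omega
      subst hj1
      refine ⟨fun t => fracSeries ζ (ζ - 1) (fun k => y (k + 1)) t + fracSeries ζ 0 z t,
        ⟨_, fun t _ => rfl, fun t ht => hy.hasDerivWithinAt_mlSolution hV hz hζ1.le hζ2 ht⟩, ?_, ?_⟩
      · exact ((hy1.continuous_fracSeries hV hζ (by linarith)).add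
          (hz.continuous_fracSeries hV hζ le_rfl)).continuousOn
      · simp [hz.fracSeries_zero_zero hV hζ,
          fracSeries_zero_right (sub_ne_zero.2 hζ1.ne') (ζ := ζ)]
  · refine hy1.isFracConv hV hz1 hζ hζ.le (by linarith) (sub_nonneg.2 (Nat.le_ceil ζ))
      fun t ht => ?_
    rw [hy.mlSolution_eq hV hζ hζ2 ht]
    -- For `ζ ≤ 1` the Taylor part contains no term `t z_0`, so nothing would cancel the first term
    -- of the second series; this is why `z = 0` is required there.
    rcases h with rfl | h
    · have hm : ∀ j ∈ Finset.range ⌈ζ⌉₊, j ≠ 0 →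
          (t ^ j / (j.factorial : ℝ)) • (if j = 0 then y 0 else (0 : ℕ → V) 0) = 0 := by
        intro j _ hj
        simp [hj]
      rw [Finset.sum_eq_single_of_mem 0 (by simpa using hζ) hm]
      have h0 : (fun k => (0 : ℕ → V) (k + 1)) = 0 := rfl
      rw [h0, fracSeries_zero_left hV hζ zero_le_one ht,
        fracSeries_zero_left hV hζ (by linarith) ht]
      simp
    · have hm : ⌈ζ⌉₊ = 2 := by
        refine le_antisymm (Nat.ceil_le.2 (by exact_mod_cast hζ2)) (Nat.lt_ceil.2 ?_)
        exact_mod_cast h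
      rw [hz.fracSeries_eq_add hV hz1 hζ zero_le_one ht, hm]
      simp [Finset.sum_range_succ, one_add_one_eq_two]
      abel
  · have hζ1 : ζ + ((⌈ζ⌉₊ : ℝ) - ζ) = ⌈ζ⌉₊ := by ring
    have hζ3 : 1 + ζ + ((⌈ζ⌉₊ : ℝ) - ζ) = ⌈ζ⌉₊ + 1 := by ring
    rw [hζ1, hζ3]
    have hiter : ∀ m j : ℕ, IsIterDeriv j
        (fun t => fracSeries ζ ((m + j : ℕ) : ℝ) (fun k => y (k + 1)) t +
          fracSeries ζ (((m + j : ℕ) : ℝ) + 1) (fun k => z (k + 1)) t)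
        (fun t => fracSeries ζ (m : ℝ) (fun k => y (k + 1)) t +
          fracSeries ζ ((m : ℝ) + 1) (fun k => z (k + 1)) t) := by
      intro m j
      induction j generalizing m with
      | zero => exact fun t _ => rfl
      | succ j ih =>
        have h1 := ih (m + 1)
        rw [show m + 1 + j = m + (j + 1) by ring] at h1
        refine ⟨_, h1, fun t ht => ?_⟩
        push_cast
        exact hy1.hasDerivWithinAt_add hV hz1 hζ (by positivity) (by positivity) ht
    have := hiter 0 ⌈ζ⌉₊
    simp only [zero_add, Nat.cast_zero] at this
    exact this

theorem HasMLGrowth.isIterCaputo (hV : SeqComplete V) (hy : HasMLGrowth ζ y)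
    (hz : HasMLGrowth ζ z) (hζ : 0 < ζ) (hζ2 : ζ ≤ 2) (h : z = 0 ∨ 1 < ζ) (p : ℕ) :
    IsIterCaputo ζ p (mlSolution ζ y z)
      (mlSolution ζ (fun k => y (k + p)) fun k => z (k + p)) := by
  induction p with
  | zero => exact fun t _ => rfl
  | succ p ih =>
    refine ⟨_, ih, ?_⟩
    have := (hy.shift hζ hζ2 p).isCaputoDeriv hV (hz.shift hζ hζ2 p) hζ hζ2
      (h.imp_left fun h0 => by subst h0; rfl)
    simpa only [add_assoc, add_comm 1] using this

end Solution

end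

/-! ### From coefficient sequences to solutions and initial data -/

section SolutionSequences

variable {X : Type*} [AddCommGroup X] [Module ℂ X] [UniformSpace X]

/-- `a i k = A_i y_k`, all sequences satisfy the growth condition, and
`∑ A_i y_{k + q i} = 0` for all `k`. -/
def IsSolutionSeq {n : ℕ} (ζ : ℝ) (q : Fin (n + 1) → ℕ) (A : Fin (n + 1) → X →ₗ.[ℂ] X)
    (y : ℕ → X) (a : Fin (n + 1) → ℕ → X) : Prop :=
  HasMLGrowth ζ y ∧ (∀ i, HasMLGrowth ζ (a i)) ∧ (∀ i k, (y k, a i k) ∈ (A i).graph) ∧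
    ∀ k, ∑ i, a i (k + q i) = 0

variable {n : ℕ} {ζ : ℝ} {q : Fin (n + 1) → ℕ} {A : Fin (n + 1) → X →ₗ.[ℂ] X}
  {y z : ℕ → X} {a b : Fin (n + 1) → ℕ → X}

theorem IsSolutionSeq.zero : IsSolutionSeq ζ q A 0 0 :=
  ⟨.zero, fun _ => .zero, fun i _ => (A i).graph.zero_mem, fun _ => by simp⟩

theorem IsSolutionSeq.add (hy : IsSolutionSeq ζ q A y a) (hz : IsSolutionSeq ζ q A z b) :
    IsSolutionSeq ζ q A (y + z) (a + b) :=
  ⟨hy.1.add hz.1, fun i => (hy.2.1 i).add (hz.2.1 i),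
    fun i k => (A i).graph.add_mem (hy.2.2.1 i k) (hz.2.2.1 i k), fun k => by
      simp [Finset.sum_add_distrib, hy.2.2.2, hz.2.2.2]⟩

theorem IsSolutionSeq.smul (c : ℂ) (hy : IsSolutionSeq ζ q A y a) :
    IsSolutionSeq ζ q A (c • y) (c • a) :=
  ⟨hy.1.smul c, fun i => (hy.2.1 i).smul c,
    fun i k => (A i).graph.smul_mem c (hy.2.2.1 i k), fun k => by
      simp [← Finset.smul_sum, hy.2.2.2]⟩

theorem IsSolutionSeq.shift (hζ : 0 < ζ) (hζ2 : ζ ≤ 2) (hy : IsSolutionSeq ζ q A y a) (d : ℕ) :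
    IsSolutionSeq ζ q A (fun k => y (k + d)) (fun i k => a i (k + d)) :=
  ⟨hy.1.shift hζ hζ2 d, fun i => (hy.2.1 i).shift hζ hζ2 d, fun i k => hy.2.2.1 i (k + d),
    fun k => by
      simpa only [add_right_comm] using hy.2.2.2 (k + d)⟩

variable (ζ q A) in
/-- The initial segments of solution sequences. -/
def solutionData (N : ℕ) : Submodule ℂ (Fin N → X) where
  carrier := {x | ∃ y a, IsSolutionSeq ζ q A y a ∧ ∀ j : Fin N, x j = y j}
  zero_mem' := ⟨0, 0, .zero, fun _ => rfl⟩
  add_mem' := by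
    rintro x x' ⟨y, a, hy, hx⟩ ⟨y', a', hy', hx'⟩
    exact ⟨y + y', a + a', hy.add hy', fun j => by simp [hx, hx']⟩
  smul_mem' := by
    rintro c x ⟨y, a, hy, hx⟩
    exact ⟨c • y, c • a, hy.smul c, fun j => by simp [hx]⟩

variable [IsUniformAddGroup X] [ContinuousSMul ℂ X] [LocallyConvexSpace ℝ X] [T2Space X]

section

variable (hX : SeqComplete X) (hζ : 0 < ζ) (hζ2 : ζ ≤ 2)
  (hy : IsSolutionSeq ζ q A y a) (hz : IsSolutionSeq ζ q A z b) (h : z = 0 ∨ 1 < ζ)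

include hX hζ hζ2 hy hz h

theorem IsSolutionSeq.hasInitialValues (N : ℕ) :
    HasInitialValues ζ (mlSolution ζ y z) fun j : Fin N => y j := fun j =>
  ⟨_, hy.1.isIterCaputo hX hz.1 hζ hζ2 h j, by
    rw [(hy.1.shift hζ hζ2 j).mlSolution_zero hX hζ, zero_add]⟩

variable (hA : ∀ i, (A i).IsClosed)

include hA

theorem IsSolutionSeq.isStrongSolution : IsStrongSolution ζ q A (mlSolution ζ y z) := by
  have hsy := fun i => hy.shift hζ hζ2 (q i)
  have hsz := fun i => hz.shift hζ hζ2 (q i)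
  refine ⟨(hy.1.continuous_mlSolution hX hz.1 hζ).continuousOn,
    fun i => mlSolution ζ (fun k => a i (k + q i)) fun k => b i (k + q i),
    fun i => ⟨_, hy.1.isIterCaputo hX hz.1 hζ hζ2 h (q i), fun t ht => ?_⟩, fun i => ?_, ?_⟩
  · exact (hsy i).1.mlSolution_mem_graph hX (hA i) (hsz i).1 ((hsy i).2.1 i) ((hsz i).2.1 i) hζ
      ((hsy i).2.2.1 i) ((hsz i).2.2.1 i) ht
  · exact (((hsy i).2.1 i).continuous_mlSolution hX ((hsz i).2.1 i) hζ).continuousOn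
  · intro t ht
    refine eq_zero_of_forall_functional fun ℓ => ?_
    have h1 := hasSum_sum (s := Finset.univ) fun i _ =>
      ((hsy i).2.1 i).hasSum hX hζ le_rfl ℓ ht
    have h2 := hasSum_sum (s := Finset.univ) fun i _ =>
      ((hsz i).2.1 i).hasSum hX hζ zero_le_one ℓ ht
    simp only [← Finset.mul_sum, ← map_sum, hy.2.2.2, hz.2.2.2, map_zero, mul_zero] at h1 h2
    simp only [mlSolution, Finset.sum_add_distrib, map_add]
    rw [h1.unique hasSum_zero, h2.unique hasSum_zero, add_zero]

theorem IsSolutionSeq.isAnalyticalSolution : IsAnalyticalSolution ζ q A (mlSolution ζ y z) := by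
  refine ⟨hy.isStrongSolution hX hζ hζ2 hz h hA, hy.1.extendsToSlitPlane hX hz.1 hζ,
    fun i p => ?_⟩
  have hsy := hy.shift hζ hζ2 p
  have hsz := hz.shift hζ hζ2 p
  exact ⟨_, _, hy.1.isIterCaputo hX hz.1 hζ hζ2 h p, fun t ht =>
    hsy.1.mlSolution_mem_graph hX (hA i) hsz.1 (hsy.2.1 i) (hsz.2.1 i) hζ
      (hsy.2.2.1 i) (hsz.2.2.1 i) ht, (hsy.2.1 i).extendsToSlitPlane hX (hsz.2.1 i) hζ⟩

end

section

variable (hX : SeqComplete X) (hA : ∀ i, (A i).IsClosed) (hy : IsSolutionSeq ζ q A y a)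
  (hz : IsSolutionSeq ζ q A z b)

include hX hy hz

theorem IsSolutionSeq.hasInitialSlopes (hζ : 1 < ζ) (hζ2 : ζ ≤ 2) (N : ℕ) :
    HasInitialSlopes ζ (mlSolution ζ y z) fun j : Fin N => z j := fun j => by
  have hζ0 : 0 < ζ := by linarith
  have hsz := hz.1.shift hζ0 hζ2 j
  refine ⟨_, hy.1.isIterCaputo hX hz.1 hζ0 hζ2 (.inr hζ) j, ?_⟩
  have := (hy.1.shift hζ0 hζ2 j).hasDerivWithinAt_mlSolution hX hsz hζ.le hζ2 le_rfl
  rwa [hsz.fracSeries_zero_zero hX hζ0, fracSeries_zero_right (sub_ne_zero.2 hζ.ne'), zero_add,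
    zero_add] at this

/-- Derivatives of solutions of integer order are again given by solution sequences. -/
theorem IsSolutionSeq.exists_isIterDeriv (h : z = 0 ∧ ζ = 1 ∨ ζ = 2) (p : ℕ) :
    ∃ y' a' z' b', IsSolutionSeq ζ q A y' a' ∧ IsSolutionSeq ζ q A z' b' ∧
      (z' = 0 ∧ ζ = 1 ∨ ζ = 2) ∧ IsIterDeriv p (mlSolution ζ y z) (mlSolution ζ y' z') := by
  have hζ1 : 1 ≤ ζ := by rcases h with h | h <;> linarith
  have hζ2 : ζ ≤ 2 := by rcases h with h | h <;> linarith
  have hζ : 0 < ζ := by linarith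
  induction p with
  | zero => exact ⟨y, a, z, b, hy, hz, h, fun t _ => rfl⟩
  | succ p ih =>
    obtain ⟨y', a', z', b', hy', hz', h', hd⟩ := ih
    have hd' := fun (t : ℝ) (ht : 0 ≤ t) =>
      hy'.1.hasDerivWithinAt_mlSolution hX hz'.1 hζ1 hζ2 ht
    have hsy := hy'.shift hζ hζ2 1
    rcases h' with ⟨rfl, rfl⟩ | rfl
    -- For `ζ = 1` differentiation is the shift of `y`.
    · refine ⟨_, _, 0, 0, hsy, .zero, .inl ⟨rfl, rfl⟩, _, hd, fun t ht => ?_⟩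
      have h1 := hd' t ht
      rw [sub_self, fracSeries_zero_left hX hζ le_rfl ht] at h1
      rwa [mlSolution, fracSeries_zero_left hX hζ zero_le_one ht]
    -- For `ζ = 2` differentiation turns the pair `(y, z)` into `(z, shift y)`.
    · refine ⟨_, _, _, _, hz', hsy, .inr rfl, _, hd, fun t ht => ?_⟩
      have h1 := hd' t ht
      rw [add_comm, show (2 : ℝ) - 1 = 1 by norm_num] at h1
      exact h1

include hA

theorem IsSolutionSeq.isEntireSolution (h : z = 0 ∧ ζ = 1 ∨ ζ = 2) :
    IsEntireSolution ζ q A (mlSolution ζ y z) := by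
  have hζ2 : ζ ≤ 2 := by rcases h with h | h <;> linarith
  have hζ : 0 < ζ := by rcases h with h | h <;> linarith
  obtain ⟨m, hm⟩ : ∃ m : ℕ, ζ = m := by
    rcases h with h | h
    · exact ⟨1, by simp [h.2]⟩
    · exact ⟨2, by simp [h]⟩
  refine ⟨hy.isStrongSolution hX hζ hζ2 hz (h.imp (fun h => h.1) fun h => by linarith) hA,
    hy.1.extendsToEntire hX hz.1 hζ hm, fun i p => ?_⟩
  obtain ⟨y', a', z', b', hy', hz', -, hd⟩ := hy.exists_isIterDeriv hX hz h p
  exact ⟨_, _, hd, fun t ht => hy'.1.mlSolution_mem_graph hX (hA i) hz'.1 (hy'.2.1 i) (hz'.2.1 i)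
    hζ (hy'.2.2.1 i) (hz'.2.2.1 i) ht, (hy'.2.1 i).extendsToEntire hX (hz'.2.1 i) hζ hm⟩

end

theorem subset_closure_initialData (hX : SeqComplete X) {N : ℕ}
    {D : Set X} (hζ : 0 < ζ) (hζ2 : ζ ≤ 2) {Sol : (ℝ → X) → Prop}
    (hSol : ∀ y a, IsSolutionSeq ζ q A y a → Sol (mlSolution ζ y 0))
    (hD : {x : Fin N → X | ∀ j, x j ∈ D} ⊆ closure (solutionData ζ q A N)) :
    {x : Fin N → X | ∀ j, x j ∈ D} ⊆ closure (initialData ζ N Sol) := by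
  refine hD.trans (closure_mono ?_)
  rintro x ⟨y, a, hy, hx⟩
  refine ⟨_, hSol y a hy, ?_⟩
  rw [show x = fun j : Fin N => y j from funext hx]
  exact hy.hasInitialValues hX hζ hζ2 .zero (.inl rfl) N

/-- Values and slopes are prescribed by two independent solution sequences, so the data contain a
product of two copies of `solutionData`, and the closure of a product is the product of the
closures. -/
theorem subset_closure_initialData₂ (hX : SeqComplete X) {N : ℕ}
    {D : Set X} (hζ : 1 < ζ) (hζ2 : ζ ≤ 2) {Sol : (ℝ → X) → Prop}
    (hSol : ∀ y a z b, IsSolutionSeq ζ q A y a → IsSolutionSeq ζ q A z b →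
      Sol (mlSolution ζ y z))
    (hD : {x : Fin N → X | ∀ j, x j ∈ D} ⊆ closure (solutionData ζ q A N)) :
    {p : (Fin N → X) × (Fin N → X) | ∀ j, p.1 j ∈ D ∧ p.2 j ∈ D} ⊆
      closure (initialData₂ ζ N Sol) := by
  intro p hp
  have h1 : p ∈ closure (solutionData ζ q A N : Set (Fin N → X)) ×ˢ
      closure (solutionData ζ q A N : Set (Fin N → X)) :=
    ⟨hD fun j => (hp j).1, hD fun j => (hp j).2⟩
  rw [← closure_prod_eq] at h1
  refine closure_mono ?_ h1
  rintro ⟨x, x'⟩ ⟨⟨y, a, hy, hx⟩, z, b, hz, hx'⟩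
  have hζ0 : 0 < ζ := by linarith
  refine ⟨_, hSol y a z b hy hz, ?_, ?_⟩
  · rw [show x = fun j : Fin N => y j from funext hx]
    exact hy.hasInitialValues hX hζ0 hζ2 hz (.inr hζ) N
  · rw [show x' = fun j : Fin N => z j from funext hx']
    exact hy.hasInitialSlopes hX hz hζ hζ2 N

end SolutionSequences

section

open MeasureTheory Complex

/-! ### Contour integrals along rays -/

section Rays

/-- The point `e^{x + iγ}` of the ray with argument `γ`. -/
noncomputable def ray (γ x : ℝ) : ℂ := exp (x + γ * I)

theorem norm_ray (γ x : ℝ) : ‖ray γ x‖ = Real.exp x := by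
  simp [ray, norm_exp]

theorem continuous_ray (γ : ℝ) : Continuous (ray γ) := by
  unfold ray
  fun_prop

theorem ray_ne_zero (γ x : ℝ) : ray γ x ≠ 0 := exp_ne_zero _

/-- The outer sector `β ≤ arg w ≤ 2π - β` thereby has the same two boundary rays as the inner one.
-/
theorem ray_two_pi_sub (β x : ℝ) : ray (2 * Real.pi - β) x = ray (-β) x := by
  unfold ray
  rw [← exp_periodic (x + ((-β : ℝ) : ℂ) * I)]
  congr 1
  push_cast
  ring

theorem ray_re (γ x : ℝ) : (ray γ x).re = Real.exp x * Real.cos γ := by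
  simp [ray, exp_re]

theorem ray_im (γ x : ℝ) : (ray γ x).im = Real.exp x * Real.sin γ := by
  simp [ray, exp_im]

theorem integrable_exp_neg_mul_abs {δ : ℝ} (hδ : 0 < δ) :
    Integrable fun x : ℝ => Real.exp (-δ * |x|) := by
  rw [← integrableOn_univ, ← Iic_union_Ioi (a := (0 : ℝ))]
  refine IntegrableOn.union ?_ ?_
  · refine (integrableOn_exp_mul_Iic hδ 0).congr_fun (fun x hx => ?_) measurableSet_Iic
    simp only [abs_of_nonpos (mem_Iic.1 hx), neg_mul_neg]
  · refine (integrableOn_exp_mul_Ioi (neg_lt_zero.2 hδ) 0).congr_fun (fun x hx => ?_)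
      measurableSet_Ioi
    simp only [abs_of_pos (mem_Ioi.1 hx)]

theorem integrable_ray {H : ℂ → ℂ} {γ M δ : ℝ} (hc : Continuous fun x => H (ray γ x))
    (hδ : 0 < δ) (hb : ∀ x, ‖H (ray γ x)‖ * Real.exp x ≤ M * Real.exp (-δ * |x|)) :
    Integrable fun x => H (ray γ x) * ray γ x := by
  refine ((integrable_exp_neg_mul_abs hδ).const_mul M).mono'
    (hc.mul (continuous_ray γ)).aestronglyMeasurable (.of_forall fun x => ?_)
  rw [norm_mul, norm_ray]
  exact hb x

theorem tendsto_exp_neg_mul_natCast {δ : ℝ} (hδ : 0 < δ) (M : ℝ) :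
    Tendsto (fun N : ℕ => M * Real.exp (-δ * N)) atTop (𝓝 0) := by
  have h1 : Tendsto (fun N : ℕ => -δ * (N : ℝ)) atTop atBot :=
    tendsto_natCast_atTop_atTop.const_mul_atTop_of_neg (by linarith)
  simpa using (Real.tendsto_exp_atBot.comp h1).const_mul M

/-- Rotation of the ray of integration inside a sector where the integrand is holomorphic. -/
theorem integral_ray_eq {H : ℂ → ℂ} {γ₁ γ₂ M δ : ℝ} (hγ : γ₁ ≤ γ₂)
    (hd : ∀ x, ∀ γ ∈ Icc γ₁ γ₂, DifferentiableAt ℂ H (ray γ x)) (hδ : 0 < δ)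
    (hb : ∀ x, ∀ γ ∈ Icc γ₁ γ₂, ‖H (ray γ x)‖ * Real.exp x ≤ M * Real.exp (-δ * |x|)) :
    ∫ x, H (ray γ₁ x) * ray γ₁ x = ∫ x, H (ray γ₂ x) * ray γ₂ x := by
  have hcont : ∀ γ ∈ Icc γ₁ γ₂, Continuous fun x => H (ray γ x) := fun γ hγ' =>
    continuous_iff_continuousAt.2 fun x =>
      (hd x γ hγ').continuousAt.comp (continuous_ray γ).continuousAt
  have hint : ∀ γ ∈ Icc γ₁ γ₂, Integrable fun x => H (ray γ x) * ray γ x := fun γ hγ' =>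
    integrable_ray (hcont γ hγ') hδ fun x => hb x γ hγ'
  have hlim : ∀ γ ∈ Icc γ₁ γ₂, Tendsto (fun N : ℕ => ∫ x in (-N : ℝ)..N, H (ray γ x) * ray γ x)
      atTop (𝓝 (∫ x, H (ray γ x) * ray γ x)) := fun γ hγ' =>
    intervalIntegral_tendsto_integral (hint γ hγ')
      (tendsto_neg_atTop_atBot.comp tendsto_natCast_atTop_atTop) tendsto_natCast_atTop_atTop
  -- The substitution `w = e^u` turns the sector into a horizontal strip, where Cauchy's theorem for
  -- rectangles applies; the vertical sides vanish in the limit by `hside`.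
  let g : ℂ → ℂ := fun u => H (exp u) * exp u
  have hg : ∀ γ x : ℝ, g (x + γ * I) = H (ray γ x) * ray γ x := fun γ x => rfl
  have hside : ∀ T : ℝ, ‖I • ∫ γ in γ₁..γ₂, g (T + γ * I)‖ ≤
      M * Real.exp (-δ * |T|) * (γ₂ - γ₁) := by
    intro T
    rw [norm_smul, norm_I, one_mul]
    refine (intervalIntegral.norm_integral_le_of_norm_le_const
      (C := M * Real.exp (-δ * |T|)) fun γ hγ' => ?_).trans (le_of_eq ?_)
    · rw [uIoc_of_le hγ] at hγ'
      rw [hg, norm_mul, norm_ray]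
      exact hb T γ (Ioc_subset_Icc_self hγ')
    · rw [abs_of_nonneg (sub_nonneg.2 hγ)]
  have hrect : ∀ N : ℕ, (∫ x in (-N : ℝ)..N, H (ray γ₁ x) * ray γ₁ x) -
      (∫ x in (-N : ℝ)..N, H (ray γ₂ x) * ray γ₂ x) =
      I • (∫ γ in γ₁..γ₂, g ((-N : ℝ) + γ * I)) - I • ∫ γ in γ₁..γ₂, g ((N : ℝ) + γ * I) := by
    intro N
    have h := integral_boundary_rect_eq_zero_of_differentiableOn g
      ((-N : ℝ) + γ₁ * I) ((N : ℝ) + γ₂ * I) fun u hu => by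
        rw [mem_reProdIm] at hu
        have him : u.im ∈ Icc γ₁ γ₂ := by simpa [uIcc_of_le hγ] using hu.2
        have hexp : exp u = ray u.im u.re := by rw [ray, re_add_im]
        have h1 : DifferentiableAt ℂ H (exp u) := hexp ▸ hd u.re u.im him
        exact ((h1.comp u differentiableAt_exp).mul
          differentiableAt_exp).differentiableWithinAt
    simp only [add_re, ofReal_re, mul_re, I_re, mul_zero, ofReal_im, I_im, mul_one, sub_self,
      add_zero, add_im, mul_im, zero_add] at h
    rw [← sub_eq_zero, ← h]
    simp only [hg]
    ring
  refine sub_eq_zero.1 (tendsto_nhds_unique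
    ((hlim γ₁ (left_mem_Icc.2 hγ)).sub (hlim γ₂ (right_mem_Icc.2 hγ))) ?_)
  refine squeeze_zero_norm (a := fun N : ℕ => 2 * (γ₂ - γ₁) * M * Real.exp (-δ * N))
    (fun N => ?_) (tendsto_exp_neg_mul_natCast hδ _)
  rw [hrect]
  refine (norm_sub_le _ _).trans ?_
  have h1 := hside (-N : ℝ)
  have h2 := hside N
  rw [abs_neg, Nat.abs_cast] at h1
  rw [Nat.abs_cast] at h2
  linarith

/-- The integral over the boundary of the sector `|arg w| ≤ β`. -/
noncomputable def sectorIntegral (β : ℝ) (H : ℂ → ℂ) : ℂ :=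
  ∫ x, (H (ray β x) * ray β x - H (ray (-β) x) * ray (-β) x)

/-- One boundary ray is rotated onto the other through the positive axis. -/
theorem sectorIntegral_eq_zero_of_inside {H : ℂ → ℂ} {β M δ : ℝ} (hβ : 0 ≤ β)
    (hd : ∀ x, ∀ γ ∈ Icc (-β) β, DifferentiableAt ℂ H (ray γ x)) (hδ : 0 < δ)
    (hb : ∀ x, ∀ γ ∈ Icc (-β) β, ‖H (ray γ x)‖ * Real.exp x ≤ M * Real.exp (-δ * |x|)) :
    sectorIntegral β H = 0 := by
  have hle : -β ≤ β := by linarith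
  have hint : ∀ γ ∈ Icc (-β) β, Integrable fun x => H (ray γ x) * ray γ x := fun γ hγ =>
    integrable_ray (continuous_iff_continuousAt.2 fun x =>
      (hd x γ hγ).continuousAt.comp (continuous_ray γ).continuousAt) hδ fun x => hb x γ hγ
  rw [sectorIntegral, integral_sub (hint _ (right_mem_Icc.2 hle)) (hint _ (left_mem_Icc.2 hle)),
    integral_ray_eq hle hd hδ hb, sub_self]

/-- One boundary ray is rotated onto the other through the negative axis. -/
theorem sectorIntegral_eq_zero_of_outside {H : ℂ → ℂ} {β M δ : ℝ} (hβ : β ≤ Real.pi)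
    (hd : ∀ x, ∀ γ ∈ Icc β (2 * Real.pi - β), DifferentiableAt ℂ H (ray γ x)) (hδ : 0 < δ)
    (hb : ∀ x, ∀ γ ∈ Icc β (2 * Real.pi - β),
      ‖H (ray γ x)‖ * Real.exp x ≤ M * Real.exp (-δ * |x|)) :
    sectorIntegral β H = 0 := by
  have hle : β ≤ 2 * Real.pi - β := by linarith
  have hint : ∀ γ ∈ Icc β (2 * Real.pi - β), Integrable fun x => H (ray γ x) * ray γ x :=
    fun γ hγ => integrable_ray (continuous_iff_continuousAt.2 fun x =>
      (hd x γ hγ).continuousAt.comp (continuous_ray γ).continuousAt) hδ fun x => hb x γ hγ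
  have h1 := integral_sub (hint _ (left_mem_Icc.2 hle)) (hint _ (right_mem_Icc.2 hle))
  rw [integral_ray_eq hle hd hδ hb, sub_self] at h1
  simp only [ray_two_pi_sub] at h1
  exact h1

theorem sectorIntegral_const_mul (β : ℝ) (c : ℂ) (H : ℂ → ℂ) :
    sectorIntegral β (fun w => c * H w) = c * sectorIntegral β H := by
  rw [sectorIntegral, sectorIntegral, ← integral_const_mul]
  congr 1
  funext x
  ring

end Rays

/-! ### Growth and decay estimates -/

section Bounds

/-- `s (a+s)^κ` decays exponentially in `log s` if `κ < -1`. -/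
theorem exists_rpow_decay {a κ : ℝ} (ha : 0 < a) (hκ : κ < -1) :
    ∃ M δ : ℝ, 0 < δ ∧ ∀ x : ℝ, (a + Real.exp x) ^ κ * Real.exp x ≤
      M * Real.exp (-δ * |x|) := by
  -- As `x → -∞` the factor `e^x` decays with rate `1`; as `x → ∞` the product decays with rate `-κ
  -- - 1`.
  refine ⟨max 1 (a ^ κ), min 1 (-κ - 1), lt_min one_pos (by linarith), fun x => ?_⟩
  have hs := Real.exp_pos x
  rcases le_total 0 x with hx | hx
  · rw [abs_of_nonneg hx]
    calc (a + Real.exp x) ^ κ * Real.exp x ≤ (Real.exp x) ^ κ * Real.exp x := by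
          gcongr ?_ * _
          exact Real.rpow_le_rpow_of_nonpos hs (by linarith) (by linarith)
      _ = 1 * Real.exp (-(-κ - 1) * x) := by
          rw [← Real.exp_mul, ← Real.exp_add, one_mul]; ring_nf
      _ ≤ max 1 (a ^ κ) * Real.exp (-min 1 (-κ - 1) * x) := by
          gcongr
          · exact le_max_left _ _
          · exact min_le_right _ _
  · rw [abs_of_nonpos hx]
    calc (a + Real.exp x) ^ κ * Real.exp x ≤ a ^ κ * Real.exp x := by
          gcongr ?_ * _
          exact Real.rpow_le_rpow_of_nonpos ha (by linarith) (by linarith)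
      _ ≤ max 1 (a ^ κ) * Real.exp (-min 1 (-κ - 1) * -x) := by
          gcongr
          · exact le_max_right _ _
          · nlinarith [min_le_left 1 (-κ - 1)]

/-- In the Euler integral for `Γ(s + 1)` keep only the interval `(τ, τ + 1]`, where the integrand is
at least `e^{-(τ+1)} τ^s`. -/
theorem rpow_le_exp_mul_Gamma {τ s : ℝ} (hτ : 0 ≤ τ) (hs : 0 ≤ s) :
    τ ^ s ≤ Real.exp (τ + 1) * Real.Gamma (s + 1) := by
  have hint : IntegrableOn (fun x : ℝ => Real.exp (-x) * x ^ s) (Ioi 0) := by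
    simpa using Real.GammaIntegral_convergent (s := s + 1) (by linarith)
  have h1 : ∫ x in Ioc τ (τ + 1), Real.exp (-(τ + 1)) * τ ^ s ≤
      ∫ x in Ioc τ (τ + 1), Real.exp (-x) * x ^ s := by
    refine setIntegral_mono_on (integrableOn_const (by simp) enorm_ne_top) (hint.mono_set fun x hx => hτ.trans_lt hx.1)
      measurableSet_Ioc fun x hx => ?_
    have := hx.1
    have := hx.2
    gcongr
  have h2 : ∫ x in Ioc τ (τ + 1), Real.exp (-x) * x ^ s ≤
      ∫ x in Ioi 0, Real.exp (-x) * x ^ s := by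
    refine setIntegral_mono_set hint ?_ ?_
    · filter_upwards [ae_restrict_mem measurableSet_Ioi] with x hx
      have : (0 : ℝ) < x := hx
      positivity
    · exact LE.le.eventuallyLE fun x hx => hτ.trans_lt hx.1
  have h3 : Real.Gamma (s + 1) = ∫ x in Ioi 0, Real.exp (-x) * x ^ s := by
    rw [Real.Gamma_eq_integral (by linarith)]; simp
  rw [h3, ← div_le_iff₀' (Real.exp_pos _), div_eq_mul_inv, ← Real.exp_neg, mul_comm]
  refine le_trans (le_of_eq ?_) (h1.trans h2)
  simp

theorem exists_exp_rpow_le {K c σ b a : ℝ} (hK : 0 ≤ K) (hc : 0 < c) (hσ : 0 < σ) (hσb : σ < b)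
    (ha : 0 ≤ a) : ∃ C, ∀ s, 0 < s → K * (a + s) ^ σ - c * s ^ b ≤ C := by
  -- Beyond `S` one has both `a + s ≤ 2s` and `K 2^σ ≤ c s^{b-σ}`, so the difference is nonpositive
  -- there.
  let S := max a ((K * 2 ^ σ / c) ^ (1 / (b - σ)))
  have hS : 0 ≤ S := ha.trans (le_max_left _ _)
  refine ⟨K * (a + S) ^ σ, fun s hs => ?_⟩
  have hsb : 0 ≤ c * s ^ b := by positivity
  rcases le_total s S with h | h
  · have : K * (a + s) ^ σ ≤ K * (a + S) ^ σ := by gcongr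
    linarith
  · have h1 : a + s ≤ 2 * s := by linarith [le_max_left a ((K * 2 ^ σ / c) ^ (1 / (b - σ)))]
    have h2 : K * 2 ^ σ / c ≤ s ^ (b - σ) := by
      have h3 : (K * 2 ^ σ / c) ^ (1 / (b - σ)) ≤ s := (le_max_right _ _).trans h
      calc K * 2 ^ σ / c = ((K * 2 ^ σ / c) ^ (1 / (b - σ))) ^ (b - σ) := by
            rw [← Real.rpow_mul (by positivity), one_div_mul_cancel (by linarith), Real.rpow_one]
        _ ≤ s ^ (b - σ) := by gcongr
    rw [div_le_iff₀ hc] at h2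
    have h4 : K * (a + s) ^ σ ≤ c * s ^ b := by
      calc K * (a + s) ^ σ ≤ K * (2 * s) ^ σ := by gcongr
        _ = K * 2 ^ σ * s ^ σ := by rw [Real.mul_rpow (by norm_num) hs.le]; ring
        _ ≤ s ^ (b - σ) * c * s ^ σ := by gcongr
        _ = c * (s ^ (b - σ) * s ^ σ) := by ring
        _ = c * s ^ b := by rw [← Real.rpow_add hs]; ring_nf
    have : 0 ≤ K * (a + S) ^ σ := by positivity
    linarith

/-- Superexponential decay dominates exponentials of lower order and polynomials. -/
theorem exists_exp_decay {ρ c σ b a : ℝ} (hρ : 0 ≤ ρ) (hc : 0 < c) (hσ : 0 < σ) (hσb : σ < b)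
    (ha : 0 ≤ a) (N : ℕ) : ∃ M, ∀ x : ℝ, Real.exp ((ρ * (a + Real.exp x)) ^ σ) *
      (a + Real.exp x) ^ N * Real.exp (-c * Real.exp x ^ b) * Real.exp x ≤
      M * Real.exp (-1 * |x|) := by
  obtain ⟨C, hC⟩ := exists_exp_rpow_le (K := ρ ^ σ + 1) (a := 1 + a) (by positivity) hc hσ hσb
    (by linarith)
  refine ⟨Real.exp C * (Real.exp 1 * Real.Gamma ((N + 2) / σ + 1)), fun x => ?_⟩
  set s := Real.exp x with hs_def
  have hs : 0 < s := Real.exp_pos x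
  have hτ : 0 < 1 + a + s := by linarith
  -- The polynomial factor is absorbed into one more exponential of order `σ`, whence the constant
  -- `ρ ^ σ + 1` above.
  have h1 : (a + s) ^ N * (s * s + 1) ≤ Real.exp ((1 + a + s) ^ σ + 1) *
      Real.Gamma ((N + 2) / σ + 1) := by
    have h2 := rpow_le_exp_mul_Gamma (τ := (1 + a + s) ^ σ) (s := (N + 2) / σ) (by positivity)
      (by positivity)
    rw [← Real.rpow_mul hτ.le, mul_div_cancel₀ _ hσ.ne'] at h2
    refine le_trans ?_ h2
    rw [show ((N : ℝ) + 2) = ((N + 2 : ℕ) : ℝ) by push_cast; ring, Real.rpow_natCast, pow_add]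
    gcongr
    · linarith
    · nlinarith
  have h3 : (ρ * (a + s)) ^ σ ≤ ρ ^ σ * (1 + a + s) ^ σ := by
    rw [Real.mul_rpow hρ (by linarith)]
    gcongr
    linarith
  -- The extra factor `s² + 1` pays for the decay `e^{-|x|}` at both ends.
  have h4 : s ≤ (s * s + 1) * Real.exp (-1 * |x|) := by
    rcases le_total 0 x with hx | hx
    · rw [abs_of_nonneg hx, neg_one_mul, Real.exp_neg, ← hs_def, add_mul, mul_assoc,
        mul_inv_cancel₀ hs.ne']
      linarith [inv_pos.2 hs]
    · rw [abs_of_nonpos hx, neg_mul_neg, one_mul, ← hs_def]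
      nlinarith [mul_pos hs (mul_pos hs hs)]
  have hΓ : 0 ≤ Real.Gamma ((N + 2) / σ + 1) := (Real.Gamma_pos_of_pos (by positivity)).le
  calc Real.exp ((ρ * (a + s)) ^ σ) * (a + s) ^ N * Real.exp (-c * s ^ b) * s
      ≤ Real.exp (ρ ^ σ * (1 + a + s) ^ σ) * (a + s) ^ N * Real.exp (-c * s ^ b) *
        ((s * s + 1) * Real.exp (-1 * |x|)) := by gcongr
    _ = Real.exp (ρ ^ σ * (1 + a + s) ^ σ) * Real.exp (-c * s ^ b) *
        ((a + s) ^ N * (s * s + 1)) * Real.exp (-1 * |x|) := by ring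
    _ ≤ Real.exp (ρ ^ σ * (1 + a + s) ^ σ) * Real.exp (-c * s ^ b) *
        (Real.exp ((1 + a + s) ^ σ + 1) * Real.Gamma ((N + 2) / σ + 1)) * Real.exp (-1 * |x|) := by
        gcongr
    _ = Real.exp ((ρ ^ σ + 1) * (1 + a + s) ^ σ - c * s ^ b) *
        (Real.exp 1 * Real.Gamma ((N + 2) / σ + 1)) * Real.exp (-1 * |x|) := by
        rw [show (ρ ^ σ + 1) * (1 + a + s) ^ σ - c * s ^ b =
          ρ ^ σ * (1 + a + s) ^ σ + -c * s ^ b + (1 + a + s) ^ σ by ring, Real.exp_add,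
          Real.exp_add, Real.exp_add (ρ ^ σ * (1 + a + s) ^ σ)]
        ring
    _ ≤ _ := by gcongr; exact hC s hs

end Bounds

/-! ### The contour inside the rotated sector -/

section Geometry

theorem norm_sub_ray_le {a : ℝ} (ha : 0 ≤ a) (γ x : ℝ) : ‖(a : ℂ) - ray γ x‖ ≤ a + Real.exp x := by
  refine (norm_sub_le _ _).trans ?_
  rw [norm_ray, norm_real, Real.norm_of_nonneg ha]

/-- The constant in the lower bound for `|a - w|` on the boundary of a sector. -/
noncomputable def sectorConst (β : ℝ) : ℝ := √((1 - |Real.cos β|) / 2)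

theorem abs_cos_lt_one {β : ℝ} (hβ : 0 < β) (hβπ : β < Real.pi) : |Real.cos β| < 1 := by
  rw [abs_lt]
  constructor
  · rw [← Real.cos_pi]
    exact Real.cos_lt_cos_of_nonneg_of_le_pi hβ.le le_rfl hβπ
  · rw [← Real.cos_zero]
    exact Real.cos_lt_cos_of_nonneg_of_le_pi le_rfl hβπ.le hβ

theorem sectorConst_pos {β : ℝ} (hβ : 0 < β) (hβπ : β < Real.pi) : 0 < sectorConst β := by
  have := abs_cos_lt_one hβ hβπ
  exact Real.sqrt_pos.2 (by linarith)

theorem cos_le_of_mem_Icc {β γ : ℝ} (hβ : 0 ≤ β) (hγ : γ ∈ Icc β (2 * Real.pi - β)) :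
    Real.cos γ ≤ Real.cos β := by
  rcases le_total γ Real.pi with h | h
  · exact Real.cos_le_cos_of_nonneg_of_le_pi hβ h hγ.1
  · rw [← Real.cos_two_pi_sub]
    exact Real.cos_le_cos_of_nonneg_of_le_pi hβ (by linarith) (by linarith [hγ.2])

/-- With `s = e^x` and `c = |cos β|`, the law of cosines gives `|a - w|² ≥ a² + s² - 2asc ≥ (1 -
c)(a² + s²) ≥ (1 - c)(a + s)²/2`. -/
theorem sectorConst_mul_le_norm {a β γ : ℝ} (ha : 0 ≤ a) (hγ : Real.cos γ ≤ |Real.cos β|) (x : ℝ) :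
    sectorConst β * (a + Real.exp x) ≤ ‖(a : ℂ) - ray γ x‖ := by
  have hs := Real.exp_pos x
  have h1 : |Real.cos β| ≤ 1 := Real.abs_cos_le_one β
  refine le_of_sq_le_sq ?_ (norm_nonneg _)
  rw [mul_pow, sectorConst, Real.sq_sqrt (by linarith), Complex.sq_norm, normSq_apply]
  simp only [sub_re, sub_im, ofReal_re, ofReal_im, ray_re, ray_im]
  have h2 := Real.sin_sq_add_cos_sq γ
  have h3 : 0 ≤ a * Real.exp x := by positivity
  have h4 : (a - Real.exp x * Real.cos γ) * (a - Real.exp x * Real.cos γ) +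
      (0 - Real.exp x * Real.sin γ) * (0 - Real.exp x * Real.sin γ) =
      a ^ 2 + Real.exp x ^ 2 - 2 * (a * Real.exp x) * Real.cos γ := by
    linear_combination Real.exp x ^ 2 * h2
  rw [h4]
  nlinarith [sq_nonneg (a - Real.exp x), abs_nonneg (Real.cos β),
    mul_nonneg h3 (sub_nonneg.2 hγ),
    mul_nonneg (abs_nonneg (Real.cos β)) (sq_nonneg (a - Real.exp x))]

/-- Because `re z = ‖z‖ cos (arg z)`, the sector can be described by an open condition that does not
involve the discontinuous function `arg`. -/
theorem mem_sector_of_lt_re {α : ℝ} (hα : 0 ≤ α) {z : ℂ} (hz : z ≠ 0)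
    (h : ‖z‖ * Real.cos α < z.re) : z ∈ sector α := by
  refine ⟨hz, ?_⟩
  rw [← norm_mul_cos_arg, mul_lt_mul_iff_right₀ (norm_pos_iff.2 hz), ← Real.cos_abs (arg z)] at h
  by_contra hle
  exact absurd (Real.cos_le_cos_of_nonneg_of_le_pi hα (abs_arg_le_pi z) (not_lt.1 hle)) (not_le.2 h)

/-- From `cos γ ≤ cos β ≤ -cos α` the real part is at least `a + e^x cos α`. According to the sign
of `cos α`, compare with `‖a - w‖ ≤ a + e^x` or with `‖a - w‖ ≥ e^x - a`, and use `|cos α| < 1`. -/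
theorem lt_re_sub_ray {a α β γ : ℝ} (ha : 0 < a) (hα : 0 < α) (hαπ : α < Real.pi)
    (hβ : Real.pi - α ≤ β) (hβπ : β ≤ Real.pi) (hγ : Real.cos γ ≤ Real.cos β) (x : ℝ) :
    ‖(a : ℂ) - ray γ x‖ * Real.cos α < ((a : ℂ) - ray γ x).re := by
  have hs := Real.exp_pos x
  have h1 : Real.cos β ≤ -Real.cos α := by
    rw [← Real.cos_pi_sub]
    exact Real.cos_le_cos_of_nonneg_of_le_pi (by linarith) hβπ hβ
  have h2 := abs_lt.1 (abs_cos_lt_one hα hαπ)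
  have hre : ((a : ℂ) - ray γ x).re = a - Real.exp x * Real.cos γ := by simp [ray_re]
  have hre' : a + Real.exp x * Real.cos α ≤ ((a : ℂ) - ray γ x).re := by
    rw [hre]; nlinarith
  have hup := norm_sub_ray_le ha.le γ x
  have hlow : Real.exp x - a ≤ ‖(a : ℂ) - ray γ x‖ := by
    have := norm_sub_norm_le (ray γ x) (a : ℂ)
    rwa [norm_ray, norm_real, Real.norm_of_nonneg ha.le, norm_sub_rev] at this
  rcases le_total 0 (Real.cos α) with h | h <;> nlinarith

/-- The point `e^{iφ}(a - w)`. -/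
noncomputable def contourPt (φ a : ℝ) (w : ℂ) : ℂ := exp (I * φ) * (a - w)

theorem norm_contourPt (φ a : ℝ) (w : ℂ) : ‖contourPt φ a w‖ = ‖(a : ℂ) - w‖ := by
  rw [contourPt, norm_mul, mul_comm I, norm_exp_ofReal_mul_I, one_mul]

theorem differentiable_contourPt (φ a : ℝ) : Differentiable ℂ (contourPt φ a) := by
  unfold contourPt
  fun_prop

/-- The whole outer sector is mapped into the interior of the truncated sector: `α + β ≥ π` takes
care of the argument and the size of `a` of the modulus. Interior points are needed for holomorphy
of the resolvent. -/
theorem contourPt_mem_nhds {a α β γ φ r : ℝ} (ha : 0 < a) (hα : 0 < α) (hαπ : α < Real.pi)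
    (hβ : Real.pi - α ≤ β) (hβπ : β < Real.pi) (hr : r < sectorConst β * a)
    (hγ : γ ∈ Icc β (2 * Real.pi - β)) (x : ℝ) :
    truncatedSector φ α r ∈ 𝓝 (contourPt φ a (ray γ x)) := by
  have hβ0 : 0 < β := by linarith
  have hcos := cos_le_of_mem_Icc hβ0.le hγ
  have hlow := sectorConst_mul_le_norm ha.le (hcos.trans (le_abs_self _)) x
  have hlt := lt_re_sub_ray ha hα hαπ hβ hβπ.le hcos x
  have hc := sectorConst_pos hβ0 hβπ
  have hr' : r < ‖(a : ℂ) - ray γ x‖ := by nlinarith [Real.exp_pos x]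
  have h0 : (a : ℂ) - ray γ x ≠ 0 := by
    rw [← norm_pos_iff]
    exact lt_of_lt_of_le (mul_pos hc (by positivity)) hlow
  have hexp : exp (-(I * φ)) * exp (I * φ) = 1 := by rw [← exp_add, neg_add_cancel, exp_zero]
  let O : Set ℂ := {z | z ≠ 0 ∧ r < ‖z‖ ∧ ‖z‖ * Real.cos α < z.re}
  have hO : IsOpen O := isOpen_ne.inter ((isOpen_lt continuous_const continuous_norm).inter
    (isOpen_lt (by fun_prop) continuous_re))
  have hcont : Continuous fun μ : ℂ => exp (-(I * φ)) * μ := by fun_prop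
  refine mem_of_superset ((hO.preimage hcont).mem_nhds ?_) fun μ hμ => ?_
  · have : exp (-(I * φ)) * contourPt φ a (ray γ x) = (a : ℂ) - ray γ x := by
      rw [contourPt, ← mul_assoc, hexp, one_mul]
    rw [mem_preimage, this]
    exact ⟨h0, hr', hlt⟩
  · refine ⟨⟨_, mem_sector_of_lt_re hα.le hμ.1 hμ.2.2, ?_⟩, ?_⟩
    · rw [← mul_assoc, mul_comm (exp _), hexp, one_mul]
    · have := hμ.2.1.le
      rwa [norm_mul, ← mul_neg, mul_comm I, ← ofReal_neg, norm_exp_ofReal_mul_I, one_mul] at this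

theorem exists_norm_contourPt_rpow_decay {a β κ : ℝ} (φ : ℝ) (ha : 0 < a) (hβ : 0 < β)
    (hβπ : β < Real.pi) (hκ : κ < -1) : ∃ M δ : ℝ, 0 < δ ∧ ∀ x : ℝ, ∀ γ : ℝ,
      Real.cos γ ≤ |Real.cos β| →
      ‖contourPt φ a (ray γ x)‖ ^ κ * Real.exp x ≤ M * Real.exp (-δ * |x|) := by
  obtain ⟨M, δ, hδ, hM⟩ := exists_rpow_decay ha hκ
  have hc := sectorConst_pos hβ hβπ
  refine ⟨sectorConst β ^ κ * M, δ, hδ, fun x γ hγ => ?_⟩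
  rw [norm_contourPt]
  have hpos : 0 < a + Real.exp x := by positivity
  calc ‖(a : ℂ) - ray γ x‖ ^ κ * Real.exp x
      ≤ (sectorConst β * (a + Real.exp x)) ^ κ * Real.exp x := by
        gcongr ?_ * _
        exact Real.rpow_le_rpow_of_nonpos (by positivity) (sectorConst_mul_le_norm ha.le hγ x)
          (by linarith)
    _ = sectorConst β ^ κ * ((a + Real.exp x) ^ κ * Real.exp x) := by
        rw [Real.mul_rpow hc.le hpos.le, mul_assoc]
    _ ≤ sectorConst β ^ κ * (M * Real.exp (-δ * |x|)) :=
        mul_le_mul_of_nonneg_left (hM x) (by positivity)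
    _ = _ := by ring

end Geometry

/-! ### Linearity of sector integrals -/

section SectorIntegral

/-- Integrability over the boundary of the sector `|arg w| ≤ β`. -/
def SectorIntegrable (β : ℝ) (H : ℂ → ℂ) : Prop :=
  Integrable fun x => H (ray β x) * ray β x - H (ray (-β) x) * ray (-β) x

theorem SectorIntegrable.of_bound {β M δ : ℝ} {H : ℂ → ℂ}
    (hc : ∀ γ, |γ| = β → Continuous fun x => H (ray γ x)) (hβ : 0 ≤ β) (hδ : 0 < δ)
    (hb : ∀ γ, |γ| = β → ∀ x, ‖H (ray γ x)‖ * Real.exp x ≤ M * Real.exp (-δ * |x|)) :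
    SectorIntegrable β H :=
  (integrable_ray (hc β (abs_of_nonneg hβ)) hδ (hb β (abs_of_nonneg hβ))).sub
    (integrable_ray (hc (-β) (by rw [abs_neg, abs_of_nonneg hβ])) hδ
      (hb (-β) (by rw [abs_neg, abs_of_nonneg hβ])))

theorem sectorIntegral_congr {β : ℝ} (hβ : 0 ≤ β) {H K : ℂ → ℂ}
    (h : ∀ γ, |γ| = β → ∀ x, H (ray γ x) = K (ray γ x)) :
    sectorIntegral β H = sectorIntegral β K := by
  unfold sectorIntegral
  congr 1
  funext x
  rw [h β (abs_of_nonneg hβ), h (-β) (by rw [abs_neg, abs_of_nonneg hβ])]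

theorem sectorIntegral_add {β : ℝ} {H K : ℂ → ℂ} (hH : SectorIntegrable β H)
    (hK : SectorIntegrable β K) :
    sectorIntegral β (fun w => H w + K w) = sectorIntegral β H + sectorIntegral β K := by
  unfold sectorIntegral
  rw [← integral_add hH hK]
  congr 1
  funext x
  ring

theorem sectorIntegral_sub {β : ℝ} {H K : ℂ → ℂ} (hH : SectorIntegrable β H)
    (hK : SectorIntegrable β K) :
    sectorIntegral β (fun w => H w - K w) = sectorIntegral β H - sectorIntegral β K := by
  unfold sectorIntegral
  rw [← integral_sub hH hK]
  congr 1
  funext x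
  ring

theorem sectorIntegral_sum {ι : Type*} {β : ℝ} (s : Finset ι) {H : ι → ℂ → ℂ}
    (hH : ∀ i ∈ s, SectorIntegrable β (H i)) :
    sectorIntegral β (fun w => ∑ i ∈ s, H i w) = ∑ i ∈ s, sectorIntegral β (H i) := by
  unfold sectorIntegral
  rw [← integral_finsetSum s hH]
  congr 1
  funext x
  rw [Finset.sum_sub_distrib, Finset.sum_mul, Finset.sum_mul]

end SectorIntegral

/-! ### The kernel `exp(-ε w^b)` -/

section Kernel

/-- The function `exp(-ε w^b)`. -/
noncomputable def expKernel (ε b : ℝ) (w : ℂ) : ℂ := exp (-ε * exp (b * log w))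

theorem log_ray {γ : ℝ} (hγ : |γ| < Real.pi) (x : ℝ) : log (ray γ x) = x + γ * I := by
  have := abs_lt.1 hγ
  rw [ray, log_exp] <;> simp <;> linarith

theorem ray_mem_slitPlane {γ : ℝ} (hγ : |γ| < Real.pi) (x : ℝ) : ray γ x ∈ slitPlane := by
  rw [mem_slitPlane_iff_arg]
  refine ⟨?_, ray_ne_zero _ _⟩
  have := congrArg im (log_ray hγ x)
  rw [log_im] at this
  rw [this]
  simpa using (abs_lt.1 hγ).2.ne

theorem differentiableAt_expKernel (ε b : ℝ) {γ : ℝ} (hγ : |γ| < Real.pi) (x : ℝ) :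
    DifferentiableAt ℂ (expKernel ε b) (ray γ x) := by
  have h := differentiableAt_log (ray_mem_slitPlane hγ x)
  exact (((h.const_mul (b : ℂ)).cexp).const_mul (-ε : ℂ)).cexp

theorem continuous_expKernel_ray (ε b : ℝ) {γ : ℝ} (hγ : |γ| < Real.pi) :
    Continuous fun x => expKernel ε b (ray γ x) :=
  continuous_iff_continuousAt.2 fun x =>
    (differentiableAt_expKernel ε b hγ x).continuousAt.comp (continuous_ray γ).continuousAt

/-- On the ray of argument `γ` the real part of `w^b` is `|w|^b cos(bγ)`, and `cos(bγ) ≥ cos(bβ)`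
since `b|γ| ≤ bβ < π/2`. -/
theorem norm_expKernel_le {ε b β γ : ℝ} (hε : 0 ≤ ε) (hb : 0 ≤ b) (hβπ : β < Real.pi)
    (hbβ : b * β < Real.pi / 2) (hγ : |γ| ≤ β) (x : ℝ) :
    ‖expKernel ε b (ray γ x)‖ ≤ Real.exp (-(ε * Real.cos (b * β)) * Real.exp x ^ b) := by
  have hγπ : |γ| < Real.pi := hγ.trans_lt hβπ
  rw [expKernel, norm_exp, log_ray hγπ, Real.exp_le_exp, ← Real.exp_mul]
  have h1 : (-(ε : ℂ) * exp (b * (x + γ * I))).re = -(ε * Real.cos (b * γ)) * Real.exp (x * b) := by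
    have : (b : ℂ) * (x + γ * I) = ((x * b : ℝ) : ℂ) + ((b * γ : ℝ) : ℂ) * I := by
      push_cast; ring
    rw [this, ← ofReal_neg, re_ofReal_mul, exp_re]
    simp
    ring
  rw [h1]
  have h2 : Real.cos (b * β) ≤ Real.cos (b * γ) := by
    rw [← Real.cos_abs (b * γ), abs_mul, abs_of_nonneg hb]
    refine Real.cos_le_cos_of_nonneg_of_le_pi (by positivity) (by linarith [Real.pi_pos]) ?_
    gcongr
  rw [neg_mul, neg_mul, neg_le_neg_iff]
  gcongr

theorem norm_expKernel_le_one {ε b β γ : ℝ} (hε : 0 ≤ ε) (hb : 0 ≤ b) (hβ : 0 ≤ β)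
    (hβπ : β < Real.pi) (hbβ : b * β < Real.pi / 2) (hγ : |γ| ≤ β) (x : ℝ) :
    ‖expKernel ε b (ray γ x)‖ ≤ 1 := by
  refine (norm_expKernel_le hε hb hβπ hbβ hγ x).trans ?_
  rw [Real.exp_le_one_iff, neg_mul, neg_nonpos]
  have : 0 ≤ Real.cos (b * β) :=
    Real.cos_nonneg_of_mem_Icc ⟨by nlinarith [Real.pi_pos, mul_nonneg hb hβ], hbβ.le⟩
  positivity

end Kernel

/-! ### Integrals against the kernel and their limits as `ε → 0` -/

section KernelIntegrals

/-- Admissible opening angle and exponent of the kernel `exp(-ε w^b)`. -/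
structure KernelAngle (b β : ℝ) : Prop where
  b_pos : 0 < b
  pos : 0 < β
  lt_pi : β < Real.pi
  mul_lt : b * β < Real.pi / 2

namespace KernelAngle

variable {b β : ℝ} (h : KernelAngle b β)

include h

theorem cos_pos : 0 < Real.cos (b * β) :=
  Real.cos_pos_of_mem_Ioo ⟨by linarith [Real.pi_pos, mul_pos h.b_pos h.pos], h.mul_lt⟩

theorem exists_decay {ρ σ ε : ℝ} (hρ : 0 ≤ ρ) (hσ : 0 < σ) (hσb : σ < b) (hε : 0 < ε) {a : ℝ}
    (ha : 0 ≤ a) (N : ℕ) : ∃ M, ∀ γ, |γ| ≤ β → ∀ x, Real.exp ((ρ * (a + Real.exp x)) ^ σ) *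
      (a + Real.exp x) ^ N * ‖expKernel ε b (ray γ x)‖ * Real.exp x ≤
      M * Real.exp (-1 * |x|) := by
  obtain ⟨M, hM⟩ := exists_exp_decay hρ (mul_pos hε h.cos_pos) hσ hσb ha N
  refine ⟨M, fun γ hγ x => le_trans ?_ (hM x)⟩
  gcongr
  exact norm_expKernel_le hε.le h.b_pos.le h.lt_pi h.mul_lt hγ x

theorem exists_norm_mul_decay {ε : ℝ} (hε : 0 < ε) {a : ℝ} (ha : 0 ≤ a) (N : ℕ) {C : ℝ}
    (hC : 0 ≤ C) :
    ∃ M, ∀ γ, |γ| ≤ β → ∀ x, ∀ z : ℂ, ‖z‖ ≤ C * (a + Real.exp x) ^ N →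
      ‖expKernel ε b (ray γ x) * z‖ * Real.exp x ≤ M * Real.exp (-1 * |x|) := by
  -- With `ρ = 0` the exponential factor is `1`, and any `σ` between `0` and `b` would do.
  obtain ⟨M, hM⟩ := h.exists_decay le_rfl (half_pos h.b_pos) (half_lt_self h.b_pos) hε ha N
  refine ⟨C * M, fun γ hγ x z hz => ?_⟩
  have h1 := hM γ hγ x
  rw [zero_mul, Real.zero_rpow (half_pos h.b_pos).ne', Real.exp_zero, one_mul] at h1
  calc ‖expKernel ε b (ray γ x) * z‖ * Real.exp x
      ≤ ‖expKernel ε b (ray γ x)‖ * (C * (a + Real.exp x) ^ N) * Real.exp x := by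
        rw [norm_mul]; gcongr
    _ = C * ((a + Real.exp x) ^ N * ‖expKernel ε b (ray γ x)‖ * Real.exp x) := by ring
    _ ≤ C * (M * Real.exp (-1 * |x|)) := mul_le_mul_of_nonneg_left h1 hC
    _ = _ := by ring

theorem sectorIntegrable {ε : ℝ} (hε : 0 < ε) {a : ℝ} (ha : 0 ≤ a) {N : ℕ} {C : ℝ} (hC : 0 ≤ C)
    {H : ℂ → ℂ} (hc : ∀ γ, |γ| = β → Continuous fun x => H (ray γ x))
    (hH : ∀ γ, |γ| = β → ∀ x, ‖H (ray γ x)‖ ≤ C * (a + Real.exp x) ^ N) :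
    SectorIntegrable β fun w => expKernel ε b w * H w := by
  obtain ⟨M, hM⟩ := h.exists_norm_mul_decay hε ha N hC
  exact .of_bound (fun γ hγ => (continuous_expKernel_ray ε b (hγ.trans_lt h.lt_pi)).mul (hc γ hγ))
    h.pos.le one_pos fun γ hγ x => hM γ hγ.le x _ (hH γ hγ x)

/-- Inside the sector the kernel beats every power of `|w|`, so Cauchy's theorem applies to any
holomorphic function of polynomial growth. -/
theorem sectorIntegral_eq_zero {ε : ℝ} (hε : 0 < ε) {a : ℝ} (ha : 0 ≤ a) {N : ℕ} {C : ℝ}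
    (hC : 0 ≤ C) {H : ℂ → ℂ} (hd : ∀ γ, |γ| ≤ β → ∀ x, DifferentiableAt ℂ H (ray γ x))
    (hH : ∀ γ, |γ| ≤ β → ∀ x, ‖H (ray γ x)‖ ≤ C * (a + Real.exp x) ^ N) :
    sectorIntegral β (fun w => expKernel ε b w * H w) = 0 := by
  obtain ⟨M, hM⟩ := h.exists_norm_mul_decay hε ha N hC
  refine sectorIntegral_eq_zero_of_inside h.pos.le (fun x γ hγ => ?_) one_pos fun x γ hγ =>
    hM γ (abs_le.2 hγ) x _ (hH γ (abs_le.2 hγ) x)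
  exact (differentiableAt_expKernel ε b ((abs_le.2 hγ).trans_lt h.lt_pi) x).mul
    (hd γ (abs_le.2 hγ) x)

/-- Dominated convergence: on the boundary rays the kernel is bounded by `1` and tends to `1`. -/
theorem tendsto_sectorIntegral {H : ℂ → ℂ} {M δ : ℝ} (hδ : 0 < δ)
    (hc : ∀ γ, |γ| = β → Continuous fun x => H (ray γ x))
    (hb : ∀ γ, |γ| = β → ∀ x, ‖H (ray γ x)‖ * Real.exp x ≤ M * Real.exp (-δ * |x|)) :
    Tendsto (fun ε => sectorIntegral β fun w => expKernel ε b w * H w) (𝓝[>] 0)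
      (𝓝 (sectorIntegral β H)) := by
  have hβ : |β| = β := abs_of_nonneg h.pos.le
  have hβ' : |-β| = β := by rw [abs_neg, hβ]
  have hbd : ∀ γ, |γ| = β → ∀ ε : ℝ, 0 < ε → ∀ x,
      ‖expKernel ε b (ray γ x) * H (ray γ x) * ray γ x‖ ≤ M * Real.exp (-δ * |x|) := by
    intro γ hγ ε hε x
    refine le_trans ?_ (hb γ hγ x)
    rw [norm_mul, norm_mul, norm_ray]
    gcongr
    exact mul_le_of_le_one_left (norm_nonneg _)
      (norm_expKernel_le_one hε.le h.b_pos.le h.pos.le h.lt_pi h.mul_lt hγ.le x)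
  have hcont : ∀ γ, |γ| = β → ∀ ε, Continuous fun x =>
      expKernel ε b (ray γ x) * H (ray γ x) * ray γ x := fun γ hγ ε =>
    ((continuous_expKernel_ray ε b (hγ.trans_lt h.lt_pi)).mul (hc γ hγ)).mul (continuous_ray γ)
  refine tendsto_integral_filter_of_dominated_convergence
    (fun x => M * Real.exp (-δ * |x|) + M * Real.exp (-δ * |x|)) ?_ ?_ ?_ ?_
  · exact .of_forall fun ε => ((hcont β hβ ε).sub (hcont (-β) hβ' ε)).aestronglyMeasurable
  · filter_upwards [self_mem_nhdsWithin] with ε hε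
    exact .of_forall fun x => (norm_sub_le _ _).trans
      (add_le_add (hbd β hβ ε hε x) (hbd (-β) hβ' ε hε x))
  · exact ((integrable_exp_neg_mul_abs hδ).const_mul M).add
      ((integrable_exp_neg_mul_abs hδ).const_mul M)
  · refine .of_forall fun x => ?_
    have hlim : ∀ w : ℂ, Tendsto (fun ε => expKernel ε b w) (𝓝[>] 0) (𝓝 1) := fun w => by
      have : Continuous fun ε : ℝ => expKernel ε b w := by unfold expKernel; fun_prop
      exact (this.tendsto' 0 1 (by simp [expKernel])).mono_left nhdsWithin_le_nhds
    have h1 := (((hlim (ray β x)).mul_const (H (ray β x))).mul_const (ray β x)).sub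
      (((hlim (ray (-β) x)).mul_const (H (ray (-β) x))).mul_const (ray (-β) x))
    simpa using h1

variable {a : ℝ} (φ : ℝ) (ha : 0 < a)

include ha

theorem sub_ray_ne_zero {γ : ℝ} (hγ : Real.cos γ ≤ |Real.cos β|) (x : ℝ) :
    (a : ℂ) - ray γ x ≠ 0 := by
  rw [← norm_pos_iff]
  exact lt_of_lt_of_le (mul_pos (sectorConst_pos h.pos h.lt_pi) (by positivity))
    (sectorConst_mul_le_norm ha.le hγ x)

theorem contourPt_ne_zero {γ : ℝ} (hγ : Real.cos γ ≤ |Real.cos β|) (x : ℝ) :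
    contourPt φ a (ray γ x) ≠ 0 :=
  mul_ne_zero (exp_ne_zero _) (h.sub_ray_ne_zero ha hγ x)

omit h ha in
theorem cos_le_abs_of_abs_eq {γ : ℝ} (hγ : |γ| = β) : Real.cos γ ≤ |Real.cos β| := by
  rw [← Real.cos_abs, hγ]
  exact le_abs_self _

theorem sectorIntegral_pow_eq_zero {ε : ℝ} (hε : 0 < ε) (m : ℕ) :
    sectorIntegral β (fun w => expKernel ε b w * contourPt φ a w ^ m) = 0 := by
  refine h.sectorIntegral_eq_zero hε ha.le (N := m) zero_le_one
    (fun γ _ x => ((differentiable_contourPt φ a).pow m).differentiableAt) fun γ _ x => ?_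
  rw [one_mul, norm_pow, norm_contourPt]
  gcongr
  exact norm_sub_ray_le ha.le γ x

/-- Integrals of holomorphic functions outside the sector with decay faster than `1/|w|` vanish in
the limit `ε → 0`. -/
theorem tendsto_sectorIntegral_zero {H : ℂ → ℂ} {C κ : ℝ} (hκ : κ < -1) (hC : 0 ≤ C)
    (hd : ∀ γ ∈ Icc β (2 * Real.pi - β), ∀ x, DifferentiableAt ℂ H (ray γ x))
    (hb : ∀ γ ∈ Icc β (2 * Real.pi - β), ∀ x,
      ‖H (ray γ x)‖ ≤ C * ‖contourPt φ a (ray γ x)‖ ^ κ) :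
    Tendsto (fun ε => sectorIntegral β fun w => expKernel ε b w * H w) (𝓝[>] 0) (𝓝 0) := by
  obtain ⟨M, δ, hδ, hM⟩ := exists_norm_contourPt_rpow_decay φ ha h.pos h.lt_pi hκ
  have hb' : ∀ γ ∈ Icc β (2 * Real.pi - β), ∀ x, ‖H (ray γ x)‖ * Real.exp x ≤
      (C * M) * Real.exp (-δ * |x|) := fun γ hγ x => by
    have h1 := hM x γ ((cos_le_of_mem_Icc h.pos.le hγ).trans (le_abs_self _))
    calc _ ≤ C * ‖contourPt φ a (ray γ x)‖ ^ κ * Real.exp x := by gcongr; exact hb γ hγ x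
      _ = C * (‖contourPt φ a (ray γ x)‖ ^ κ * Real.exp x) := by ring
      _ ≤ C * (M * Real.exp (-δ * |x|)) := mul_le_mul_of_nonneg_left h1 hC
      _ = _ := by ring
  have hle : β ≤ 2 * Real.pi - β := by linarith [h.lt_pi]
  have hc : ∀ γ ∈ Icc β (2 * Real.pi - β), Continuous fun x => H (ray γ x) := fun γ hγ =>
    continuous_iff_continuousAt.2 fun x =>
      (hd γ hγ x).continuousAt.comp (continuous_ray γ).continuousAt
  have hray : ∀ γ, |γ| = β → ∃ γ' ∈ Icc β (2 * Real.pi - β), ray γ = ray γ' := by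
    intro γ hγ
    rcases (abs_eq h.pos.le).1 hγ with rfl | rfl
    · exact ⟨_, left_mem_Icc.2 hle, rfl⟩
    · exact ⟨_, right_mem_Icc.2 hle, funext fun x => (ray_two_pi_sub β x).symm⟩
  -- Decay of the kernel is available only inside the sector, so Cauchy's theorem outside is applied
  -- to `H` itself, that is, to the limit.
  have h0 := sectorIntegral_eq_zero_of_outside h.lt_pi.le (fun x γ hγ => hd γ hγ x) hδ
    fun x γ hγ => hb' γ hγ x
  rw [← h0]
  refine h.tendsto_sectorIntegral hδ (fun γ hγ => ?_) (M := C * M) fun γ hγ x => ?_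
  · obtain ⟨γ', hγ', hr⟩ := hray γ hγ
    rw [hr]
    exact hc γ' hγ'
  · obtain ⟨γ', hγ', hr⟩ := hray γ hγ
    rw [hr]
    exact hb' γ' hγ' x

theorem tendsto_sectorIntegral_zpow_zero {m : ℤ} (hm : m ≤ -2) :
    Tendsto (fun ε => sectorIntegral β fun w => expKernel ε b w * contourPt φ a w ^ m) (𝓝[>] 0)
      (𝓝 0) := by
  refine h.tendsto_sectorIntegral_zero φ ha (κ := m) (by exact_mod_cast (by omega : m < -1))
    zero_le_one (fun γ hγ x => ?_) fun γ hγ x => ?_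
  · exact (differentiable_contourPt φ a).differentiableAt.zpow (.inl (h.contourPt_ne_zero φ ha
      ((cos_le_of_mem_Icc h.pos.le hγ).trans (le_abs_self _)) x))
  · rw [one_mul, norm_zpow, Real.rpow_intCast]

/-- The limit of the normalising integrals. -/
theorem exists_tendsto_sectorIntegral_inv : ∃ κ : ℂ, κ ≠ 0 ∧
    Tendsto (fun ε => sectorIntegral β fun w => expKernel ε b w * (contourPt φ a w)⁻¹) (𝓝[>] 0)
      (𝓝 κ) := by
  have hc := sectorConst_pos h.pos h.lt_pi
  -- `(a - w)⁻¹` is not absolutely integrable on the rays. Adding `(a + w)⁻¹`, whose integral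
  -- against the kernel vanishes as its pole `-a` lies outside the sector, gives `G`, which decays
  -- like `|w|⁻²`.
  let G : ℂ → ℂ := fun w => 2 * a / ((a - w) * (a + w))
  have hadd : ∀ γ x, (a : ℂ) + ray γ x = a - ray (γ + Real.pi) x := fun γ x => by
    have : ray (γ + Real.pi) x = -ray γ x := by
      rw [ray, ray, ← exp_antiperiodic]; congr 1; push_cast; ring
    rw [this, sub_neg_eq_add]
  have hcosadd : ∀ γ, |γ| ≤ β → Real.cos (γ + Real.pi) ≤ |Real.cos β| := fun γ hγ => by
    rw [Real.cos_add_pi, ← Real.cos_abs]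
    have := Real.cos_le_cos_of_nonneg_of_le_pi (abs_nonneg γ) h.lt_pi.le hγ
    exact (neg_le_neg this).trans (neg_le_abs _)
  have hne1 : ∀ γ, |γ| = β → ∀ x, (a : ℂ) - ray γ x ≠ 0 := fun γ hγ x =>
    h.sub_ray_ne_zero ha (cos_le_abs_of_abs_eq hγ) x
  have hne2 : ∀ γ, |γ| ≤ β → ∀ x, (a : ℂ) + ray γ x ≠ 0 := fun γ hγ x => by
    rw [hadd]
    exact h.sub_ray_ne_zero ha (hcosadd γ hγ) x
  have hlow1 : ∀ γ, |γ| = β → ∀ x, sectorConst β * (a + Real.exp x) ≤ ‖(a : ℂ) - ray γ x‖ :=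
    fun γ hγ x => sectorConst_mul_le_norm ha.le (cos_le_abs_of_abs_eq hγ) x
  have hlow2 : ∀ γ, |γ| ≤ β → ∀ x, sectorConst β * (a + Real.exp x) ≤ ‖(a : ℂ) + ray γ x‖ :=
    fun γ hγ x => by
      rw [hadd]
      exact sectorConst_mul_le_norm ha.le (hcosadd γ hγ) x
  have hGc : ∀ γ, |γ| = β → Continuous fun x => G (ray γ x) := fun γ hγ =>
    continuous_const.div ((continuous_const.sub (continuous_ray γ)).mul
      (continuous_const.add (continuous_ray γ)))
      fun x => mul_ne_zero (hne1 γ hγ x) (hne2 γ hγ.le x)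
  obtain ⟨M, δ, hδ, hM⟩ := exists_rpow_decay ha (κ := -2) (by norm_num)
  have hGb : ∀ γ, |γ| = β → ∀ x, ‖G (ray γ x)‖ * Real.exp x ≤
      (2 * a / sectorConst β ^ 2 * M) * Real.exp (-δ * |x|) := fun γ hγ x => by
    have hpos : 0 < a + Real.exp x := by positivity
    have h1 := hM x
    have h2 : (a + Real.exp x) ^ (-2 : ℝ) = ((a + Real.exp x) ^ 2)⁻¹ := by
      rw [Real.rpow_neg hpos.le]; norm_cast
    rw [h2] at h1
    have h3 : ‖G (ray γ x)‖ ≤ 2 * a / ((sectorConst β * (a + Real.exp x)) *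
        (sectorConst β * (a + Real.exp x))) := by
      simp only [G]
      rw [norm_div, norm_mul, norm_mul, norm_real, Real.norm_of_nonneg ha.le, RCLike.norm_two]
      gcongr
      · exact hlow1 γ hγ x
      · exact hlow2 γ hγ.le x
    calc ‖G (ray γ x)‖ * Real.exp x ≤ 2 * a / ((sectorConst β * (a + Real.exp x)) *
        (sectorConst β * (a + Real.exp x))) * Real.exp x := by gcongr
      _ = 2 * a / sectorConst β ^ 2 * (((a + Real.exp x) ^ 2)⁻¹ * Real.exp x) := by
        field_simp
      _ ≤ 2 * a / sectorConst β ^ 2 * (M * Real.exp (-δ * |x|)) :=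
        mul_le_mul_of_nonneg_left h1 (by positivity)
      _ = _ := by ring
  have hlim := (h.tendsto_sectorIntegral hδ hGc hGb).const_mul (exp (-(I * φ)))
  refine ⟨_, mul_ne_zero (exp_ne_zero _) ?_, hlim.congr' ?_⟩
  · have hint : Integrable fun x => G (ray β x) * ray β x - G (ray (-β) x) * ray (-β) x :=
      SectorIntegrable.of_bound hGc h.pos.le hδ hGb
    have hnsq : ∀ x, 0 < normSq (((a : ℂ) - ray β x) * (a + ray β x)) := fun x =>
      normSq_pos.2 (mul_ne_zero (hne1 β (abs_of_pos h.pos) x) (hne2 β (abs_of_pos h.pos).le x))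
    -- The contributions of the two rays are complex conjugate, so their difference is purely
    -- imaginary. Its positive imaginary part shows that the limit is nonzero without evaluating it.
    have him : ∀ x, (G (ray β x) * ray β x - G (ray (-β) x) * ray (-β) x).im =
        4 * a * (Real.exp x * Real.sin β * (a ^ 2 + Real.exp x ^ 2)) /
          normSq (((a : ℂ) - ray β x) * (a + ray β x)) := fun x => by
      have hconj : ray (-β) x = (starRingEnd ℂ) (ray β x) := by
        rw [ray, ray, ← exp_conj]; simp
      have hG : G (ray (-β) x) * ray (-β) x = (starRingEnd ℂ) (G (ray β x) * ray β x) := by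
        simp only [G, hconj, map_mul, map_div₀, map_sub, map_add, conj_ofReal, map_ofNat]
      rw [hG, sub_im, conj_im]
      have hGr : G (ray β x) * ray β x = 2 * a * ray β x *
          (starRingEnd ℂ) (((a : ℂ) - ray β x) * (a + ray β x)) /
          (normSq (((a : ℂ) - ray β x) * (a + ray β x)) : ℝ) := by
        rw [← mul_conj, mul_div_mul_right _ _ (by
          rw [map_ne_zero]
          exact normSq_pos.1 (hnsq x))]
        simp only [G]
        ring
      rw [hGr, div_ofReal_im]
      have h1 := Real.sin_sq_add_cos_sq β
      simp only [map_mul, map_sub, map_add, conj_ofReal, mul_im, mul_re, sub_re, sub_im, add_re,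
        add_im, conj_re, conj_im, ofReal_re, ofReal_im, ray_re, ray_im, re_ofNat, im_ofNat]
      rw [sub_neg_eq_add, ← add_div]
      congr 1
      linear_combination 4 * a * Real.exp x ^ 3 * Real.sin β * h1
    have hpos : 0 < ∫ x, (G (ray β x) * ray β x - G (ray (-β) x) * ray (-β) x).im := by
      have hpt : ∀ x, 0 < (G (ray β x) * ray β x - G (ray (-β) x) * ray (-β) x).im := fun x => by
        rw [him]
        have := Real.sin_pos_of_pos_of_lt_pi h.pos h.lt_pi
        have := hnsq x
        positivity
      rw [integral_pos_iff_support_of_nonneg (fun x => (hpt x).le) hint.im]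
      have : Function.support (fun x =>
          (G (ray β x) * ray β x - G (ray (-β) x) * ray (-β) x).im) = univ :=
        eq_univ_of_forall fun x => (hpt x).ne'
      rw [this]
      simp
    intro h0
    have h1 := imCLM.integral_comp_comm hint
    simp only [imCLM_apply] at h1
    rw [h1] at hpos
    rw [sectorIntegral] at h0
    rw [h0] at hpos
    simp at hpos
  · filter_upwards [self_mem_nhdsWithin] with ε hε
    have hε : 0 < ε := hε
    have hKb : ∀ γ, |γ| ≤ β → ∀ x, ‖((a : ℂ) + ray γ x)⁻¹‖ ≤
        (sectorConst β * a)⁻¹ * (a + Real.exp x) ^ 0 := fun γ hγ x => by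
      rw [pow_zero, mul_one, norm_inv]
      gcongr
      refine le_trans ?_ (hlow2 γ hγ x)
      gcongr
      linarith [Real.exp_pos x]
    have hK0 : sectorIntegral β (fun w => expKernel ε b w * (a + w)⁻¹) = 0 :=
      h.sectorIntegral_eq_zero hε ha.le (by positivity) (fun γ hγ x =>
        ((differentiableAt_const _).add differentiableAt_id).inv (hne2 γ hγ x)) hKb
    have hKi : SectorIntegrable β (fun w => expKernel ε b w * (a + w)⁻¹) :=
      h.sectorIntegrable hε ha.le (by positivity) (fun γ hγ =>
        (continuous_const.add (continuous_ray γ)).inv₀ (hne2 γ hγ.le)) fun γ hγ => hKb γ hγ.le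
    have hGi : SectorIntegrable β (fun w => expKernel ε b w * G w) := by
      refine .of_bound (fun γ hγ => (continuous_expKernel_ray ε b (hγ.trans_lt h.lt_pi)).mul
        (hGc γ hγ)) h.pos.le hδ fun γ hγ x => le_trans ?_ (hGb γ hγ x)
      rw [norm_mul]
      gcongr
      exact mul_le_of_le_one_left (norm_nonneg _)
        (norm_expKernel_le_one hε.le h.b_pos.le h.pos.le h.lt_pi h.mul_lt hγ.le x)
    rw [← sub_zero (sectorIntegral β fun w => expKernel ε b w * G w), ← hK0,
      ← sectorIntegral_sub hGi hKi, ← sectorIntegral_const_mul]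
    refine sectorIntegral_congr h.pos.le fun γ hγ x => ?_
    have h1 := hne1 γ hγ x
    have h2 := hne2 γ hγ.le x
    rw [contourPt, mul_inv, ← exp_neg]
    simp only [G]
    field_simp
    ring

end KernelAngle

end KernelIntegrals

/-! ### Vector-valued moments -/

section Moments

variable {V : Type*} [AddCommGroup V] [Module ℂ V] [UniformSpace V] [IsUniformAddGroup V]
  [ContinuousSMul ℂ V] [LocallyConvexSpace ℝ V] {b β : ℝ}

theorem exists_sectorIntegral (hV : SeqComplete V) (hβ : 0 ≤ β) {Q : ℂ → V}
    (hQ : ∀ γ, |γ| = β → Continuous fun x => Q (ray γ x))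
    (hb : ∀ p : Seminorm ℂ V, Continuous p → ∃ H : ℝ → ℝ, Integrable H ∧
      ∀ γ, |γ| = β → ∀ x, Real.exp x * p (Q (ray γ x)) ≤ H x) :
    ∃ y : V, ∀ ℓ : V →L[ℂ] ℂ, ℓ y = sectorIntegral β fun w => ℓ (Q w) := by
  have h1 : |β| = β := abs_of_nonneg hβ
  have h2 : |-β| = β := by rw [abs_neg, h1]
  obtain ⟨y, hy⟩ := exists_weakIntegral hV
    (g := fun x => ray β x • Q (ray β x) - ray (-β) x • Q (ray (-β) x))
    (((continuous_ray β).smul (hQ β h1)).sub ((continuous_ray (-β)).smul (hQ (-β) h2)))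
    fun p hp => by
      obtain ⟨H, hH, hbH⟩ := hb p hp
      refine ⟨fun x => H x + H x, hH.add hH, fun x => (map_sub_le_add p _ _).trans ?_⟩
      rw [map_smul_eq_mul, map_smul_eq_mul, norm_ray, norm_ray]
      exact add_le_add (hbH β h1 x) (hbH (-β) h2 x)
  refine ⟨y, fun ℓ => ?_⟩
  rw [hy, sectorIntegral]
  congr 1
  funext x
  simp [mul_comm]

theorem norm_sectorIntegral_le {B : ℝ} {H : ℂ → ℂ} (hβ : 0 ≤ β)
    (hb : ∀ γ, |γ| = β → ∀ x, Real.exp x * ‖H (ray γ x)‖ ≤ B * Real.exp (-1 * |x|)) :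
    ‖sectorIntegral β H‖ ≤ 2 * B * ∫ x : ℝ, Real.exp (-1 * |x|) := by
  have h1 : |β| = β := abs_of_nonneg hβ
  have h2 : |-β| = β := by rw [abs_neg, h1]
  rw [← integral_const_mul]
  refine norm_integral_le_of_norm_le ((integrable_exp_neg_mul_abs one_pos).const_mul _)
    (.of_forall fun x => (norm_sub_le _ _).trans ?_)
  rw [norm_mul, norm_mul, norm_ray, norm_ray, mul_comm _ (Real.exp x), mul_comm _ (Real.exp x)]
  linarith [hb β h1 x, hb (-β) h2 x]

/-- The moments `∫ exp(-ε w^b) λ(w)^k Q(w) dw` of a polynomially bounded function. -/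
theorem KernelAngle.exists_moments (h : KernelAngle b β) (hV : SeqComplete V) {ζ : ℝ} (hζ : 0 < ζ)
    (hb : 1 / ζ < b) (φ : ℝ) {a : ℝ} (ha : 0 < a) {ε : ℝ} (hε : 0 < ε) {Q : ℂ → V}
    (hQ : ∀ γ, |γ| = β → Continuous fun x => Q (ray γ x))
    (hQb : ∀ p : Seminorm ℂ V, Continuous p → ∃ (C : ℝ) (N : ℕ), 0 ≤ C ∧
      ∀ γ, |γ| = β → ∀ x, p (Q (ray γ x)) ≤ C * (a + Real.exp x) ^ N) :
    ∃ y : ℕ → V, HasMLGrowth ζ y ∧ ∀ k (ℓ : V →L[ℂ] ℂ), ℓ (y k) =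
      sectorIntegral β fun w => expKernel ε b w * (contourPt φ a w ^ k * ℓ (Q w)) := by
  have key : ∀ p : Seminorm ℂ V, Continuous p → ∀ ρ : ℝ, 0 < ρ → ∃ B, ∀ (k : ℕ) (γ : ℝ),
      |γ| = β → ∀ x, Real.exp x * p ((expKernel ε b (ray γ x) * contourPt φ a (ray γ x) ^ k) •
        Q (ray γ x)) * ρ ^ k ≤ B * Real.Gamma (ζ * k + 1) * Real.exp (-1 * |x|) := by
    intro p hp ρ hρ
    obtain ⟨C, N, hC, hQC⟩ := hQb p hp
    obtain ⟨M, hM⟩ := h.exists_decay hρ.le (by positivity : 0 < 1 / ζ) hb hε ha.le N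
    refine ⟨C * Real.exp 1 * M, fun k γ hγ x => ?_⟩
    have hs : 0 < a + Real.exp x := by positivity
    have hΓ : 0 < Real.Gamma (ζ * k + 1) := Real.Gamma_pos_of_pos (by positivity)
    -- This is `rpow_le_exp_mul_Gamma` with `τ = (ρ(a + e^x))^{1/ζ}` and exponent `ζ k`. The factor
    -- `e^τ` is then absorbed by the kernel because `1/ζ < b`.
    have h1 : (ρ * (a + Real.exp x)) ^ k ≤
        Real.exp ((ρ * (a + Real.exp x)) ^ (1 / ζ) + 1) * Real.Gamma (ζ * k + 1) := by
      have := rpow_le_exp_mul_Gamma (τ := (ρ * (a + Real.exp x)) ^ (1 / ζ)) (s := ζ * k)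
        (by positivity) (by positivity)
      rwa [← Real.rpow_mul (by positivity), ← mul_assoc, one_div_mul_cancel hζ.ne', one_mul,
        Real.rpow_natCast] at this
    have h2 := hM γ hγ.le x
    rw [map_smul_eq_mul, norm_mul, norm_pow, norm_contourPt]
    calc Real.exp x * (‖expKernel ε b (ray γ x)‖ * ‖(a : ℂ) - ray γ x‖ ^ k * p (Q (ray γ x))) *
          ρ ^ k
        ≤ Real.exp x * (‖expKernel ε b (ray γ x)‖ * (a + Real.exp x) ^ k *
          (C * (a + Real.exp x) ^ N)) * ρ ^ k := by
          gcongr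
          · exact norm_sub_ray_le ha.le γ x
          · exact hQC γ hγ x
      _ = C * (ρ * (a + Real.exp x)) ^ k * (a + Real.exp x) ^ N * ‖expKernel ε b (ray γ x)‖ *
          Real.exp x := by rw [mul_pow]; ring
      _ ≤ C * (Real.exp ((ρ * (a + Real.exp x)) ^ (1 / ζ) + 1) * Real.Gamma (ζ * k + 1)) *
          (a + Real.exp x) ^ N * ‖expKernel ε b (ray γ x)‖ * Real.exp x := by gcongr
      _ = C * Real.exp 1 * Real.Gamma (ζ * k + 1) * (Real.exp ((ρ * (a + Real.exp x)) ^ (1 / ζ)) *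
          (a + Real.exp x) ^ N * ‖expKernel ε b (ray γ x)‖ * Real.exp x) := by
          rw [Real.exp_add]; ring
      _ ≤ C * Real.exp 1 * Real.Gamma (ζ * k + 1) * (M * Real.exp (-1 * |x|)) :=
          mul_le_mul_of_nonneg_left h2 (by positivity)
      _ = _ := by ring
  choose y hy using fun k : ℕ => exists_sectorIntegral hV h.pos.le
    (Q := fun w => (expKernel ε b w * contourPt φ a w ^ k) • Q w)
    (fun γ hγ => ((continuous_expKernel_ray ε b (hγ.trans_lt h.lt_pi)).mul
      (((differentiable_contourPt φ a).continuous.comp (continuous_ray γ)).pow k)).smul (hQ γ hγ))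
    fun p hp => by
      obtain ⟨B, hB⟩ := key p hp 1 one_pos
      exact ⟨_, (integrable_exp_neg_mul_abs one_pos).const_mul (B * Real.Gamma (ζ * k + 1)),
        fun γ hγ x => by simpa using hB k γ hγ x⟩
  refine ⟨y, fun p hp ρ hρ => ?_, fun k ℓ => ?_⟩
  · obtain ⟨B, hB⟩ := key p hp ρ hρ
    refine ⟨2 * B * ∫ x : ℝ, Real.exp (-1 * |x|), fun k => ?_⟩
    rw [← le_div_iff₀ (by positivity)]
    refine seminorm_le_of_forall_functional hp fun ℓ hℓ => ?_
    rw [hy]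
    refine (norm_sectorIntegral_le (B := B * Real.Gamma (ζ * k + 1) / ρ ^ k) h.pos.le
      fun γ hγ x => ?_).trans (le_of_eq (by ring))
    rw [div_mul_eq_mul_div, le_div_iff₀ (by positivity)]
    refine le_trans ?_ (hB k γ hγ x)
    gcongr
    exact hℓ _
  · rw [hy]
    simp only [map_smul, smul_eq_mul, mul_assoc]

end Moments

/-! ### The regularized resolvent of the pencil -/

section Resolvent

variable {X : Type*} [AddCommGroup X] [Module ℂ X] [UniformSpace X]

/-- `R μ = (∑ μ^{q i} A_i)⁻¹ C` and `B i μ = A_i R μ` on `Λ`, with growth bounds. -/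
structure IsPencilResolvent {n : ℕ} (q : Fin (n + 1) → ℕ) (A : Fin (n + 1) → X →ₗ.[ℂ] X)
    (C : X →L[ℂ] X) (ν : ℝ) (Λ : Set ℂ) (R : ℂ → X →L[ℂ] X)
    (B : Fin (n + 1) → ℂ → X → X) : Prop where
  graph : ∀ i, ∀ μ ∈ Λ, ∀ x, (R μ x, B i μ x) ∈ (A i).graph
  sum_eq : ∀ μ ∈ Λ, ∀ x, ∑ i, μ ^ q i • B i μ x = C x
  apply_sum : ∀ μ ∈ Λ, ∀ (d : X) (c : Fin (n + 1) → X), (∀ i, (d, c i) ∈ (A i).graph) →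
    R μ (∑ i, μ ^ q i • c i) = C d
  continuousOn : ∀ x, ContinuousOn (fun μ => R μ x) Λ
  bound : ∀ (x : X) (p : Seminorm ℂ X), Continuous p → ∃ M, 0 ≤ M ∧
    ∀ μ ∈ Λ, p (R μ x) ≤ M * (1 + ‖μ‖) ^ ν
  continuousOn_comp : ∀ i x, ContinuousOn (fun μ => B i μ x) Λ
  bound_comp : ∀ i (x : X) (p : Seminorm ℂ X), Continuous p → ∃ (M : ℝ) (N : ℕ), 0 ≤ M ∧
    ∀ μ ∈ Λ, p (B i μ x) ≤ M * (1 + ‖μ‖) ^ N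

/-- At a zero of `f` the slope of the product is the slope of `f` times the value of `g`, so
continuity of `g` suffices. -/
theorem hasDerivAt_mul_of_continuousAt {f g : ℂ → ℂ} {f' μ : ℂ} (hf : HasDerivAt f f' μ)
    (h0 : f μ = 0) (hg : ContinuousAt g μ) :
    HasDerivAt (fun z => f z * g z) (f' * g μ) μ := by
  rw [hasDerivAt_iff_tendsto_slope] at hf ⊢
  refine (hf.mul (hg.tendsto.mono_left nhdsWithin_le_nhds)).congr fun z => ?_
  simp only [slope_def_field, h0]
  ring

namespace IsPencilResolvent

variable {n : ℕ} {q : Fin (n + 1) → ℕ} {A : Fin (n + 1) → X →ₗ.[ℂ] X} {C : X →L[ℂ] X} {ν : ℝ}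
  {Λ : Set ℂ} {R : ℂ → X →L[ℂ] X} {B : Fin (n + 1) → ℂ → X → X}
  (h : IsPencilResolvent q A C ν Λ R B)

include h

theorem comm {μ : ℂ} (hμ : μ ∈ Λ) (x : X) : C (R μ x) = R μ (C x) := by
  rw [← h.apply_sum μ hμ _ _ fun i => h.graph i μ hμ x, h.sum_eq μ hμ]

/-- Apply `apply_sum` at `z` to `d = R μ x` and split `z^{q i} = μ^{q i} + (z^{q i} - μ^{q i})`; the
first part sums to `C x`. -/
theorem resolvent_identity {μ z : ℂ} (hμ : μ ∈ Λ) (hz : z ∈ Λ) (x : X) :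
    R z (C x) = R μ (C x) - ∑ i, (z ^ q i - μ ^ q i) • R z (B i μ x) := by
  have h1 := h.apply_sum z hz _ _ fun i => h.graph i μ hμ x
  rw [← h.comm hμ, ← h1]
  nth_rewrite 1 [← h.sum_eq μ hμ x]
  simp only [map_sum, map_smul, sub_smul, Finset.sum_sub_distrib]
  abel

/-- By the resolvent identity the function is a constant minus products of a factor vanishing at `μ`
with a continuous function. The identity carries an extra `C`; holomorphy is therefore obtained for
`R z (C x)` and not for `R z x`. -/
theorem differentiableAt {μ : ℂ} (hμ : Λ ∈ 𝓝 μ) (ℓ : X →L[ℂ] ℂ) (x : X) :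
    DifferentiableAt ℂ (fun z => ℓ (R z (C x))) μ := by
  have hmem := mem_of_mem_nhds hμ
  have h1 : ∀ i, DifferentiableAt ℂ (fun z => (z ^ q i - μ ^ q i) * ℓ (R z (B i μ x))) μ :=
    fun i => (hasDerivAt_mul_of_continuousAt ((hasDerivAt_pow (q i) μ).sub_const _) (sub_self _)
      (ℓ.continuous.continuousAt.comp
        ((h.continuousOn (B i μ x)).continuousAt hμ))).differentiableAt
  have h2 : DifferentiableAt ℂ (fun z => ℓ (R μ (C x)) -
      ∑ i, (z ^ q i - μ ^ q i) * ℓ (R z (B i μ x))) μ :=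
    (differentiableAt_const _).sub (DifferentiableAt.fun_sum fun i _ => h1 i)
  refine h2.congr_of_eventuallyEq ?_
  filter_upwards [hμ] with z hz
  rw [h.resolvent_identity hmem hz]
  simp

end IsPencilResolvent

end Resolvent

/-! ### Constructing the resolvent data from the hypotheses -/

section Pencil

variable {X : Type*} [AddCommGroup X] [Module ℂ X] {n : ℕ} {q : Fin (n + 1) → ℕ}
  {A : Fin (n + 1) → X →ₗ.[ℂ] X}

theorem pencil_apply {μ : ℂ} (d : (pencil q A μ).domain) (h : ∀ i, (d : X) ∈ (A i).domain) :
    pencil q A μ d = ∑ i, μ ^ q i • A i ⟨d, h i⟩ :=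
  LinearMap.sum_apply Finset.univ (fun i => μ ^ q i • (A i).toFun ∘ₗ
    Submodule.inclusion (iInf_le (fun i => (A i).domain) i)) d

theorem mem_graph_pencil_iff {μ : ℂ} {y z : X} : (y, z) ∈ (pencil q A μ).graph ↔
    ∃ c : Fin (n + 1) → X, (∀ i, (y, c i) ∈ (A i).graph) ∧ ∑ i, μ ^ q i • c i = z := by
  constructor
  · intro h
    obtain ⟨d, hd, hz⟩ := LinearPMap.mem_graph_iff _ |>.1 h
    simp only at hd hz
    have hdom : ∀ i, (d : X) ∈ (A i).domain := (Submodule.mem_iInf _).1 d.2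
    subst hd
    exact ⟨fun i => A i ⟨d, hdom i⟩, fun i => LinearPMap.mem_graph (A i) ⟨d, hdom i⟩,
      (pencil_apply d hdom).symm.trans hz⟩
  · rintro ⟨c, hc, rfl⟩
    have hdom : ∀ i, y ∈ (A i).domain := fun i => LinearPMap.mem_domain_of_mem_graph (hc i)
    have hd : y ∈ (pencil q A μ).domain := (Submodule.mem_iInf _).2 hdom
    refine (LinearPMap.mem_graph_iff _).2 ⟨⟨y, hd⟩, rfl, (pencil_apply ⟨y, hd⟩ hdom).trans ?_⟩
    refine Finset.sum_congr rfl fun i _ => congrArg _ ?_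
    exact LinearPMap.mem_graph_snd_inj' (A i) (LinearPMap.mem_graph (A i) ⟨y, hdom i⟩) (hc i) rfl

variable [UniformSpace X] [IsUniformAddGroup X] [ContinuousSMul ℂ X]

theorem exists_isPencilResolvent (A : Fin (n + 1) → X →ₗ.[ℂ] X) {C : X →L[ℂ] X}
    (hCA : ∀ i, ∀ x y : X, (x, y) ∈ (A i).graph → (C x, C y) ∈ (A i).graph)
    {Λ : Set ℂ} {r ν : ℝ} (hr : 0 < r) (hΛ : ∀ μ ∈ Λ, r ≤ ‖μ‖) {R : ℂ → X →L[ℂ] X}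
    (hR : ∀ μ ∈ Λ, IsRegularizedInverse (pencil q A μ) C (R μ))
    (hRequi : Equicontinuous fun (μ : Λ) (x : X) => (1 + ‖(μ : ℂ)‖) ^ (-ν) • R μ x)
    (hRcont : ∀ x : X, ContinuousOn (fun μ : ℂ => (1 + ‖μ‖) ^ (-ν) • R μ x) Λ)
    {S : Fin (n + 1) → ℂ → X →L[ℂ] X}
    (hS : ∀ i, i ≠ Fin.last n → ∀ μ ∈ Λ, ∀ x : X, (R μ x, S i μ x) ∈ (A i).graph)
    (hScont : ∀ i, i ≠ Fin.last n → ∀ x : X, ContinuousOn (fun μ : ℂ => S i μ x) Λ)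
    (hSequi : ∀ i, i ≠ Fin.last n → ∃ v : ℕ, Equicontinuous
      fun (μ : Λ) (x : X) => (1 + ‖(μ : ℂ)‖) ^ (-(v : ℝ)) • S i μ x) :
    ∃ B : Fin (n + 1) → ℂ → X → X, IsPencilResolvent q A C ν Λ R B := by
  classical
  have hne : ∀ μ ∈ Λ, μ ≠ 0 := fun μ hμ => norm_pos_iff.1 (hr.trans_le (hΛ μ hμ))
  -- No bound on `A_n R μ` is assumed. It is recovered from `∑ μ^{q i} A_i R μ x = C x`, and `|μ| ≥
  -- r` controls the division by `μ^{q_n}`.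
  let B : Fin (n + 1) → ℂ → X → X := fun i μ x => if i = Fin.last n then
    (μ ^ q (Fin.last n))⁻¹ • (C x - ∑ j ∈ Finset.univ.erase (Fin.last n), μ ^ q j • S j μ x)
    else S i μ x
  have hB : ∀ i, i ≠ Fin.last n → ∀ μ x, B i μ x = S i μ x := fun i hi μ x => if_neg hi
  have hBl : ∀ μ x, B (Fin.last n) μ x = (μ ^ q (Fin.last n))⁻¹ •
    (C x - ∑ j ∈ Finset.univ.erase (Fin.last n), μ ^ q j • S j μ x) := fun μ x => if_pos rfl
  have key : ∀ μ ∈ Λ, ∀ x, (∀ i, (R μ x, B i μ x) ∈ (A i).graph) ∧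
      ∑ i, μ ^ q i • B i μ x = C x := by
    intro μ hμ x
    obtain ⟨c, hc, hsum⟩ := mem_graph_pencil_iff.1 ((hR μ hμ).2 x)
    have h1 : ∀ i, i ≠ Fin.last n → c i = S i μ x := fun i hi =>
      LinearPMap.mem_graph_snd_inj' (A i) (hc i) (hS i hi μ hμ x) rfl
    have h2 : ∀ i, B i μ x = c i := by
      intro i
      by_cases hi : i = Fin.last n
      · subst hi
        rw [hBl, ← hsum, ← Finset.add_sum_erase _ _ (Finset.mem_univ (Fin.last n)),
          Finset.sum_congr rfl fun j hj =>
            congrArg (μ ^ q j • ·) (h1 j (Finset.ne_of_mem_erase hj)),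
          add_sub_cancel_right, inv_smul_smul₀ (pow_ne_zero _ (hne μ hμ))]
      · rw [hB i hi, h1 i hi]
    simp only [h2]
    exact ⟨hc, hsum⟩
  have hpow : ∀ i, i ≠ Fin.last n → ∀ (x : X) (p : Seminorm ℂ X), Continuous p →
      ∃ (M : ℝ) (N : ℕ), 0 ≤ M ∧ ∀ μ ∈ Λ, p (S i μ x) ≤ M * (1 + ‖μ‖) ^ N := by
    intro i hi x p hp
    obtain ⟨v, hv⟩ := hSequi i hi
    obtain ⟨M, hM⟩ := exists_seminorm_le_of_equicontinuous hv hp x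
    refine ⟨max M 0, v, le_max_right _ _, fun μ hμ => ?_⟩
    have h1 := hM ⟨μ, hμ⟩
    have h2 : (0 : ℝ) < 1 + ‖μ‖ := by positivity
    rw [abs_of_pos (by positivity), Real.rpow_neg h2.le, Real.rpow_natCast,
      inv_mul_le_iff₀ (by positivity), mul_comm] at h1
    exact h1.trans (by gcongr; exact le_max_left _ _)
  refine ⟨B, fun i μ hμ x => (key μ hμ x).1 i, fun μ hμ x => (key μ hμ x).2, ?_, ?_, ?_, ?_, ?_⟩
  · intro μ hμ d c hc
    set z := ∑ i, μ ^ q i • c i with hz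
    -- Since `C` commutes with the `A_i`, both `C d` and `R μ z` are mapped to `C z` by the pencil,
    -- which is injective.
    have h1 : (C d, C z) ∈ (pencil q A μ).graph :=
      mem_graph_pencil_iff.2 ⟨fun i => C (c i), fun i => hCA i _ _ (hc i), by simp [hz]⟩
    have h2 := (pencil q A μ).graph.sub_mem ((hR μ hμ).2 z) h1
    obtain ⟨e, he, he'⟩ := (LinearPMap.mem_graph_iff _).1 h2
    have h3 := (hR μ hμ).1 e (by simpa using he')
    rw [h3] at he
    exact (sub_eq_zero.1 (by simpa using he.symm))
  · intro x
    have h1 : ContinuousOn (fun μ : ℂ => ((1 + ‖μ‖) ^ ν : ℝ)) Λ :=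
      (ContinuousOn.rpow_const (by fun_prop) fun μ _ => .inl (by positivity))
    refine (h1.smul (hRcont x)).congr fun μ _ => ?_
    have h2 : (0 : ℝ) < 1 + ‖μ‖ := by positivity
    simp only [Pi.smul_apply']
    rw [smul_smul, ← Real.rpow_add h2, add_neg_cancel, Real.rpow_zero, one_smul]
  · intro x p hp
    obtain ⟨M, hM⟩ := exists_seminorm_le_of_equicontinuous hRequi hp x
    refine ⟨max M 0, le_max_right _ _, fun μ hμ => ?_⟩
    have h1 := hM ⟨μ, hμ⟩
    have h2 : (0 : ℝ) < 1 + ‖μ‖ := by positivity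
    rw [abs_of_pos (by positivity), Real.rpow_neg h2.le,
      inv_mul_le_iff₀ (by positivity), mul_comm] at h1
    exact h1.trans (by gcongr; exact le_max_left _ _)
  · intro i x
    by_cases hi : i = Fin.last n
    · subst hi
      simp only [hBl]
      refine ContinuousOn.smul (ContinuousOn.inv₀ (by fun_prop) fun μ hμ =>
        pow_ne_zero _ (hne μ hμ)) (continuousOn_const.sub (continuousOn_finsetSum _ fun j hj =>
        ContinuousOn.smul (by fun_prop) (hScont j (Finset.ne_of_mem_erase hj) x)))
    · simpa only [hB i hi] using hScont i hi x
  · intro i x p hp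
    by_cases hi : i = Fin.last n
    · subst hi
      choose! M N hM hMN using fun i hi => hpow i hi x p hp
      let K := ∑ j ∈ Finset.univ.erase (Fin.last n), (q j + N j)
      refine ⟨(r ^ q (Fin.last n))⁻¹ * (p (C x) + ∑ j ∈ Finset.univ.erase (Fin.last n), M j), K,
        ?_, fun μ hμ => ?_⟩
      · have : 0 ≤ ∑ j ∈ Finset.univ.erase (Fin.last n), M j :=
          Finset.sum_nonneg fun j hj => hM j (Finset.ne_of_mem_erase hj)
        have := apply_nonneg p (C x)
        positivity
      have h1 : (1 : ℝ) ≤ 1 + ‖μ‖ := by linarith [norm_nonneg μ]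
      have hinv : ‖(μ ^ q (Fin.last n))⁻¹‖ ≤ (r ^ q (Fin.last n))⁻¹ := by
        rw [norm_inv, norm_pow]
        gcongr
        exact hΛ μ hμ
      have hterm : ∀ j ∈ Finset.univ.erase (Fin.last n),
          p (μ ^ q j • S j μ x) ≤ M j * (1 + ‖μ‖) ^ K := by
        intro j hj
        have hj' := Finset.ne_of_mem_erase hj
        rw [map_smul_eq_mul, norm_pow]
        have hMj := hM j hj'
        calc ‖μ‖ ^ q j * p (S j μ x) ≤ (1 + ‖μ‖) ^ q j * (M j * (1 + ‖μ‖) ^ N j) := by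
              gcongr
              · linarith
              · exact hMN j hj' μ hμ
          _ = M j * (1 + ‖μ‖) ^ (q j + N j) := by rw [pow_add]; ring
          _ ≤ _ := by
              gcongr
              exact Finset.single_le_sum (f := fun j => q j + N j) (fun _ _ => Nat.zero_le _) hj
      rw [hBl, map_smul_eq_mul, mul_assoc]
      refine mul_le_mul hinv ?_ (apply_nonneg _ _) (by positivity)
      refine (map_sub_le_add p _ _).trans ?_
      rw [add_mul, Finset.sum_mul]
      refine add_le_add (le_mul_of_one_le_right (apply_nonneg _ _) (one_le_pow₀ h1)) ?_
      exact (Finset.le_sum_of_subadditive p (map_zero p).le (map_add_le_add p) _ _).trans (Finset.sum_le_sum hterm)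
    · simpa only [hB i hi] using hpow i hi x p hp

end Pencil

/-! ### Polynomial growth along the contour -/

section Moderate

variable {V : Type*} [AddCommGroup V] [Module ℂ V] [UniformSpace V] {a b β : ℝ}

/-- Continuity and polynomial growth along the two boundary rays. -/
structure ModerateOnRays (a β : ℝ) (Q : ℂ → V) : Prop where
  continuous : ∀ γ, |γ| = β → Continuous fun x => Q (ray γ x)
  bound : ∀ p : Seminorm ℂ V, Continuous p → ∃ (C : ℝ) (N : ℕ), 0 ≤ C ∧
    ∀ γ, |γ| = β → ∀ x, p (Q (ray γ x)) ≤ C * (a + Real.exp x) ^ N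

theorem ModerateOnRays.sectorIntegrable {Q : ℂ → V} (hQ : ModerateOnRays a β Q)
    (h : KernelAngle b β) {ε : ℝ} (hε : 0 < ε) (ha : 0 ≤ a) (φ : ℝ) (k : ℕ) (ℓ : V →L[ℂ] ℂ) :
    SectorIntegrable β fun w => expKernel ε b w * (contourPt φ a w ^ k * ℓ (Q w)) := by
  obtain ⟨C, N, hC, hb⟩ := hQ.bound ((normSeminorm ℂ ℂ).comp (ℓ : V →ₗ[ℂ] ℂ))
    (continuous_norm.comp ℓ.continuous)
  refine h.sectorIntegrable hε ha (N := k + N) hC (fun γ hγ =>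
    (((differentiable_contourPt φ a).continuous.comp (continuous_ray γ)).pow k).mul
      (ℓ.continuous.comp (hQ.continuous γ hγ))) fun γ hγ x => ?_
  have h1 : ‖ℓ (Q (ray γ x))‖ ≤ C * (a + Real.exp x) ^ N := hb γ hγ x
  rw [norm_mul, norm_pow, norm_contourPt, pow_add, mul_left_comm]
  gcongr
  exact norm_sub_ray_le ha γ x

theorem moderateOnRays_comp_contourPt {Λ : Set ℂ} {f : ℂ → V} (hf : ContinuousOn f Λ)
    (hb : ∀ p : Seminorm ℂ V, Continuous p → ∃ (M : ℝ) (N : ℕ), 0 ≤ M ∧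
      ∀ μ ∈ Λ, p (f μ) ≤ M * (1 + ‖μ‖) ^ N) {φ : ℝ} (ha : 0 < a)
    (hΛ : ∀ γ, |γ| = β → ∀ x, contourPt φ a (ray γ x) ∈ Λ) :
    ModerateOnRays a β fun w => f (contourPt φ a w) := by
  refine ⟨fun γ hγ => hf.comp_continuous
    ((differentiable_contourPt φ a).continuous.comp (continuous_ray γ)) (hΛ γ hγ), fun p hp => ?_⟩
  obtain ⟨M, N, hM, hMN⟩ := hb p hp
  refine ⟨M * (1 / a + 1) ^ N, N, by positivity, fun γ hγ x => (hMN _ (hΛ γ hγ x)).trans ?_⟩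
  have h1 : 1 + ‖contourPt φ a (ray γ x)‖ ≤ (1 / a + 1) * (a + Real.exp x) := by
    have h2 := norm_sub_ray_le ha.le γ x
    have h3 : 1 ≤ 1 / a * (a + Real.exp x) := by
      rw [one_div_mul_eq_div, le_div_iff₀ ha]
      linarith [Real.exp_pos x]
    rw [norm_contourPt]
    linarith
  rw [mul_assoc, ← mul_pow]
  gcongr

end Moderate

/-! ### Solution sequences from moments of the resolvent -/

namespace IsPencilResolvent

variable {X : Type*} [AddCommGroup X] [Module ℂ X] [UniformSpace X]
  {n : ℕ} {q : Fin (n + 1) → ℕ} {A : Fin (n + 1) → X →ₗ.[ℂ] X} {C : X →L[ℂ] X} {ν : ℝ}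
  {Λ : Set ℂ} {R : ℂ → X →L[ℂ] X} {B : Fin (n + 1) → ℂ → X → X} {a b β φ ζ ε : ℝ}

section Moderate

variable (hP : IsPencilResolvent q A C ν Λ R B) (ha : 0 < a)
  (hΛ : ∀ γ, |γ| = β → ∀ x, contourPt φ a (ray γ x) ∈ Λ)

include hP ha hΛ

theorem moderateOnRays (z : X) : ModerateOnRays a β fun w => R (contourPt φ a w) z := by
  refine moderateOnRays_comp_contourPt (hP.continuousOn z) (fun p hp => ?_) ha hΛ
  obtain ⟨M, hM, hMν⟩ := hP.bound z p hp
  refine ⟨M, ⌈ν⌉₊, hM, fun μ hμ => (hMν μ hμ).trans ?_⟩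
  gcongr
  rw [← Real.rpow_natCast]
  exact Real.rpow_le_rpow_of_exponent_le (by linarith [norm_nonneg μ]) (Nat.le_ceil ν)

theorem moderateOnRays_comp (i : Fin (n + 1)) (z : X) :
    ModerateOnRays a β fun w => B i (contourPt φ a w) z :=
  moderateOnRays_comp_contourPt (hP.continuousOn_comp i z) (hP.bound_comp i z) ha hΛ

/-- The moments of `exp(-ε w^b) (∑ λ^{q i} A_i)⁻¹ C z` along the contour form a solution. -/
theorem exists_isSolutionSeq [IsUniformAddGroup X] [ContinuousSMul ℂ X] [LocallyConvexSpace ℝ X]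
    [T2Space X] (hX : SeqComplete X) (hA : ∀ i, (A i).IsClosed) (h : KernelAngle b β) (hζ : 0 < ζ)
    (hb : 1 / ζ < b) (hε : 0 < ε) (z : X) :
    ∃ (y : ℕ → X) (c : Fin (n + 1) → ℕ → X), IsSolutionSeq ζ q A y c ∧ ∀ k (ℓ : X →L[ℂ] ℂ),
      ℓ (y k) = sectorIntegral β fun w =>
        expKernel ε b w * (contourPt φ a w ^ k * ℓ (R (contourPt φ a w) z)) := by
  have hR := hP.moderateOnRays ha hΛ z
  have hB := fun i => hP.moderateOnRays_comp ha hΛ i z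
  obtain ⟨y, hyg, hy⟩ := h.exists_moments hX hζ hb φ ha hε
    (Q := fun w => R (contourPt φ a w) z) hR.continuous hR.bound
  choose c hcg hc using fun i =>
    h.exists_moments hX hζ hb φ ha hε
      (Q := fun w => B i (contourPt φ a w) z) (hB i).continuous (hB i).bound
  refine ⟨y, c, ⟨hyg, hcg, fun i k => ?_, fun k => ?_⟩, hy⟩
  · refine mem_graph_of_forall_functional (hA i) fun ℓ ℓ' hℓ => ?_
    rw [hy, hc, ← sectorIntegral_add (hR.sectorIntegrable h hε ha.le φ k ℓ)
      ((hB i).sectorIntegrable h hε ha.le φ k ℓ')]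
    rw [sectorIntegral_congr (K := fun w => 0 * expKernel ε b w) h.pos.le fun γ hγ x => ?_,
      sectorIntegral_const_mul, zero_mul]
    rw [← mul_add, ← mul_add, hℓ _ _ (hP.graph i _ (hΛ γ hγ x) z), mul_zero, mul_zero, zero_mul]
  -- The shift by `q i` inserts the factor `λ^{q i}`, so the sum over `i` collapses to `C z` times
  -- the integral of the kernel against a polynomial in `w`, which is zero.
  · refine eq_zero_of_forall_functional fun ℓ => ?_
    rw [map_sum]
    simp only [hc]
    rw [← sectorIntegral_sum _ fun i _ => (hB i).sectorIntegrable h hε ha.le φ _ ℓ,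
      sectorIntegral_congr (K := fun w => ℓ (C z) * (expKernel ε b w * contourPt φ a w ^ k))
        h.pos.le fun γ hγ x => ?_,
      sectorIntegral_const_mul, h.sectorIntegral_pow_eq_zero φ ha hε, mul_zero]
    rw [← hP.sum_eq _ (hΛ γ hγ x) z, map_sum, Finset.sum_mul]
    refine Finset.sum_congr rfl fun i _ => ?_
    rw [map_smul, smul_eq_mul, pow_add]
    ring

end Moderate

end IsPencilResolvent

theorem abs_eq_imp_forall_ray {P : ℂ → Prop} {β γ : ℝ} (hβ : β ≤ Real.pi)
    (h : ∀ γ ∈ Icc β (2 * Real.pi - β), ∀ x, P (ray γ x)) (hγ : |γ| = β) (x : ℝ) :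
    P (ray γ x) := by
  rcases eq_or_eq_neg_of_abs_eq hγ with rfl | rfl
  · exact h γ ⟨le_rfl, by linarith⟩ x
  · rw [← ray_two_pi_sub]
    exact h _ ⟨by linarith, le_rfl⟩ x

/-! ### Contour integrals of the resolvent that vanish in the limit -/

namespace IsPencilResolvent

variable {X : Type*} [AddCommGroup X] [Module ℂ X] [UniformSpace X]
  {n : ℕ} {q : Fin (n + 1) → ℕ} {A : Fin (n + 1) → X →ₗ.[ℂ] X} {C : X →L[ℂ] X} {ν : ℝ}
  {Λ : Set ℂ} {R : ℂ → X →L[ℂ] X} {B : Fin (n + 1) → ℂ → X → X} {a b β φ : ℝ}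
  (hP : IsPencilResolvent q A C ν Λ R B) (h : KernelAngle b β) (ha : 0 < a)
  (hΛ : ∀ γ ∈ Icc β (2 * Real.pi - β), ∀ x, Λ ∈ 𝓝 (contourPt φ a (ray γ x)))

include hP h ha

theorem exists_bound_zpow_mul {m : ℤ} (hν : ν ≤ 0) (hm : m + ν < -1) :
    ∃ δ : ℝ, 0 < δ ∧ ∀ (p : Seminorm ℂ X) (z : X), Continuous p → ∃ M, ∀ γ x,
      Real.cos γ ≤ |Real.cos β| → contourPt φ a (ray γ x) ∈ Λ →
      ‖contourPt φ a (ray γ x)‖ ^ m * p (R (contourPt φ a (ray γ x)) z) * Real.exp x ≤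
        M * Real.exp (-δ * |x|) := by
  obtain ⟨M', δ, hδ, hM'⟩ := exists_norm_contourPt_rpow_decay φ ha h.pos h.lt_pi hm
  refine ⟨δ, hδ, fun p z hp => ?_⟩
  obtain ⟨M, hM, hMν⟩ := hP.bound z p hp
  refine ⟨M * M', fun γ x hγ hmem => ?_⟩
  set μ := contourPt φ a (ray γ x) with hμ
  have hpos : 0 < ‖μ‖ := norm_pos_iff.2 (h.contourPt_ne_zero φ ha hγ x)
  have h1 : (1 + ‖μ‖) ^ ν ≤ ‖μ‖ ^ ν :=
    Real.rpow_le_rpow_of_nonpos hpos (by linarith) hν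
  calc ‖μ‖ ^ m * p (R μ z) * Real.exp x
      ≤ ‖μ‖ ^ m * (M * ‖μ‖ ^ ν) * Real.exp x := by
        gcongr
        exact (hMν μ hmem).trans (by gcongr)
    _ = M * (‖μ‖ ^ ((m : ℝ) + ν) * Real.exp x) := by
        rw [Real.rpow_add hpos, Real.rpow_intCast]; ring
    _ ≤ M * (M' * Real.exp (-δ * |x|)) := mul_le_mul_of_nonneg_left (hM' x γ hγ) hM
    _ = _ := by ring

include hΛ

/-- The limit is `ℓ y` with `y = ∫ λ^m R(λ) z dw`. Holomorphy is available only after applying `C`: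
`C y = ∫ λ^m R(λ) C z dw` vanishes by Cauchy's theorem in the outer sector, and injectivity of `C`
gives `y = 0`. -/
theorem tendsto_sectorIntegral_zpow_mul [IsUniformAddGroup X] [ContinuousSMul ℂ X]
    [LocallyConvexSpace ℝ X] [T2Space X] (hX : SeqComplete X) (hC : Function.Injective C) {m : ℤ}
    (hν : ν ≤ 0) (hm : m + ν < -1) (z : X) (ℓ : X →L[ℂ] ℂ) :
    Tendsto (fun ε => sectorIntegral β fun w => expKernel ε b w *
      (contourPt φ a w ^ m * ℓ (R (contourPt φ a w) z))) (𝓝[>] 0) (𝓝 0) := by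
  obtain ⟨δ, hδ, hbd⟩ := hP.exists_bound_zpow_mul h ha (φ := φ) hν hm
  have hmem : ∀ γ, |γ| = β → ∀ x, contourPt φ a (ray γ x) ∈ Λ := fun γ hγ x =>
    abs_eq_imp_forall_ray (P := fun w => contourPt φ a w ∈ Λ) h.lt_pi.le
      (fun γ hγ x => mem_of_mem_nhds (hΛ γ hγ x)) hγ x
  have hcont : ∀ γ, |γ| = β → Continuous fun x => contourPt φ a (ray γ x) ^ m := fun γ hγ =>
    ((differentiable_contourPt φ a).continuous.comp (continuous_ray γ)).zpow₀ m fun x =>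
      .inl (h.contourPt_ne_zero φ ha (KernelAngle.cos_le_abs_of_abs_eq hγ) x)
  have hRc : ∀ γ, |γ| = β → Continuous fun x => R (contourPt φ a (ray γ x)) z := fun γ hγ =>
    (hP.continuousOn z).comp_continuous
      ((differentiable_contourPt φ a).continuous.comp (continuous_ray γ)) (hmem γ hγ)
  obtain ⟨y, hy⟩ := exists_sectorIntegral hX h.pos.le
    (Q := fun w => contourPt φ a w ^ m • R (contourPt φ a w) z)
    (fun γ hγ => (hcont γ hγ).smul (hRc γ hγ)) fun p hp => by
      obtain ⟨M, hM⟩ := hbd p z hp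
      refine ⟨_, (integrable_exp_neg_mul_abs hδ).const_mul M, fun γ hγ x => ?_⟩
      have := hM γ x (KernelAngle.cos_le_abs_of_abs_eq hγ) (hmem γ hγ x)
      rwa [map_smul_eq_mul, norm_zpow, mul_comm]
  have hfun : ∀ (ℓ : X →L[ℂ] ℂ) (z : X), ∃ M, ∀ γ x, Real.cos γ ≤ |Real.cos β| →
      contourPt φ a (ray γ x) ∈ Λ →
      ‖contourPt φ a (ray γ x) ^ m * ℓ (R (contourPt φ a (ray γ x)) z)‖ * Real.exp x ≤
        M * Real.exp (-δ * |x|) := fun ℓ z => by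
    obtain ⟨M, hM⟩ := hbd ((normSeminorm ℂ ℂ).comp (ℓ : X →ₗ[ℂ] ℂ)) z
      (continuous_norm.comp ℓ.continuous)
    refine ⟨M, fun γ x hγ hx => ?_⟩
    rw [norm_mul, norm_zpow]
    exact hM γ x hγ hx
  have hy0 : y = 0 := by
    refine hC ?_
    rw [map_zero]
    refine eq_zero_of_forall_functional fun ℓ => ?_
    have h1 := hy (ℓ.comp C)
    rw [ContinuousLinearMap.comp_apply] at h1
    rw [h1, sectorIntegral_congr
      (K := fun w => contourPt φ a w ^ m * ℓ (R (contourPt φ a w) (C z))) h.pos.le fun γ hγ x => by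
        simp [hP.comm (hmem γ hγ x)]]
    obtain ⟨M, hM⟩ := hfun ℓ (C z)
    refine sectorIntegral_eq_zero_of_outside h.lt_pi.le (fun x γ hγ => ?_) hδ fun x γ hγ =>
      hM γ x ((cos_le_of_mem_Icc h.pos.le hγ).trans (le_abs_self _)) (mem_of_mem_nhds (hΛ γ hγ x))
    refine DifferentiableAt.mul ((differentiable_contourPt φ a).differentiableAt.zpow
      (.inl (h.contourPt_ne_zero φ ha ((cos_le_of_mem_Icc h.pos.le hγ).trans (le_abs_self _)) x)))
      ?_
    exact (hP.differentiableAt (hΛ γ hγ x) ℓ z).comp _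
      (differentiable_contourPt φ a).differentiableAt
  obtain ⟨M, hM⟩ := hfun ℓ z
  have h2 := h.tendsto_sectorIntegral hδ (M := M)
    (H := fun w => contourPt φ a w ^ m * ℓ (R (contourPt φ a w) z))
    (fun γ hγ => (hcont γ hγ).mul (ℓ.continuous.comp (hRc γ hγ)))
    fun γ hγ x => hM γ x (KernelAngle.cos_le_abs_of_abs_eq hγ) (hmem γ hγ x)
  have h3 := hy ℓ
  simp only [hy0, map_zero, map_smul, smul_eq_mul] at h3
  rwa [← h3] at h2

end IsPencilResolvent

theorem ModerateOnRays.sectorIntegrable_zpow {V : Type*} [AddCommGroup V] [Module ℂ V]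
    [UniformSpace V] {a b β ε : ℝ} {Q : ℂ → V} (hQ : ModerateOnRays a β Q)
    (h : KernelAngle b β) (hε : 0 < ε) (ha : 0 < a) (φ : ℝ) (m : ℤ) (ℓ : V →L[ℂ] ℂ) :
    SectorIntegrable β fun w => expKernel ε b w * (contourPt φ a w ^ m * ℓ (Q w)) := by
  obtain ⟨d, rfl | rfl⟩ := m.eq_nat_or_neg
  · simpa only [zpow_natCast] using hQ.sectorIntegrable h hε ha.le φ d ℓ
  obtain ⟨C, N, hC, hb⟩ := hQ.bound ((normSeminorm ℂ ℂ).comp (ℓ : V →ₗ[ℂ] ℂ))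
    (continuous_norm.comp ℓ.continuous)
  have hs : 0 < sectorConst β * a := mul_pos (sectorConst_pos h.pos h.lt_pi) ha
  refine h.sectorIntegrable hε ha.le (N := N) (C := ((sectorConst β * a) ^ d)⁻¹ * C)
    (by positivity) (fun γ hγ =>
    (((differentiable_contourPt φ a).continuous.comp (continuous_ray γ)).zpow₀ _ fun x =>
      .inl (h.contourPt_ne_zero φ ha (KernelAngle.cos_le_abs_of_abs_eq hγ) x)).mul
      (ℓ.continuous.comp (hQ.continuous γ hγ))) fun γ hγ x => ?_
  have h1 : ‖ℓ (Q (ray γ x))‖ ≤ C * (a + Real.exp x) ^ N := hb γ hγ x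
  rw [norm_mul, zpow_neg, zpow_natCast, norm_inv, norm_pow, norm_contourPt, mul_assoc]
  gcongr
  refine le_trans ?_ (sectorConst_mul_le_norm ha.le (KernelAngle.cos_le_abs_of_abs_eq hγ) x)
  gcongr
  · exact (sectorConst_pos h.pos h.lt_pi).le
  · linarith [Real.exp_pos x]

theorem GrowthExponent.neg {n : ℕ} {q : Fin (n + 1) → ℕ} {ν : ℝ} (hν : GrowthExponent q ν)
    (hq0 : q 0 = 0) (hq : 0 < q (Fin.last n)) : ν < 0 := by
  have h1 := hν 0 hq 0 (by simp [indexSet, hq0])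
  have h2 : (1 : ℝ) ≤ q (Fin.last n) := by exact_mod_cast hq
  rw [hq0] at h1
  push_cast at h1
  linarith

/-! ### The duality argument -/

namespace IsPencilResolvent

variable {X : Type*} [AddCommGroup X] [Module ℂ X] [UniformSpace X] [IsUniformAddGroup X]
  [ContinuousSMul ℂ X] [LocallyConvexSpace ℝ X] [T2Space X]
  {n : ℕ} {q : Fin (n + 1) → ℕ} {A : Fin (n + 1) → X →ₗ.[ℂ] X} {C : X →L[ℂ] X} {ν : ℝ}
  {Λ : Set ℂ} {R : ℂ → X →L[ℂ] X} {B : Fin (n + 1) → ℂ → X → X} {a b β φ ζ : ℝ}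

/-- A functional that vanishes on the data of all solutions vanishes on `C (⋂ D(A j))`. -/
theorem functional_single_eq_zero (hP : IsPencilResolvent q A C ν Λ R B) (h : KernelAngle b β)
    (ha : 0 < a) (hΛ : ∀ γ ∈ Icc β (2 * Real.pi - β), ∀ x, Λ ∈ 𝓝 (contourPt φ a (ray γ x)))
    (hX : SeqComplete X) (hA : ∀ i, (A i).IsClosed) (hC : Function.Injective C) (hζ : 0 < ζ)
    (hζ2 : ζ ≤ 2) (hb : 1 / ζ < b) (hν : GrowthExponent q ν) (hν0 : ν ≤ 0)
    {ℓ : (Fin (q (Fin.last n)) → X) →L[ℂ] ℂ}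
    (hℓ : ∀ x ∈ solutionData ζ q A (q (Fin.last n)), ℓ x = 0) (ω : Fin (q (Fin.last n))) {ξ : X}
    (hξ : ∀ i, ξ ∈ (A i).domain) : ℓ (Pi.single ω (C ξ)) = 0 := by
  classical
  set c : Fin (n + 1) → X := fun i => A i ⟨ξ, hξ i⟩ with hc
  have hgr : ∀ i, (ξ, c i) ∈ (A i).graph := fun i => LinearPMap.mem_graph (A i) ⟨ξ, hξ i⟩
  let L : Fin (q (Fin.last n)) → X →L[ℂ] ℂ := fun k =>
    ℓ.comp (ContinuousLinearMap.single ℂ (fun _ => X) k)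
  have hL : ∀ k x, L k x = ℓ (Pi.single k x) := fun k x => rfl
  have hLsum : ∀ x, ℓ x = ∑ k, L k (x k) := fun x => by
    simp only [hL]
    rw [← map_sum, Finset.univ_sum_single]
  have hmem : ∀ γ, |γ| = β → ∀ x, contourPt φ a (ray γ x) ∈ Λ := fun γ hγ x =>
    abs_eq_imp_forall_ray (P := fun w => contourPt φ a w ∈ Λ) h.lt_pi.le
      (fun γ hγ x => mem_of_mem_nhds (hΛ γ hγ x)) hγ x
  -- `J` and `K` are the two sides of `∑_j λ^{q_j} R(λ) A_j ξ = C ξ`, multiplied by `λ^{k-1-ω}`,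
  -- under `L k` and integrated against the kernel.
  let J : ℝ → Fin (q (Fin.last n)) → Fin (n + 1) → ℂ := fun ε k j => sectorIntegral β fun w =>
    expKernel ε b w * (contourPt φ a w ^ ((k : ℤ) + q j - 1 - ω) * L k (R (contourPt φ a w) (c j)))
  let K : ℝ → Fin (q (Fin.last n)) → ℂ := fun ε k => L k (C ξ) * sectorIntegral β fun w =>
    expKernel ε b w * contourPt φ a w ^ ((k : ℤ) - 1 - ω)
  -- For `q_j > ω` the exponent is `k + (q_j - 1 - ω)` with a nonnegative shift, so `J ε k j` is `L
  -- k` of an entry of a shifted solution sequence; the sum over `k` is a value of `ℓ` on solution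
  -- data.
  have hJ : ∀ ε, 0 < ε → ∀ j, (ω : ℕ) < q j → ∑ k, J ε k j = 0 := by
    intro ε hε j hj
    obtain ⟨y, e, hsol, hy⟩ := hP.exists_isSolutionSeq ha hmem hX hA h hζ hb hε (c j)
    have h1 := hℓ (fun k => y (k + (q j - 1 - ω)))
      ⟨_, _, hsol.shift hζ hζ2 (q j - 1 - ω), fun _ => rfl⟩
    rw [hLsum] at h1
    rw [← h1]
    refine Finset.sum_congr rfl fun k _ => ?_
    rw [hy]
    have h2 : (k : ℤ) + q j - 1 - ω = ((k + (q j - 1 - ω) : ℕ) : ℤ) := by omega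
    simp only [J, h2, zpow_natCast]
  have hK : ∀ ε, 0 < ε → ∀ k, ∑ j, J ε k j = K ε k := by
    intro ε hε k
    simp only [J, K]
    rw [← sectorIntegral_sum _ fun j _ => (hP.moderateOnRays ha hmem (c j)).sectorIntegrable_zpow
      h hε ha φ _ (L k), ← sectorIntegral_const_mul]
    refine sectorIntegral_congr h.pos.le fun γ hγ x => ?_
    have hne := h.contourPt_ne_zero φ ha (KernelAngle.cos_le_abs_of_abs_eq hγ) x
    rw [← hP.apply_sum _ (hmem γ hγ x) ξ c hgr, map_sum, map_sum, Finset.sum_mul]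
    refine Finset.sum_congr rfl fun j _ => ?_
    rw [map_smul, map_smul, smul_eq_mul,
      show (k : ℤ) + q j - 1 - ω = ((k : ℤ) - 1 - ω) + q j by ring, zpow_add₀ hne, zpow_natCast]
    ring
  -- For `q_j ≤ ω` the growth exponent and `k ≤ q_n - 1` give `(k + q_j - 1 - ω) + ν < -1`, exactly
  -- the required decay.
  have hJ0 : ∀ k j, ¬ (ω : ℕ) < q j → Tendsto (fun ε => J ε k j) (𝓝[>] 0) (𝓝 0) := by
    intro k j hj
    refine hP.tendsto_sectorIntegral_zpow_mul h ha hΛ hX hC hν0 ?_ (c j) (L k)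
    have h1 := hν ω ω.2 j (by simp only [indexSet, mem_ofPred_eq]; omega)
    have h2 : ((k : ℕ) : ℝ) + 1 ≤ q (Fin.last n) := by exact_mod_cast k.2
    push_cast
    linarith
  obtain ⟨κ, hκ, hκt⟩ := h.exists_tendsto_sectorIntegral_inv φ ha
  -- The exponent `k - 1 - ω` is at most `-2` for `k < ω`, equal to `-1` for `k = ω`, and
  -- nonnegative for `k > ω`. Only `k = ω` survives in the limit.
  have hK0 : ∀ k, Tendsto (fun ε => K ε k) (𝓝[>] 0)
      (𝓝 (if k = ω then L ω (C ξ) * κ else 0)) := by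
    intro k
    rcases lt_trichotomy k ω with hk | rfl | hk
    · rw [if_neg hk.ne]
      have := (h.tendsto_sectorIntegral_zpow_zero φ ha
        (m := (k : ℤ) - 1 - ω) (by have : (k : ℕ) < ω := hk; omega)).const_mul (L k (C ξ))
      rwa [mul_zero] at this
    · rw [if_pos rfl]
      refine (hκt.const_mul (L k (C ξ))).congr fun ε => ?_
      simp [K]
    · rw [if_neg hk.ne']
      refine tendsto_const_nhds.congr' ?_
      filter_upwards [self_mem_nhdsWithin] with ε hε
      have h1 : (k : ℤ) - 1 - ω = ((k - 1 - ω : ℕ) : ℤ) := by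
        have : (ω : ℕ) < k := hk
        omega
      simp only [K, h1, zpow_natCast]
      rw [h.sectorIntegral_pow_eq_zero φ ha hε, mul_zero]
  have hlim := tendsto_finsetSum Finset.univ fun k _ => hK0 k
  rw [Finset.sum_ite_eq' Finset.univ ω, if_pos (Finset.mem_univ _)] at hlim
  have hlim' : Tendsto (fun ε => ∑ k, K ε k) (𝓝[>] 0) (𝓝 0) := by
    have h1 := tendsto_finsetSum Finset.univ fun k (_ : k ∈ Finset.univ) =>
      tendsto_finsetSum (Finset.univ.filter fun j => ¬ (ω : ℕ) < q j) fun j hj =>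
        hJ0 k j (Finset.mem_filter.1 hj).2
    simp only [Finset.sum_const_zero] at h1
    refine h1.congr' ?_
    filter_upwards [self_mem_nhdsWithin] with ε hε
    simp only [← hK ε hε, ← Finset.sum_filter_add_sum_filter_not Finset.univ
      (fun j => (ω : ℕ) < q j) (J ε _), Finset.sum_add_distrib]
    rw [Finset.sum_comm (s := Finset.univ) (t := Finset.univ.filter fun j => (ω : ℕ) < q j),
      Finset.sum_eq_zero fun j hj => hJ ε hε j (Finset.mem_filter.1 hj).2, zero_add]
  exact (mul_eq_zero.1 (tendsto_nhds_unique hlim hlim')).resolve_right hκ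

theorem subset_closure_solutionData (hP : IsPencilResolvent q A C ν Λ R B) (h : KernelAngle b β)
    (ha : 0 < a) (hΛ : ∀ γ ∈ Icc β (2 * Real.pi - β), ∀ x, Λ ∈ 𝓝 (contourPt φ a (ray γ x)))
    (hX : SeqComplete X) (hA : ∀ i, (A i).IsClosed) (hC : Function.Injective C) (hζ : 0 < ζ)
    (hζ2 : ζ ≤ 2) (hb : 1 / ζ < b) (hν : GrowthExponent q ν) (hν0 : ν ≤ 0) :
    {x : Fin (q (Fin.last n)) → X | ∀ j, x j ∈ imageOfDomains A C} ⊆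
      closure (solutionData ζ q A (q (Fin.last n)) : Set (Fin (q (Fin.last n)) → X)) := by
  intro x hx
  refine mem_closure_of_forall_functional _ fun ℓ hℓ => ?_
  rw [← Finset.univ_sum_single x, map_sum]
  refine Finset.sum_eq_zero fun ω _ => ?_
  obtain ⟨ξ, hξ, hξx⟩ := hx ω
  rw [← hξx]
  exact hP.functional_single_eq_zero h ha hΛ hX hA hC hζ hζ2 hb hν hν0 hℓ ω hξ

end IsPencilResolvent

/-- This is the choice of parameters. With `α = ζπ/2 + θ`, the lower bound on `θ` says `π - α <
πζ/2` and the upper one says `α < π`. So there are `β` between `π - α` and `πζ/2`, and then `b`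
between `1/ζ` and `π/(2β)`. -/
theorem subset_closure_solutionData {X : Type*} [AddCommGroup X] [Module ℂ X] [UniformSpace X]
    [IsUniformAddGroup X] [ContinuousSMul ℂ X] [LocallyConvexSpace ℝ X] [T2Space X]
    (hX : SeqComplete X) {n : ℕ} {q : Fin (n + 1) → ℕ} (hq0 : q 0 = 0)
    (hq : 0 < q (Fin.last n)) {A : Fin (n + 1) → X →ₗ.[ℂ] X} (hA : ∀ i, (A i).IsClosed)
    {C : X →L[ℂ] X} (hC : Function.Injective C) {ζ φ θ r ν : ℝ} (hζ : 0 < ζ) (hζ2 : ζ ≤ 2)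
    (hθ : θ ∈ Ioo (Real.pi - Real.pi * ζ) (Real.pi - Real.pi * ζ / 2)) (hr : 0 < r)
    (hν : GrowthExponent q ν) {R : ℂ → X →L[ℂ] X} {B : Fin (n + 1) → ℂ → X → X}
    (hP : IsPencilResolvent q A C ν (truncatedSector φ (ζ * Real.pi / 2 + θ) r) R B) :
    {x : Fin (q (Fin.last n)) → X | ∀ j, x j ∈ imageOfDomains A C} ⊆
      closure (solutionData ζ q A (q (Fin.last n)) : Set (Fin (q (Fin.last n)) → X)) := by
  have hpi := Real.pi_pos
  obtain ⟨hθ1, hθ2⟩ := hθ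
  set α := ζ * Real.pi / 2 + θ with hα
  have hα1 : Real.pi - α < Real.pi * ζ / 2 := by linarith
  have hα2 : α < Real.pi := by linarith
  have hζpi : Real.pi * ζ / 2 ≤ Real.pi := by nlinarith
  obtain ⟨β, hβ1, hβ2⟩ := exists_between hα1
  have hβ0 : 0 < β := by linarith
  obtain ⟨b, hb1, hb2⟩ := exists_between (show 1 / ζ < Real.pi / (2 * β) by
    rw [div_lt_div_iff₀ hζ (by positivity)]; linarith)
  have h : KernelAngle b β := ⟨(by positivity : 0 < 1 / ζ).trans hb1, hβ0, by linarith, by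
    rw [lt_div_iff₀ (by positivity)] at hb2; linarith⟩
  have hs := sectorConst_pos h.pos h.lt_pi
  -- This `a` makes the lower bound `sectorConst β * a` for the modulus on the contour equal to `r +
  -- 1`.
  refine hP.subset_closure_solutionData h (a := (r + 1) / sectorConst β) (by positivity)
    (fun γ hγ x => contourPt_mem_nhds (by positivity) (by linarith) hα2 hβ1.le h.lt_pi ?_ hγ x)
    hX hA hC hζ hζ2 hb1 hν (hν.neg hq0 hq).le
  rw [mul_div_cancel₀ _ hs.ne']
  linarith

end

end MultiTermCaputo

/-! ### Conclusion for the four ranges of `ζ` -/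

theorem mainTheorem1
    {X : Type*} [AddCommGroup X] [Module ℂ X] [UniformSpace X] [IsUniformAddGroup X]
    [ContinuousSMul ℂ X] [LocallyConvexSpace ℝ X] [T2Space X] (hX : SeqComplete X)
    (n : ℕ) (hn : 1 ≤ n) (q : Fin (n + 1) → ℕ) (hq0 : q 0 = 0) (hq : Monotone q)
    (hqpos : ∀ i, i ≠ 0 → 0 < q i)
    (A : Fin (n + 1) → X →ₗ.[ℂ] X) (hA : ∀ i, (A i).IsClosed)
    (C : X →L[ℂ] X) (hC : Function.Injective C)
    (hCA : ∀ i, ∀ x y : X, (x, y) ∈ (A i).graph → (C x, C y) ∈ (A i).graph)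
    (ζ φ θ r ν : ℝ) (hζ : 0 < ζ) (hζ2 : ζ ≤ 2)
    (hφ : φ ∈ Ioc (-Real.pi) Real.pi)
    (hθ : θ ∈ Ioo (Real.pi - Real.pi * ζ) (Real.pi - Real.pi * ζ / 2))
    (hr : 0 < r) (hν : GrowthExponent q ν)
    -- `R μ = (∑ μ ^ q i • A i)⁻¹ C` for `μ` in the truncated sector
    (R : ℂ → X →L[ℂ] X)
    (hR : ∀ μ ∈ truncatedSector φ (ζ * Real.pi / 2 + θ) r,
      IsRegularizedInverse (pencil q A μ) C (R μ))
    (hRequi : Equicontinuous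
      (fun (μ : truncatedSector φ (ζ * Real.pi / 2 + θ) r) (x : X) =>
        (1 + ‖(μ : ℂ)‖) ^ (-ν) • R μ x))
    (hRcont : ∀ x : X, ContinuousOn (fun μ : ℂ => (1 + ‖μ‖) ^ (-ν) • R μ x)
      (truncatedSector φ (ζ * Real.pi / 2 + θ) r))
    -- `S i μ = A i ∘ R μ` for `i < n` and `μ` in the truncated sector
    (S : Fin (n + 1) → ℂ → X →L[ℂ] X)
    (hS : ∀ i, i ≠ Fin.last n → ∀ μ ∈ truncatedSector φ (ζ * Real.pi / 2 + θ) r,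
      ∀ x : X, (R μ x, S i μ x) ∈ (A i).graph)
    (hScont : ∀ i, i ≠ Fin.last n → ∀ x : X,
      ContinuousOn (fun μ : ℂ => S i μ x) (truncatedSector φ (ζ * Real.pi / 2 + θ) r))
    (hSequi : ∀ i, i ≠ Fin.last n → ∃ v : ℕ, Equicontinuous
      (fun (μ : truncatedSector φ (ζ * Real.pi / 2 + θ) r) (x : X) =>
        (1 + ‖(μ : ℂ)‖) ^ (-(v : ℝ)) • S i μ x)) :
    (ζ < 1 →
      {x : Fin (q (Fin.last n)) → X | ∀ j, x j ∈ imageOfDomains A C} ⊆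
        closure (initialData ζ (q (Fin.last n)) (IsAnalyticalSolution ζ q A))) ∧
    (1 < ζ → ζ < 2 →
      {p : (Fin (q (Fin.last n)) → X) × (Fin (q (Fin.last n)) → X) |
          ∀ j, p.1 j ∈ imageOfDomains A C ∧ p.2 j ∈ imageOfDomains A C} ⊆
        closure (initialData₂ ζ (q (Fin.last n)) (IsAnalyticalSolution ζ q A))) ∧
    (ζ = 1 →
      {x : Fin (q (Fin.last n)) → X | ∀ j, x j ∈ imageOfDomains A C} ⊆
        closure (initialData ζ (q (Fin.last n)) (IsEntireSolution ζ q A))) ∧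
    (ζ = 2 →
      {p : (Fin (q (Fin.last n)) → X) × (Fin (q (Fin.last n)) → X) |
          ∀ j, p.1 j ∈ imageOfDomains A C ∧ p.2 j ∈ imageOfDomains A C} ⊆
        closure (initialData₂ ζ (q (Fin.last n)) (IsEntireSolution ζ q A))) := by
  obtain ⟨B, hP⟩ := exists_isPencilResolvent A hCA hr (fun μ hμ => hμ.2) hR hRequi hRcont hS
    hScont hSequi
  have hlast : Fin.last n ≠ 0 := fun h => by simp [Fin.ext_iff] at h; omega
  have hD := subset_closure_solutionData hX hq0 (hqpos _ hlast) hA hC hζ hζ2 hθ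
    hr hν hP
  have h0 : IsSolutionSeq ζ q A 0 0 := IsSolutionSeq.zero
  refine ⟨fun _ => ?_, fun h1 _ => ?_, fun h1 => ?_, fun h2 => ?_⟩
  · exact subset_closure_initialData hX hζ hζ2
      (fun y a hy => hy.isAnalyticalSolution hX hζ hζ2 h0 (.inl rfl) hA) hD
  · exact subset_closure_initialData₂ hX h1 hζ2
      (fun y a z b hy hz => hy.isAnalyticalSolution hX hζ hζ2 hz (.inr h1) hA) hD
  · exact subset_closure_initialData hX hζ hζ2
      (fun y a hy => hy.isEntireSolution hX hA h0 (.inl ⟨rfl, h1⟩)) hD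
  · exact subset_closure_initialData₂ hX (by linarith) hζ2
      (fun y a z b hy hz => hy.isEntireSolution hX hA hz (.inr h2)) hD
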